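/- Let $P>0$, $\sigma_1,\sigma_2>0$, $-1\le r\le 1$, $\tilde P>\tilde\sigma^2>0$, and $$K_Z=\begin{bmatrix}\sigma_1^2& r\sigma_1\sigma_2\\ r\sigma_1\sigma_2&\sigma_2^2\end{bmatrix}.$$ **Setup 1 (broadcast channel with multiple-access feedback).** At each time $n=1,\dots,N$, Terminal A sends $X_n$, and Terminal $B_i$ ($i=1,2$) receives $Y_{i,n}=X_n+Z_{i,n}$, where the pairs $(Z_{1,n},Z_{2,n})$ are i.i.d. centred Gaussian with covariance $K_Z$. Then $B_i$ sends $\tilde X_{i,n}$, and A receives $\tilde Y_n=\tilde X_{1,n}+\tilde X_{2,n}+\tilde Z_n$, where the $\tilde Z_n$ are i.i.d. $\mathcal N(0,\tilde\sigma^2)$ and independent of the $Z$'s. The messages $W_1,W_2$ are known to A, independent, and uniform on finite sets of sizes $M_1,M_2$. The signal $X_n$ is a function of $(W_1,W_2,\tilde Y^{n-1})$ and $\tilde X_{i,n}$ is a function of $Y_i^n$; both may also depend on common randomness shared by the terminals. The power constraints are $\sum_{n}\mathbb E X_n^2\le NP$ and $\sum_n\mathbb E\tilde X_{i,n}^2\le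 N\tilde P$ for $i=1,2$. **Setup 2 (noiseless feedback).** The forward channel is as above, but with noise covariance $$K_{\rm eq}=K_Z+\tilde\sigma^2\tfrac{P}{\tilde P}\begin{bmatrix}1&1\\1&1\end{bmatrix}$$ and power $P_{\rm eq}=P\left(1-\tilde\sigma^2/\tilde P\right)$, and at time $n$ Terminal A knows $Y_1^{n-1},Y_2^{n-1}$. A *linear-feedback coding (LFC) scheme* of length $N$ transmits $$X_n=\Theta_n(W_1,W_2)-\sum_{i=1}^2\Phi_{i,n},\qquad \Phi_{i,n}=\sum_{j<n}a_{i,n,j}Y_{i,j}.$$ It has *constant transmission power* if $\mathbb E X_n^2=P_{\rm eq}$ for every $n$. One has $X_n=\bar\Theta_n(W_1,W_2)-(\text{a linear combination of the past noises})$ for a unique $\bar\Theta_n$. In either setup, the rates of a scheme of length $N$ are $R_i=\frac1N\log_2 M_i$, and its error probability is the probability, under the optimal decision rule, that at least one of $B_1,B_2$ errs in decoding its own message from its channel outputs (and the common randomness). A sequence of schemes *achieves* $(R_1,R_2)$ if their lengths tend to infinity, their rates tend to $(R_1,R_2)$ and their error probabilities tend to $0$. **Modulo-lattice LFC (MLLFC)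 scheme.** This is an interactive scheme for Setup 1, built as follows from an LFC scheme of length $N_C$ with coefficients $\Theta_n,a_{i,n,j}$, a lattice $\Lambda\subset\mathbb R^{N_\Lambda}$ of full rank, and scalars $\gamma_n>0$. Here $\mathbf x \bmod\Lambda=\mathbf x-Q_\Lambda(\mathbf x)$, where $Q_\Lambda$ is nearest-neighbour quantization with ties broken consistently with translations by $\Lambda$. It runs $2N_\Lambda$ instances $(\ell,\pi)\in[N_\Lambda]\times\{0,1\}$ of the LFC scheme, with independent messages, in $2N_\Lambda N_C$ rounds. These rounds are divided into consecutive blocks of length $N_\Lambda$, ordered $(1,0),(1,1),(2,0),(2,1),\dots,(N_C,0),(N_C,1)$. The $\ell$-th round of block $(n,\pi)$ carries step $n$ of instance $(\ell,\pi)$. Bold letters denote vectors indexed by $\ell\in[N_\Lambda]$. The common randomness consists of dithers $\mathbf V_{i,n}$, one for each user and each block, i.i.d. uniform on the Voronoi cell $\{\mathbf x:Q_\Lambda(\mathbf x)=\mathbf 0\}$. In the blocks $n=1$, Terminal A sends $\mathbf X_1=\boldsymbol\Theta_1$. For every block $(n,\pi)$ with $n\ge2$: during the block that precedes it, $B_i$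 sends $$\tilde{\mathbf X}_i=\left[\gamma_n\boldsymbol\Phi_{i,n}+\mathbf V_{i,n}\right]\bmod\Lambda,$$ where $\boldsymbol\Phi_{i,n}$ is computed from its outputs in the blocks $(j,\pi)$, $j<n$; Terminal A, having received $\tilde{\mathbf Y}$ during that preceding block, then sends in block $(n,\pi)$ $$\mathbf X_n=\gamma_n^{-1}\mathbf K_n+\bar{\boldsymbol\Theta}_n,\qquad \mathbf K_n=\left[\gamma_n\boldsymbol\Theta_n-\left(\tilde{\mathbf Y}-\mathbf V_{1,n}-\mathbf V_{2,n}\right)-\gamma_n\bar{\boldsymbol\Theta}_n\right]\bmod\Lambda.$$ In the remaining rounds (the first and the last block) nothing is sent over the feedback link. **Theorem.** For every pair $(R_1,R_2)$ and every sequence of LFC schemes with constant transmission power $P_{\rm eq}$ that achieves $(R_1,R_2)$ in Setup 2, there is a sequence of MLLFC schemes that satisfy the power constraints of Setup 1 and achieve $(R_1,R_2)$ in Setup 1. -/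

import Mathlib

open MeasureTheory ProbabilityTheory Filter
open scoped ENNReal Topology Matrix

namespace BCFeedback

noncomputable section

/-! ### Channels: users are indexed by `Fin 2`, time by `Fin N` -/

/-- A pair of forward noise samples `(Z₁, Z₂)`. -/
abbrev NoisePair : Type := EuclideanSpace ℝ (Fin 2)

/-- The covariance matrix with variances `σ₁², σ₂²` and correlation coefficient `r`. -/
def noiseCov (σ₁ σ₂ r : ℝ) : Matrix (Fin 2) (Fin 2) ℝ :=
  !![σ₁ ^ 2, r * σ₁ * σ₂; r * σ₁ * σ₂, σ₂ ^ 2]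

/-- Law of the forward noise over `N` rounds: independent over time, each pair being centred
Gaussian with covariance matrix `K`. -/
def bcNoise (N : ℕ) (K : Matrix (Fin 2) (Fin 2) ℝ) : Measure (Fin N → NoisePair) :=
  Measure.pi fun _ => multivariateGaussian 0 K

/-- Law of the feedback noise over `N` rounds: i.i.d. centred Gaussian of variance `v`. -/
def macNoise (N : ℕ) (v : ℝ) : Measure (Fin N → ℝ) :=
  Measure.pi fun _ => gaussianReal 0 v.toNNReal

/-- Average of `f` over a message that is uniform on a finite set. -/
def uniformAvg {W : Type} [Fintype W] (f : W → ℝ≥0∞) : ℝ≥0∞ :=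
  (∑ w, f w) / Fintype.card W

/-- Error probability under the optimal decision rule: the infimum, over all pairs of (measurable)
decoders, of the probability that at least one receiver `i` errs on its message `w i`, where
receiver `i` observes `obs w ω i`. The messages are independent and uniform, and independent of
`ω ∼ μ`. -/
def optErrorProb {W : Fin 2 → Type} [∀ i, Fintype (W i)] {Ω O : Type} [MeasurableSpace Ω]
    [MeasurableSpace O] (μ : Measure Ω) (obs : (∀ i, W i) → Ω → Fin 2 → O) : ℝ≥0∞ :=
  ⨅ g : {g : (i : Fin 2) → O → W i // ∀ i a, MeasurableSet (g i ⁻¹' {a})},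
    uniformAvg fun w : (∀ i, W i) => μ {ω | ∃ i, g.1 i (obs w ω i) ≠ w i}

/-- Mean power `E[x²]`, over uniform messages and `ω ∼ μ`. -/
def meanPower {W : Fin 2 → Type} [∀ i, Fintype (W i)] {Ω : Type} [MeasurableSpace Ω]
    (μ : Measure Ω) (x : (∀ i, W i) → Ω → ℝ) : ℝ≥0∞ :=
  uniformAvg fun w : (∀ i, W i) => ∫⁻ ω, ENNReal.ofReal (x w ω ^ 2) ∂μ

/-! ### Linear feedback coding over the broadcast channel with noiseless feedback -/

/-- A linear-feedback coding scheme: `N` rounds, message sets `Fin (M i)`, codebook elements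
`codebook n w`, and coefficients `coef i n j` of which only those with `j < n` are used. -/
structure LFC where
  N : ℕ
  M : Fin 2 → ℕ
  M_pos : ∀ i, 0 < M i
  codebook : Fin N → (∀ i, Fin (M i)) → ℝ
  coef : Fin 2 → Fin N → Fin N → ℝ

namespace LFC

/-- The channel input `X_n = Θ_n(w) - ∑_i ∑_{j<n} a_{i,n,j} Y_{i,j}`, with `Y_{i,j} = X_j + Z_{i,j}`,
when the forward noise is `z`. -/
def input (S : LFC) (w : ∀ i, Fin (S.M i)) (z : Fin S.N → NoisePair) (n : Fin S.N) : ℝ :=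
  S.codebook n w - ∑ i : Fin 2, ∑ j : Set.Iio n, S.coef i n j * (S.input w z j + z j i)
termination_by n.val
decreasing_by exact j.2

/-- The channel outputs of the two receivers. -/
def output (S : LFC) (w : ∀ i, Fin (S.M i)) (z : Fin S.N → NoisePair) (i : Fin 2) (n : Fin S.N) :
    ℝ :=
  S.input w z n + z n i

/-- The codebook element `Θ̄_n` of the equivalent form `X_n = Θ̄_n(w) - (linear function of the past
noises)`: it is the channel input in the absence of noise. -/
def codebookBar (S : LFC) (n : Fin S.N) (w : ∀ i, Fin (S.M i)) : ℝ :=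
  S.input w 0 n

def rate (S : LFC) (i : Fin 2) : ℝ := Real.logb 2 (S.M i) / S.N

def errorProb (S : LFC) (K : Matrix (Fin 2) (Fin 2) ℝ) : ℝ≥0∞ :=
  optErrorProb (W := fun i => Fin (S.M i)) (bcNoise S.N K) S.output

/-- Constant transmission power: `E[X_n²] = Q` in every round `n`. -/
def HasConstantPower (S : LFC) (K : Matrix (Fin 2) (Fin 2) ℝ) (Q : ℝ) : Prop :=
  ∀ n, meanPower (W := fun i => Fin (S.M i)) (bcNoise S.N K) (fun w z => S.input w z n) =
    ENNReal.ofReal Q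

end LFC

/-! ### Interactive schemes over the broadcast channel with multiple-access feedback -/

/-- An interactive scheme over `N` rounds, with message sets `W i` and common randomness
`u ∼ common`: Terminal A sends `enc n w u (past feedback outputs)`, and Terminal `B_i` sends
`fb i n u (own outputs up to and including time n)` over the feedback link. -/
structure InteractiveScheme (N : ℕ) (W : Fin 2 → Type) (U : Type) [MeasurableSpace U] where
  common : Measure U
  isProb : IsProbabilityMeasure common
  enc : (n : Fin N) → (∀ i, W i) → U → (Set.Iio n → ℝ) → ℝ
  fb : Fin 2 → (n : Fin N) → U → (Set.Iic n → ℝ) → ℝ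
  measurable_enc : ∀ n w, Measurable fun p : U × (Set.Iio n → ℝ) => enc n w p.1 p.2
  measurable_fb : ∀ i n, Measurable fun p : U × (Set.Iic n → ℝ) => fb i n p.1 p.2

/-- A sample of all the randomness besides the messages: forward noise, feedback noise, common
randomness. -/
abbrev Sample (N : ℕ) (U : Type) : Type := ((Fin N → NoisePair) × (Fin N → ℝ)) × U

namespace InteractiveScheme

variable {N : ℕ} {W : Fin 2 → Type} {U : Type} [MeasurableSpace U]

/-- The feedback channel output `Ỹ_n = X̃_{1,n} + X̃_{2,n} + Z̃_n` at Terminal A. -/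
def macOutput (S : InteractiveScheme N W U) (w : ∀ i, W i) (ω : Sample N U) (n : Fin N) : ℝ :=
  (∑ i : Fin 2, S.fb i n ω.2 fun m : Set.Iic n =>
    (S.enc m w ω.2 fun j : Set.Iio m.1 => S.macOutput w ω j) + ω.1.1 m i) + ω.1.2 n
termination_by n.val
decreasing_by exact lt_of_lt_of_le (Fin.lt_def.1 j.2) (Fin.le_def.1 m.2)

/-- The forward channel input `X_n`. -/
def input (S : InteractiveScheme N W U) (w : ∀ i, W i) (ω : Sample N U) (n : Fin N) : ℝ :=
  S.enc n w ω.2 fun j : Set.Iio n => S.macOutput w ω j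

/-- The forward channel outputs `Y_{i,n} = X_n + Z_{i,n}`. -/
def output (S : InteractiveScheme N W U) (w : ∀ i, W i) (ω : Sample N U) (i : Fin 2) (n : Fin N) :
    ℝ :=
  S.input w ω n + ω.1.1 n i

/-- The feedback channel inputs `X̃_{i,n}`. -/
def fbInput (S : InteractiveScheme N W U) (w : ∀ i, W i) (ω : Sample N U) (i : Fin 2)
    (n : Fin N) : ℝ :=
  S.fb i n ω.2 fun m : Set.Iic n => S.output w ω i m

/-- Forward noise, feedback noise and common randomness are independent. -/
def law (S : InteractiveScheme N W U) (K : Matrix (Fin 2) (Fin 2) ℝ) (v : ℝ) :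
    Measure (Sample N U) :=
  ((bcNoise N K).prod (macNoise N v)).prod S.common

variable [∀ i, Fintype (W i)]

def rate (_S : InteractiveScheme N W U) (i : Fin 2) : ℝ := Real.logb 2 (Fintype.card (W i)) / N

/-- Receiver `i` decides from its channel outputs and the common randomness. -/
def errorProb (S : InteractiveScheme N W U) (K : Matrix (Fin 2) (Fin 2) ℝ) (v : ℝ) : ℝ≥0∞ :=
  optErrorProb (S.law K v) fun w ω i => (S.output w ω i, ω.2)

/-- `∑_n E[X_n²] ≤ N P`, and `∑_n E[X̃_{i,n}²] ≤ N P̃` for both `i`. -/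
def SatisfiesPower (S : InteractiveScheme N W U) (K : Matrix (Fin 2) (Fin 2) ℝ) (v P Pt : ℝ) :
    Prop :=
  ∑ n, meanPower (S.law K v) (fun w ω => S.input w ω n) ≤ ENNReal.ofReal (N * P) ∧
  ∀ i, ∑ n, meanPower (S.law K v) (fun w ω => S.fbInput w ω i n) ≤ ENNReal.ofReal (N * Pt)

end InteractiveScheme

/-! ### Lattices -/

/-- A lattice `Λ = G ℤ^L`, with a (measurable) nearest-neighbour quantizer whose ties are broken
consistently over `Λ`, so that the modulo operation is constant on the cosets of `Λ`. -/
structure ModLattice (L : ℕ) where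
  G : Matrix (Fin L) (Fin L) ℝ
  det_ne_zero : G.det ≠ 0
  quant : (Fin L → ℝ) → (Fin L → ℝ)
  measurable_quant : Measurable quant
  quant_mem : ∀ x, ∃ k : Fin L → ℤ, quant x = G *ᵥ fun i => (k i : ℝ)
  nearest : ∀ x (k : Fin L → ℤ),
    ∑ i, (x i - quant x i) ^ 2 ≤ ∑ i, (x i - (G *ᵥ fun j => (k j : ℝ)) i) ^ 2
  quant_add : ∀ x (k : Fin L → ℤ),
    quant (x + G *ᵥ fun i => (k i : ℝ)) = quant x + G *ᵥ fun i => (k i : ℝ)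

namespace ModLattice

variable {L : ℕ}

/-- The modulo-`Λ` operation. -/
def modulo (Λ : ModLattice L) (x : Fin L → ℝ) : Fin L → ℝ := x - Λ.quant x

/-- The fundamental (Voronoi) cell. -/
def cell (Λ : ModLattice L) : Set (Fin L → ℝ) := {x | Λ.quant x = 0}

/-- The uniform distribution on the fundamental cell. -/
def uniformCell (Λ : ModLattice L) : Measure (Fin L → ℝ) := cond volume Λ.cell

lemma measurable_modulo (Λ : ModLattice L) : Measurable Λ.modulo :=
  measurable_id.sub Λ.measurable_quant

lemma measurableSet_cell (Λ : ModLattice L) : MeasurableSet Λ.cell :=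
  Λ.measurable_quant (measurableSet_singleton 0)

lemma volume_cell_ne_zero (Λ : ModLattice L) : volume Λ.cell ≠ 0 := by
  intro h0
  have hU : (⋃ k : Fin L → ℤ, (fun x => x + -(Λ.G *ᵥ fun i => (k i : ℝ))) ⁻¹' Λ.cell) =
      Set.univ := by
    refine Set.eq_univ_of_forall fun x => Set.mem_iUnion.2 ?_
    obtain ⟨k, hk⟩ := Λ.quant_mem x
    refine ⟨k, ?_⟩
    have h := Λ.quant_add (x + -(Λ.G *ᵥ fun i => (k i : ℝ))) k
    rw [neg_add_cancel_right, hk] at h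
    exact (right_eq_add.1 h)
  have : volume (Set.univ : Set (Fin L → ℝ)) = 0 := by
    rw [← hU]
    refine measure_iUnion_null fun k => ?_
    rw [measure_preimage_add_right, h0]
  exact (NeZero.ne (volume : Measure (Fin L → ℝ))) (Measure.measure_univ_eq_zero.1 this)

lemma volume_cell_ne_top (Λ : ModLattice L) : volume Λ.cell ≠ ⊤ := by
  set B : ℝ := ∑ i, (∑ j, |Λ.G i j|) ^ 2 with hB
  have hsub : Λ.cell ⊆ Set.Icc (fun _ => -(B + 1)) (fun _ => B + 1) := by
    intro x hx
    have hx0 : Λ.quant x = 0 := hx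
    set c : Fin L → ℝ := Λ.G⁻¹ *ᵥ x with hc
    have hGc : Λ.G *ᵥ c = x := by
      rw [hc, Matrix.mulVec_mulVec, Matrix.mul_nonsing_inv _ (Ne.isUnit Λ.det_ne_zero),
        Matrix.one_mulVec]
    have h1 := Λ.nearest x fun i => ⌊c i⌋
    have h2 : ∀ i, (x i - (Λ.G *ᵥ fun j => ((⌊c j⌋ : ℤ) : ℝ)) i) ^ 2 ≤ (∑ j, |Λ.G i j|) ^ 2 := by
      intro i
      have : x i - (Λ.G *ᵥ fun j => ((⌊c j⌋ : ℤ) : ℝ)) i = ∑ j, Λ.G i j * Int.fract (c j) := by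
        conv_lhs => rw [← hGc]
        simp only [Matrix.mulVec, dotProduct, ← Finset.sum_sub_distrib, ← mul_sub]
        rfl
      rw [this, sq_le_sq, abs_of_nonneg (Finset.sum_nonneg fun j _ => abs_nonneg (Λ.G i j))]
      refine (Finset.abs_sum_le_sum_abs _ _).trans (Finset.sum_le_sum fun j _ => ?_)
      rw [abs_mul, abs_of_nonneg (Int.fract_nonneg (c j))]
      exact mul_le_of_le_one_right (abs_nonneg _) (Int.fract_lt_one _).le
    have h3 : ∀ i, x i ^ 2 ≤ B := by
      intro i
      have h4 : x i ^ 2 ≤ ∑ i, (x i - Λ.quant x i) ^ 2 := by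
        simp only [hx0, Pi.zero_apply, sub_zero]
        exact Finset.single_le_sum (f := fun i => x i ^ 2) (fun j _ => sq_nonneg _)
          (Finset.mem_univ i)
      exact h4.trans (h1.trans (Finset.sum_le_sum fun i _ => h2 i))
    have h5 : ∀ i, |x i| ≤ B + 1 := by
      intro i
      have := h3 i
      rw [← sq_abs] at this
      nlinarith [sq_nonneg (|x i| - 1), abs_nonneg (x i)]
    exact ⟨fun i => (abs_le.1 (h5 i)).1, fun i => (abs_le.1 (h5 i)).2⟩
  exact ((measure_mono hsub).trans_lt isCompact_Icc.measure_lt_top).ne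

instance (Λ : ModLattice L) : IsProbabilityMeasure Λ.uniformCell :=
  cond_isProbabilityMeasure_of_finite Λ.volume_cell_ne_zero Λ.volume_cell_ne_top

end ModLattice

/-! ### Modulo-lattice linear-feedback coding -/

/-- Data of a modulo-lattice LFC scheme: an LFC scheme, a lattice of dimension `L` and scaling
factors. Twice `L` instances `(ℓ, π) ∈ Fin L × Fin 2` of the LFC scheme are interleaved in time. -/
structure MLLFC where
  lfc : LFC
  L : ℕ
  L_pos : 0 < L
  lattice : ModLattice L
  γ : Fin lfc.N → ℝ
  γ_pos : ∀ n, 0 < γ n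

namespace MLLFC

/-- Message sets: one message of the LFC scheme per instance. -/
abbrev Msg (C : MLLFC) (i : Fin 2) : Type := Fin C.L × Fin 2 → Fin (C.lfc.M i)

/-- Number of rounds. -/
abbrev len (C : MLLFC) : ℕ := C.lfc.N * 2 * C.L

/-- Blocks are numbered consecutively, block `(n, π)` having number `2 n + π`. -/
abbrev Block (C : MLLFC) : Type := Fin (C.lfc.N * 2)

def step (C : MLLFC) (b : C.Block) : Fin C.lfc.N := (finProdFinEquiv.symm b).1

def parity (C : MLLFC) (b : C.Block) : Fin 2 := (finProdFinEquiv.symm b).2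

def block (C : MLLFC) (n : Fin C.lfc.N) (π : Fin 2) : C.Block := finProdFinEquiv (n, π)

/-- The `ℓ`-th round of block `b`, which is round `L b + ℓ`. -/
def time (C : MLLFC) (b : C.Block) (ℓ : Fin C.L) : Fin C.len := finProdFinEquiv (b, ℓ)

def blockOf (C : MLLFC) (t : Fin C.len) : C.Block := (finProdFinEquiv.symm t).1

def posOf (C : MLLFC) (t : Fin C.len) : Fin C.L := (finProdFinEquiv.symm t).2

/-- Common randomness: a dither vector for each user and each block. -/
abbrev Dither (C : MLLFC) : Type := Fin 2 → C.Block → Fin C.L → ℝ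

/-- The dithers are i.i.d. uniform on the fundamental cell. -/
def ditherLaw (C : MLLFC) : Measure C.Dither :=
  Measure.pi fun _ => Measure.pi fun _ => C.lattice.uniformCell

/-- Messages of instance `(ℓ, π)`. -/
def msg (C : MLLFC) (w : ∀ i, C.Msg i) (ℓ : Fin C.L) (π : Fin 2) : ∀ i, Fin (C.lfc.M i) :=
  fun i => w i (ℓ, π)

/-- The vector of the codebook elements `Θ_n` used in block `b = (n, π)`. -/
def codeVec (C : MLLFC) (w : ∀ i, C.Msg i) (b : C.Block) : Fin C.L → ℝ :=
  fun ℓ => C.lfc.codebook (C.step b) (C.msg w ℓ (C.parity b))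

/-- The vector of the codebook elements `Θ̄_n` used in block `b = (n, π)`. -/
def codeBarVec (C : MLLFC) (w : ∀ i, C.Msg i) (b : C.Block) : Fin C.L → ℝ :=
  fun ℓ => C.lfc.codebookBar (C.step b) (C.msg w ℓ (C.parity b))

/-- A partially known sequence, completed by zeros. -/
def complete {N : ℕ} {s : Set (Fin N)} (y : s → ℝ) (j : Fin N) : ℝ :=
  open Classical in if h : j ∈ s then y ⟨j, h⟩ else 0

/-- The vector of the feedback elements of user `i` for block `b = (n, π)`, computed from the outputs
of user `i` in the earlier blocks of the same parity. -/
def fbVec (C : MLLFC) (i : Fin 2) (b : C.Block) (y : Fin C.len → ℝ) : Fin C.L → ℝ :=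
  fun ℓ => ∑ j : Set.Iio (C.step b),
    C.lfc.coef i (C.step b) j * y (C.time (C.block j (C.parity b)) ℓ)

/-- Transmission of Terminal A at time `t`, in block `b = (n, π)`. In the first step `n = 0` there
are no feedback elements, and the codebook element is sent. Later, the feedback outputs `Ỹ` of the
preceding block give `K = [γ Θ - (Ỹ - V₁ - V₂) - γ Θ̄] mod Λ`, and `γ⁻¹ K + Θ̄` is sent. -/
def encFun (C : MLLFC) (t : Fin C.len) (w : ∀ i, C.Msg i) (u : C.Dither)
    (y : Set.Iio t → ℝ) : ℝ :=
  let b := C.blockOf t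
  let γ := C.γ (C.step b)
  if (C.step b).val = 0 then C.codeVec w b (C.posOf t)
  else
    let Yt : Fin C.L → ℝ := fun ℓ =>
      complete y (C.time ⟨b.val - 1, lt_of_le_of_lt (Nat.sub_le _ _) b.2⟩ ℓ)
    let Kv := C.lattice.modulo (γ • C.codeVec w b - (Yt - ∑ i, u i b) - γ • C.codeBarVec w b)
    γ⁻¹ * Kv (C.posOf t) + C.codeBarVec w b (C.posOf t)

/-- Transmission of Terminal `B_i` at time `t`: it serves the block `b` following that of `t`, and is
`[γ φ_i + V_i] mod Λ` where `φ_i` are the feedback elements for that block. Nothing is sent if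
there is no such block, or if it is in the first step and so uses no feedback. -/
def fbFun (C : MLLFC) (i : Fin 2) (t : Fin C.len) (u : C.Dither) (y : Set.Iic t → ℝ) : ℝ :=
  if h : (C.blockOf t).val + 1 < C.lfc.N * 2 then
    let b : C.Block := ⟨(C.blockOf t).val + 1, h⟩
    if (C.step b).val = 0 then 0
    else C.lattice.modulo (C.γ (C.step b) • C.fbVec i b (complete y) + u i b) (C.posOf t)
  else 0

lemma measurable_complete {N : ℕ} {s : Set (Fin N)} (j : Fin N) :
    Measurable fun y : s → ℝ => complete y j := by
  unfold complete
  split_ifs with h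
  · exact measurable_pi_apply _
  · exact measurable_const

lemma measurable_encFun (C : MLLFC) (t : Fin C.len) (w : ∀ i, C.Msg i) :
    Measurable fun p : C.Dither × (Set.Iio t → ℝ) => C.encFun t w p.1 p.2 := by
  unfold encFun
  simp only
  split_ifs with h
  · exact measurable_const
  · refine (measurable_const.mul ?_).add measurable_const
    refine (measurable_pi_apply (C.posOf t)).comp (C.lattice.measurable_modulo.comp ?_)
    refine (measurable_const.sub (Measurable.sub ?_ ?_)).sub measurable_const
    · exact measurable_pi_lambda _ fun ℓ => (measurable_complete _).comp measurable_snd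
    · exact Finset.measurable_sum _ fun i _ =>
        (measurable_pi_apply _).comp ((measurable_pi_apply i).comp measurable_fst)

lemma measurable_fbFun (C : MLLFC) (i : Fin 2) (t : Fin C.len) :
    Measurable fun p : C.Dither × (Set.Iic t → ℝ) => C.fbFun i t p.1 p.2 := by
  unfold fbFun
  simp only
  split_ifs with h h'
  · exact measurable_const
  · refine (measurable_pi_apply (C.posOf t)).comp (C.lattice.measurable_modulo.comp ?_)
    refine Measurable.add (measurable_pi_lambda _ fun ℓ => Measurable.const_mul ?_ _) ?_
    · unfold fbVec
      exact Finset.measurable_sum _ fun j _ =>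
        ((measurable_complete _).comp measurable_snd).const_mul _
    · exact (measurable_pi_apply _).comp ((measurable_pi_apply i).comp measurable_fst)
  · exact measurable_const

/-- The interactive scheme of a modulo-lattice LFC scheme. -/
def toScheme (C : MLLFC) : InteractiveScheme C.len C.Msg C.Dither where
  common := C.ditherLaw
  isProb := by unfold ditherLaw; infer_instance
  enc := C.encFun
  fb := C.fbFun
  measurable_enc := C.measurable_encFun
  measurable_fb := C.measurable_fbFun

end MLLFC

end

end BCFeedback

open BCFeedback

/-! If the lattice reduction at Terminal A never overflows the Voronoi cell, the modulo operations
and dithers cancel, and A effectively sends the LFC input minus the feedback noise scaled by `γ⁻¹`.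
That noise enters both receivers' outputs alike, so each instance sees forward noise of covariance
`K_eq`. With `γ² = P̃/P` the forward power per round is `P_eq + σ̃²P/P̃ = P`, and the vector to be
reduced is white Gaussian of variance at most `γ² P_eq + σ̃² = P̃` per coordinate
(`input_eq_virtualInput`, `measure_aliasing_le`). What is needed is a lattice of second moment close
to `P̃` whose cell captures such noise. The second moment governs the feedback power, because a
dithered vector reduced modulo the lattice is uniform on the cell whatever the data
(`lintegral_normSq_fbInput`).

Good lattices (`exists_good_modLattice`). Construction A is used with a random line over a prime
field. A first-moment (Minkowski–Hlawka) count bounds the probability that Gaussian noise leaves the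
cell; a second-moment count for random lines bounds the part of space far from the lattice, hence
the second moment. In dimension `L = m⁴` the excess of the second moment is `1/m`, the escape
probability is `O(exp(-m/128))`, and the squared covering radius is polynomial in `m`, so that even
the rare aliasing events cost negligible power.

Error amplification (`LFC.exists_concat`). There are `2 m⁴` instances, and the error probability of
the given schemes tends to zero at an unknown speed, so a union bound over instances cannot be
applied to them directly. Instead one fixed scheme of the sequence is repeated `T` times under an
outer Gilbert–Varshamov code, which makes the error exponentially small in `T` with a small loss of
rate. A uniformly random shift of the codewords makes the letters of every codeword uniform and
independent over the repetitions, so that average error and average power are those of the inner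
scheme. One shift is then chosen that is good for a weighted sum of error and power. The new scheme
need not have constant power: only its noise response must fit in the cell, and that response is
inherited from the inner scheme.

The concatenated scheme of length `m + 1` begins with an idle round. This settles the first round,
in which no feedback noise is added and the covariance is `K_Z` instead of `K_eq`. It also leaves
spare power: on the feedback link only `m` of `m + 1` steps are active, which pays exactly for the
factor `1 + 1/m` of the lattice, and on the forward link the unused round pays for aliasing and for
the choice of the shift (`exists_mllfc`). `exists_mllfc_approx` selects the parameters for a given
tolerance, and the theorem follows by letting the tolerance tend to zero. -/

namespace BCFeedback

noncomputable section


/-! ### Lattices: quantizers and fundamental domains -/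

/-- The squared Euclidean norm. -/
def normSq {ι : Type*} [Fintype ι] (x : ι → ℝ) : ℝ := ∑ i, x i ^ 2

lemma normSq_nonneg {ι : Type*} [Fintype ι] (x : ι → ℝ) : 0 ≤ normSq x :=
  Finset.sum_nonneg fun _ _ => sq_nonneg _

lemma sq_le_normSq {ι : Type*} [Fintype ι] (x : ι → ℝ) (i : ι) : x i ^ 2 ≤ normSq x :=
  Finset.single_le_sum (f := fun i => x i ^ 2) (fun _ _ => sq_nonneg _) (Finset.mem_univ i)

lemma measurable_normSq {ι : Type*} [Fintype ι] : Measurable (normSq : (ι → ℝ) → ℝ) :=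
  Finset.measurable_sum _ fun i _ => (measurable_pi_apply i).pow_const 2

/-- The lattice point of `G ℤ^L` with integer coordinates `k`. -/
def latticeHom {L : ℕ} (G : Matrix (Fin L) (Fin L) ℝ) : (Fin L → ℤ) →+ (Fin L → ℝ) where
  toFun k := G *ᵥ fun i => (k i : ℝ)
  map_zero' := by ext i; simp [Matrix.mulVec, dotProduct]
  map_add' k l := by
    rw [← Matrix.mulVec_add]; congr 1; ext i; simp

lemma latticeHom_apply {L : ℕ} (G : Matrix (Fin L) (Fin L) ℝ) (k : Fin L → ℤ) :
    latticeHom G k = G *ᵥ fun i => (k i : ℝ) := rfl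

/-- Applying `G⁻¹` to a bounded set of lattice points bounds the integer coordinates. -/
lemma finite_setOf_normSq_sub_latticeHom_le {L : ℕ} (G : Matrix (Fin L) (Fin L) ℝ)
    (hG : G.det ≠ 0) (x : Fin L → ℝ) (C : ℝ) :
    {k : Fin L → ℤ | normSq (x - latticeHom G k) ≤ C}.Finite := by
  set b : Fin L → ℝ := fun i => ∑ j, |G⁻¹ i j| * (|x j| + (C + 1))
  refine Set.Finite.subset (Set.Finite.pi' fun i => Set.finite_Icc (-⌈b i⌉) ⌈b i⌉) ?_
  intro k hk i
  have hk' : normSq (x - latticeHom G k) ≤ C := hk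
  have h1 : ∀ j, |latticeHom G k j| ≤ |x j| + (C + 1) := by
    intro j
    have h2 := (sq_le_normSq (x - latticeHom G k) j).trans hk'
    have h3 : |(x - latticeHom G k) j| ≤ C + 1 := by
      rw [← sq_abs] at h2
      nlinarith [sq_nonneg (|(x - latticeHom G k) j| - 1), abs_nonneg ((x - latticeHom G k) j)]
    have h4 : latticeHom G k j = x j - (x - latticeHom G k) j := by simp
    rw [h4]
    exact (abs_sub _ _).trans (by linarith)
  have h5 : (k i : ℝ) = ∑ j, G⁻¹ i j * latticeHom G k j := by
    have : (fun i => (k i : ℝ)) = G⁻¹ *ᵥ latticeHom G k := by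
      rw [latticeHom_apply, Matrix.mulVec_mulVec, Matrix.nonsing_inv_mul _ (Ne.isUnit hG),
        Matrix.one_mulVec]
    exact congrFun this i
  have h6 : |(k i : ℝ)| ≤ b i := by
    rw [h5]
    refine (Finset.abs_sum_le_sum_abs _ _).trans (Finset.sum_le_sum fun j _ => ?_)
    rw [abs_mul]
    exact mul_le_mul_of_nonneg_left (h1 j) (abs_nonneg _)
  have h7 : |(k i : ℝ)| ≤ (⌈b i⌉ : ℝ) := h6.trans (Int.le_ceil _)
  have h8 : |k i| ≤ ⌈b i⌉ := by exact_mod_cast h7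
  exact ⟨(abs_le.1 h8).1, (abs_le.1 h8).2⟩

lemma exists_nearest_latticeHom {L : ℕ} (G : Matrix (Fin L) (Fin L) ℝ) (hG : G.det ≠ 0)
    (x : Fin L → ℝ) :
    ∃ k, ∀ k', normSq (x - latticeHom G k) ≤ normSq (x - latticeHom G k') := by
  have hne : {k : Fin L → ℤ | normSq (x - latticeHom G k) ≤ normSq x}.Nonempty :=
    ⟨0, by simp⟩
  obtain ⟨k, hk, hmin⟩ := Set.exists_min_image _ (fun k => normSq (x - latticeHom G k))
    (finite_setOf_normSq_sub_latticeHom_le G hG x (normSq x)) hne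
  refine ⟨k, fun k' => ?_⟩
  by_cases h : normSq (x - latticeHom G k') ≤ normSq x
  · exact hmin k' h
  · exact le_trans hk (le_of_not_ge h)

/-- Every lattice of full rank has a measurable nearest-neighbour quantizer which commutes with
lattice translations. -/
lemma exists_modLattice {L : ℕ} (G : Matrix (Fin L) (Fin L) ℝ) (hG : G.det ≠ 0) :
    ∃ Λ : ModLattice L, Λ.G = G := by
  -- The enumeration settles ties: among the nearest points the one of least index is taken, which
  -- is a measurable choice.
  obtain ⟨e, he⟩ := exists_surjective_nat (Fin L → ℤ)
  let k₀ : (Fin L → ℝ) → (Fin L → ℤ) := fun x i => ⌊(G⁻¹ *ᵥ x) i⌋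
  have hk₀ : ∀ x k, k₀ (x + latticeHom G k) = k₀ x + k := by
    intro x k
    ext i
    simp only [k₀, Matrix.mulVec_add, latticeHom_apply, Matrix.mulVec_mulVec,
      Matrix.nonsing_inv_mul _ (Ne.isUnit hG), Matrix.one_mulVec, Pi.add_apply, Int.floor_add_intCast]
  -- Reduction to the fundamental parallelepiped. As `x₀` is invariant under lattice translations,
  -- any tie-breaking rule applied to `x₀ x` is automatically consistent with them.
  let x₀ : (Fin L → ℝ) → (Fin L → ℝ) := fun x => x - latticeHom G (k₀ x)
  have hx₀ : ∀ x k, x₀ (x + latticeHom G k) = x₀ x := by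
    intro x k
    simp only [x₀, hk₀, map_add]
    abel
  have hex : ∀ x, ∃ n : ℕ, ∀ k', normSq (x - latticeHom G (e n)) ≤ normSq (x - latticeHom G k') := by
    intro x
    obtain ⟨k, hk⟩ := exists_nearest_latticeHom G hG x
    obtain ⟨n, rfl⟩ := he k
    exact ⟨n, hk⟩
  classical
  let n : (Fin L → ℝ) → ℕ := fun x => Nat.find (hex x)
  have hmk₀ : Measurable fun x => latticeHom G (k₀ x) := by
    have : Measurable k₀ := by
      refine measurable_pi_lambda _ fun i => Measurable.floor ?_
      simp only [Matrix.mulVec, dotProduct]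
      exact Finset.measurable_sum _ fun j _ => (measurable_pi_apply j).const_mul _
    exact (measurable_of_countable (latticeHom G)).comp this
  have hmx₀ : Measurable x₀ := measurable_id.sub hmk₀
  have hmn : Measurable n := by
    refine measurable_find hex fun N => ?_
    rw [Set.ofPred_forall]
    exact MeasurableSet.iInter fun k' => measurableSet_le
      (measurable_normSq.comp (measurable_id.sub_const _))
      (measurable_normSq.comp (measurable_id.sub_const _))
  refine ⟨⟨G, hG, fun x => latticeHom G (k₀ x) + latticeHom G (e (n (x₀ x))), ?_, ?_, ?_, ?_⟩, rfl⟩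
  · exact hmk₀.add ((measurable_of_countable fun m => latticeHom G (e m)).comp (hmn.comp hmx₀))
  · intro x
    exact ⟨k₀ x + e (n (x₀ x)), by rw [← map_add]; rfl⟩
  · intro x k
    have h := Nat.find_spec (hex (x₀ x)) (k - k₀ x)
    have h1 : x₀ x - latticeHom G (k - k₀ x) = x - latticeHom G k := by
      simp only [x₀, map_sub]; abel
    rw [h1] at h
    have h2 : x₀ x - latticeHom G (e (n (x₀ x))) =
        x - (latticeHom G (k₀ x) + latticeHom G (e (n (x₀ x)))) := by
      simp only [x₀]; abel
    change normSq (x₀ x - latticeHom G (e (n (x₀ x)))) ≤ _ at h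
    rw [h2] at h
    exact h
  · intro x k
    rw [← latticeHom_apply]
    simp only [hx₀, hk₀, map_add]
    abel

/-! ### The Voronoi cell as a fundamental domain, and dithering -/

namespace ModLattice

variable {L : ℕ} (Λ : ModLattice L)

/-- The lattice as an additive group. -/
def points : AddSubgroup (Fin L → ℝ) := (latticeHom Λ.G).range

instance : Countable Λ.points := by
  have : Countable (Set.range (latticeHom Λ.G)) := Set.countable_range _
  exact this

variable {Λ}

lemma mem_points {x : Fin L → ℝ} : x ∈ Λ.points ↔ ∃ k, latticeHom Λ.G k = x := Iff.rfl

lemma quant_mem_points (x : Fin L → ℝ) : Λ.quant x ∈ Λ.points := by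
  obtain ⟨k, hk⟩ := Λ.quant_mem x
  exact ⟨k, hk.symm⟩

lemma quant_add_point {g : Fin L → ℝ} (hg : g ∈ Λ.points) (x : Fin L → ℝ) :
    Λ.quant (x + g) = Λ.quant x + g := by
  obtain ⟨k, rfl⟩ := hg
  exact Λ.quant_add x k

lemma modulo_add_point {g : Fin L → ℝ} (hg : g ∈ Λ.points) (x : Fin L → ℝ) :
    Λ.modulo (x + g) = Λ.modulo x := by
  simp only [modulo, quant_add_point hg]; abel

/-- Each inner reduction changes its argument by a lattice vector, which the outer one ignores. This
is what lets Terminal A undo the reductions made by both users although it receives only their sum.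
-/
lemma modulo_sub_sum_modulo {ι : Type*} (s : Finset ι) (x : Fin L → ℝ) (a : ι → Fin L → ℝ) :
    Λ.modulo (x - ∑ i ∈ s, Λ.modulo (a i)) = Λ.modulo (x - ∑ i ∈ s, a i) := by
  have : x - ∑ i ∈ s, Λ.modulo (a i) = (x - ∑ i ∈ s, a i) + ∑ i ∈ s, Λ.quant (a i) := by
    simp only [modulo, Finset.sum_sub_distrib]; abel
  rw [this, modulo_add_point (sum_mem fun i _ => quant_mem_points _)]

lemma modulo_of_mem_cell {x : Fin L → ℝ} (hx : x ∈ Λ.cell) : Λ.modulo x = x := by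
  have : Λ.quant x = 0 := hx
  simp [modulo, this]

lemma normSq_modulo_le {g : Fin L → ℝ} (hg : g ∈ Λ.points) (x : Fin L → ℝ) :
    normSq (Λ.modulo x) ≤ normSq (x - g) := by
  obtain ⟨k, rfl⟩ := hg
  exact Λ.nearest x k

variable (Λ)

/-- Consistent tie-breaking makes `quant` equivariant, so `-quant x` is the only translation
bringing `x` into the cell; no null set of ties has to be discarded. -/
lemma isAddFundamentalDomain_cell : IsAddFundamentalDomain Λ.points Λ.cell volume := by
  refine IsAddFundamentalDomain.mk' Λ.measurableSet_cell.nullMeasurableSet fun x => ?_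
  refine ⟨⟨-Λ.quant x, neg_mem (quant_mem_points x)⟩, ?_, ?_⟩
  · change Λ.quant (-Λ.quant x + x) = 0
    rw [add_comm, quant_add_point (neg_mem (quant_mem_points x))]
    abel
  · rintro ⟨g, hg⟩ h
    have h' : Λ.quant (g + x) = 0 := h
    rw [add_comm, quant_add_point hg] at h'
    exact Subtype.ext (eq_neg_of_add_eq_zero_right h')

lemma lintegral_uniformCell (f : (Fin L → ℝ) → ℝ≥0∞) :
    ∫⁻ x, f x ∂Λ.uniformCell = (volume Λ.cell)⁻¹ * ∫⁻ x in Λ.cell, f x := by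
  rw [uniformCell, ProbabilityTheory.cond, lintegral_smul_measure]; rfl

/-- The integral over the cell equals that of the periodic extension over any other
fundamental domain. -/
lemma lintegral_uniformCell_eq {D : Set (Fin L → ℝ)} (hD : IsAddFundamentalDomain Λ.points D volume)
    (f : (Fin L → ℝ) → ℝ≥0∞) :
    ∫⁻ x, f x ∂Λ.uniformCell = (volume D)⁻¹ * ∫⁻ x in D, f (Λ.modulo x) := by
  rw [lintegral_uniformCell, Λ.isAddFundamentalDomain_cell.measure_eq hD,
    ← Λ.isAddFundamentalDomain_cell.setLIntegral_eq hD (fun x => f (Λ.modulo x))]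
  · congr 1
    exact setLIntegral_congr_fun Λ.measurableSet_cell fun x hx => by rw [modulo_of_mem_cell hx]
  · rintro ⟨g, hg⟩ x
    change f (Λ.modulo (g + x)) = _
    rw [add_comm, modulo_add_point hg]

open scoped Pointwise in
/-- A vector dithered uniformly over the cell and reduced modulo the lattice is uniform. -/
lemma lintegral_modulo_add_uniformCell (c : Fin L → ℝ) {f : (Fin L → ℝ) → ℝ≥0∞} :
    ∫⁻ x, f (Λ.modulo (c + x)) ∂Λ.uniformCell = ∫⁻ x, f x ∂Λ.uniformCell := by
  -- The translated cell is again a fundamental domain, and a function of `x mod Λ` has the same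
  -- mean over all of them.
  have hD : IsAddFundamentalDomain Λ.points (c +ᵥ Λ.cell) volume :=
    Λ.isAddFundamentalDomain_cell.vadd_of_comm c
  rw [Λ.lintegral_uniformCell_eq hD f, lintegral_uniformCell]
  have h1 : volume (c +ᵥ Λ.cell) = volume Λ.cell := measure_vadd _ _ _
  rw [h1]
  congr 1
  have h2 := (measurePreserving_vadd c (volume : Measure (Fin L → ℝ))).setLIntegral_comp_emb
    (measurableEmbedding_const_vadd c) (fun x => f (Λ.modulo x)) Λ.cell
  exact h2

end ModLattice


/-! ### Random lattices of Construction A: counting -/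

/-- For a random line `c ↦ c • g - u` in `F × A`, the probability of missing a set `S` is at most
`card A / card S`. -/
lemma card_line_disjoint_mul_card_le {F A : Type*} [Field F] [AddCommGroup A] [Module F A]
    [Fintype A] [DecidableEq A] (S : Finset (F × A)) :
    ((Finset.univ.filter fun gu : A × A => ∀ y ∈ S, gu.2 ≠ y.1 • gu.1 - y.2).card : ℝ) * S.card ≤
      (Fintype.card A : ℝ) ^ 3 := by
  classical
  set q : ℝ := ((Fintype.card A : ℕ) : ℝ) with hq
  -- Second-moment method: `N` counts the points of `S` hit by the line; its mean is `card S / q`.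
  let N : A × A → ℝ := fun gu => ∑ y ∈ S, if gu.2 = y.1 • gu.1 - y.2 then 1 else 0
  have hsum1 : ∑ gu, N gu = S.card * q := by
    simp only [N]
    rw [Finset.sum_comm]
    simp only [Fintype.sum_prod_type, Finset.sum_ite_eq', Finset.mem_univ, if_true, Finset.sum_const,
      Finset.card_univ, nsmul_eq_mul, mul_one]
    rw [hq]
  -- Both points are hit only if `(y.1 - z.1) • g = y.2 - z.2`. For `y ≠ z` this has at most one
  -- solution `g`, and `g` determines `u`.
  have hpair : ∀ y z : F × A, ∑ gu : A × A, ((if gu.2 = y.1 • gu.1 - y.2 then (1 : ℝ) else 0) *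
      (if gu.2 = z.1 • gu.1 - z.2 then 1 else 0)) ≤ if y = z then q else 1 := by
    intro y z
    have h1 : ∑ gu : A × A, ((if gu.2 = y.1 • gu.1 - y.2 then (1 : ℝ) else 0) *
        (if gu.2 = z.1 • gu.1 - z.2 then 1 else 0)) =
        ∑ g : A, if y.1 • g - y.2 = z.1 • g - z.2 then (1 : ℝ) else 0 := by
      rw [Fintype.sum_prod_type]
      refine Finset.sum_congr rfl fun g _ => ?_
      simp only [ite_mul, one_mul, zero_mul, Finset.sum_ite_eq', Finset.mem_univ, if_true]
    rw [h1]
    split_ifs with h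
    · refine (Finset.sum_le_sum fun g _ => (?_ : _ ≤ (1 : ℝ))).trans (by simp [hq])
      split_ifs <;> norm_num
    · rw [← Finset.sum_filter, Finset.sum_const, nsmul_eq_mul, mul_one]
      have : (Finset.univ.filter fun g : A => y.1 • g - y.2 = z.1 • g - z.2).card ≤ 1 := by
        refine Finset.card_le_one.2 fun a ha b hb => ?_
        simp only [Finset.mem_filter, Finset.mem_univ, true_and] at ha hb
        have hne : y.1 - z.1 ≠ 0 := by
          intro h0
          have h0' : y.1 = z.1 := sub_eq_zero.1 h0
          rw [h0'] at ha
          exact h (Prod.ext h0' (sub_right_injective ha))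
        have h2 : (y.1 - z.1) • a = (y.1 - z.1) • b := by
          have ha' : (y.1 - z.1) • a = y.2 - z.2 := by
            rw [sub_smul, sub_eq_sub_iff_add_eq_add]
            have := sub_eq_sub_iff_add_eq_add.1 ha
            rw [this, add_comm]
          have hb' : (y.1 - z.1) • b = y.2 - z.2 := by
            rw [sub_smul, sub_eq_sub_iff_add_eq_add]
            have := sub_eq_sub_iff_add_eq_add.1 hb
            rw [this, add_comm]
          rw [ha', hb']
        exact smul_right_injective A hne h2
      exact_mod_cast this
  have hsum2 : ∑ gu, N gu ^ 2 ≤ S.card * q + (S.card : ℝ) ^ 2 := by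
    have h1 : ∑ gu, N gu ^ 2 = ∑ y ∈ S, ∑ z ∈ S, ∑ gu : A × A,
        ((if gu.2 = y.1 • gu.1 - y.2 then (1 : ℝ) else 0) *
        (if gu.2 = z.1 • gu.1 - z.2 then 1 else 0)) := by
      simp only [N, sq, Finset.sum_mul_sum]
      rw [Finset.sum_comm]
      refine Finset.sum_congr rfl fun y _ => ?_
      rw [Finset.sum_comm]
    rw [h1]
    calc _ ≤ ∑ y ∈ S, ∑ z ∈ S, (if y = z then q else 1) :=
          Finset.sum_le_sum fun y _ => Finset.sum_le_sum fun z _ => hpair y z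
      _ ≤ ∑ y ∈ S, ∑ z ∈ S, ((if y = z then q else 0) + 1) := by
          refine Finset.sum_le_sum fun y _ => Finset.sum_le_sum fun z _ => ?_
          split_ifs <;> simp
      _ = S.card * q + (S.card : ℝ) ^ 2 := by
          simp only [Finset.sum_add_distrib, Finset.sum_ite_eq, Finset.sum_const, nsmul_eq_mul,
            mul_one, sq]
          congr 1
          rw [Finset.sum_ite_mem, Finset.inter_self, Finset.sum_const, nsmul_eq_mul]
  set B := Finset.univ.filter fun gu : A × A => ∀ y ∈ S, gu.2 ≠ y.1 • gu.1 - y.2 with hB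
  have hvar : ∑ gu : A × A, (q * N gu - S.card) ^ 2 ≤ q ^ 3 * S.card := by
    have h1 : ∑ gu : A × A, (q * N gu - S.card) ^ 2 =
        q ^ 2 * ∑ gu, N gu ^ 2 - 2 * q * S.card * ∑ gu, N gu + q ^ 2 * (S.card : ℝ) ^ 2 := by
      have : ∀ gu : A × A, (q * N gu - S.card) ^ 2 =
          q ^ 2 * N gu ^ 2 - 2 * q * S.card * N gu + (S.card : ℝ) ^ 2 := fun gu => by ring
      simp only [this, Finset.sum_add_distrib, Finset.sum_sub_distrib, ← Finset.mul_sum,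
        Finset.sum_const, Finset.card_univ, Fintype.card_prod, nsmul_eq_mul]
      push_cast
      rw [hq]; ring
    rw [h1, hsum1]
    nlinarith [mul_le_mul_of_nonneg_left hsum2 (sq_nonneg q)]
  -- Chebyshev: a line that misses `S` has `N = 0` and so contributes `(card S)²`.
  have hlow : (B.card : ℝ) * (S.card : ℝ) ^ 2 ≤ ∑ gu : A × A, (q * N gu - S.card) ^ 2 := by
    rw [← nsmul_eq_mul, ← Finset.sum_const]
    refine (Finset.sum_le_sum fun gu hgu => ?_).trans
      (Finset.sum_le_sum_of_subset_of_nonneg (Finset.subset_univ B) fun _ _ _ => sq_nonneg _)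
    have : N gu = 0 := by
      refine Finset.sum_eq_zero fun y hy => if_neg ?_
      exact (Finset.mem_filter.1 hgu).2 y hy
    rw [this]; simp
  rcases Nat.eq_zero_or_pos S.card with h0 | h0
  · rw [h0]; simp only [Nat.cast_zero, mul_zero]; positivity
  · have h0' : (0 : ℝ) < S.card := by exact_mod_cast h0
    have := hlow.trans hvar
    nlinarith

/-! ### Grid points in Euclidean balls -/

/-- The closed Euclidean ball around the origin, as a subset of `ι → ℝ`. -/
def ballSq (ι : Type*) [Fintype ι] (r : ℝ) : Set (ι → ℝ) := {x | normSq x ≤ r ^ 2}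

lemma normSq_eq_norm_sq {ι : Type*} [Fintype ι] (x : ι → ℝ) :
    normSq x = ‖(WithLp.toLp 2 x : EuclideanSpace ℝ ι)‖ ^ 2 := by
  rw [EuclideanSpace.real_norm_sq_eq]; rfl

lemma normSq_le_sq_iff {ι : Type*} [Fintype ι] (x : ι → ℝ) {r : ℝ} (hr : 0 ≤ r) :
    normSq x ≤ r ^ 2 ↔ ‖(WithLp.toLp 2 x : EuclideanSpace ℝ ι)‖ ≤ r := by
  rw [normSq_eq_norm_sq, sq_le_sq₀ (norm_nonneg _) hr]

lemma normSq_add_le {ι : Type*} [Fintype ι] {x y : ι → ℝ} {r s : ℝ} (hr : 0 ≤ r) (hs : 0 ≤ s)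
    (hx : normSq x ≤ r ^ 2) (hy : normSq y ≤ s ^ 2) : normSq (x + y) ≤ (r + s) ^ 2 := by
  rw [normSq_le_sq_iff _ hr] at hx
  rw [normSq_le_sq_iff _ hs] at hy
  rw [normSq_le_sq_iff _ (add_nonneg hr hs), WithLp.toLp_add]
  exact (norm_add_le _ _).trans (add_le_add hx hy)

lemma normSq_neg {ι : Type*} [Fintype ι] (x : ι → ℝ) : normSq (-x) = normSq x := by
  simp [normSq]

lemma normSq_sub_comm {ι : Type*} [Fintype ι] (x y : ι → ℝ) : normSq (x - y) = normSq (y - x) := by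
  rw [← normSq_neg, neg_sub]

lemma normSq_smul {ι : Type*} [Fintype ι] (c : ℝ) (x : ι → ℝ) :
    normSq (c • x) = c ^ 2 * normSq x := by
  simp [normSq, mul_pow, Finset.mul_sum]

lemma measurableSet_ballSq {ι : Type*} [Fintype ι] (r : ℝ) : MeasurableSet (ballSq ι r) :=
  measurableSet_le measurable_normSq measurable_const

lemma volume_ballSq {ι : Type*} [Fintype ι] {r : ℝ} (hr : 0 < r) :
    volume (ballSq ι r) = ENNReal.ofReal (r ^ Fintype.card ι) * volume (ballSq ι 1) := by
  have h : ballSq ι r = (fun x => r⁻¹ • x) ⁻¹' ballSq ι 1 := by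
    ext x
    simp only [ballSq, Set.mem_ofPred_eq, Set.mem_preimage, normSq_smul]
    rw [inv_pow, inv_mul_le_iff₀ (by positivity)]
    simp
  rw [h, Measure.addHaar_preimage_smul _ (inv_ne_zero hr.ne')]
  congr 1
  rw [inv_pow, inv_inv, Module.finrank_pi, abs_of_pos (by positivity)]

lemma volume_ballSq_one_le {ι : Type*} [Fintype ι] :
    volume (ballSq ι 1) ≤ ENNReal.ofReal (2 ^ Fintype.card ι) := by
  have hsub : ballSq ι 1 ⊆ Set.Icc (fun _ => -1) (fun _ => 1) := by
    intro x hx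
    have hx' : normSq x ≤ 1 ^ 2 := hx
    have : ∀ i, |x i| ≤ 1 := fun i => by
      have := (sq_le_normSq x i).trans hx'
      exact abs_le_of_sq_le_sq this (by norm_num)
    exact ⟨fun i => (abs_le.1 (this i)).1, fun i => (abs_le.1 (this i)).2⟩
  refine (measure_mono hsub).trans ?_
  rw [Real.volume_Icc_pi]
  norm_num [ENNReal.ofReal_pow]

/-- The inscribed cube has half-side `1/√d`. This and the circumscribed cube bound the volume of the
ball crudely, but well enough to control the grid spacing in `exists_grid_spacing`. -/
lemma le_volume_ballSq_one {ι : Type*} [Fintype ι] [Nonempty ι] :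
    ENNReal.ofReal ((2 / √(Fintype.card ι)) ^ Fintype.card ι) ≤ volume (ballSq ι 1) := by
  set d : ℝ := √(Fintype.card ι) with hd
  have hc : (0 : ℝ) < Fintype.card ι := by exact_mod_cast Fintype.card_pos
  have hd0 : 0 < d := Real.sqrt_pos.2 hc
  have hsub : Set.Icc (fun _ : ι => -(1 / d)) (fun _ => 1 / d) ⊆ ballSq ι 1 := by
    intro x hx
    have : ∀ i, x i ^ 2 ≤ (1 / d) ^ 2 := fun i => by
      rw [sq_le_sq, abs_of_pos (one_div_pos.2 hd0)]
      exact abs_le.2 ⟨hx.1 i, hx.2 i⟩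
    change normSq x ≤ 1 ^ 2
    refine (Finset.sum_le_sum fun i _ => this i).trans ?_
    rw [Finset.sum_const, Finset.card_univ, nsmul_eq_mul, div_pow, hd, Real.sq_sqrt hc.le]
    field_simp
    norm_num
  refine le_trans ?_ (measure_mono hsub)
  rw [Real.volume_Icc_pi]
  rw [Finset.prod_const, Finset.card_univ, ← ENNReal.ofReal_pow (by
    rw [sub_neg_eq_add]; positivity)]
  apply le_of_eq
  congr 2
  ring

/-- The half-open cube of side `β` with lower corner `β y`. -/
def gridCube {ι : Type*} (β : ℝ) (y : ι → ℤ) : Set (ι → ℝ) :=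
  Set.univ.pi fun i => Set.Ico (β * y i) (β * y i + β)

/-- The grid point `β y`. -/
def gridPt {ι : Type*} (β : ℝ) (y : ι → ℤ) : ι → ℝ := fun i => β * y i

lemma measurableSet_gridCube {ι : Type*} [Fintype ι] (β : ℝ) (y : ι → ℤ) :
    MeasurableSet (gridCube β y) :=
  MeasurableSet.univ_pi fun _ => measurableSet_Ico

lemma volume_gridCube {ι : Type*} [Fintype ι] {β : ℝ} (hβ : 0 < β) (y : ι → ℤ) :
    volume (gridCube β y) = ENNReal.ofReal (β ^ Fintype.card ι) := by
  rw [gridCube, volume_pi_pi]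
  simp [ENNReal.ofReal_pow hβ.le]

lemma mem_gridCube_floor {ι : Type*} {β : ℝ} (hβ : 0 < β) (x : ι → ℝ) :
    x ∈ gridCube β fun i => ⌊x i / β⌋ := by
  intro i _
  have h1 := Int.floor_le (x i / β)
  have h2 := Int.lt_floor_add_one (x i / β)
  rw [le_div_iff₀ hβ] at h1
  rw [div_lt_iff₀ hβ] at h2
  constructor <;> nlinarith

lemma eq_of_mem_gridCube {ι : Type*} {β : ℝ} (hβ : 0 < β) {x : ι → ℝ} {y : ι → ℤ}
    (hx : x ∈ gridCube β y) : y = fun i => ⌊x i / β⌋ := by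
  ext i
  have h := hx i trivial
  symm
  rw [Int.floor_eq_iff, le_div_iff₀ hβ, div_lt_iff₀ hβ]
  constructor <;> nlinarith [h.1, h.2]

lemma normSq_sub_gridPt_le {ι : Type*} [Fintype ι] {β : ℝ} {x : ι → ℝ}
    {y : ι → ℤ} (hx : x ∈ gridCube β y) :
    normSq (x - gridPt β y) ≤ (β * √(Fintype.card ι)) ^ 2 := by
  rw [mul_pow, Real.sq_sqrt (Nat.cast_nonneg _), mul_comm]
  refine (Finset.sum_le_card_nsmul _ _ (β ^ 2) fun i _ => ?_).trans (by simp)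
  have h := hx i trivial
  simp only [Pi.sub_apply, gridPt]
  apply sq_le_sq'
  · linarith [h.1, h.2]
  · linarith [h.1, h.2]

lemma finite_gridPt_ball {ι : Type*} [Fintype ι] {β : ℝ} (hβ : 0 < β) (z : ι → ℝ) (r : ℝ) :
    {y : ι → ℤ | normSq (z - gridPt β y) ≤ r ^ 2}.Finite := by
  refine Set.Finite.subset (Set.Finite.pi' fun i =>
    Set.finite_Icc (-⌈(|z i| + |r|) / β⌉) ⌈(|z i| + |r|) / β⌉) ?_
  intro y hy i
  have h1 : (z i - β * y i) ^ 2 ≤ r ^ 2 := (sq_le_normSq (z - gridPt β y) i).trans hy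
  have h2 : |z i - β * y i| ≤ |r| := sq_le_sq.1 h1
  have h3 : |β * y i| ≤ |z i| + |r| := by
    have : β * y i = z i - (z i - β * y i) := by ring
    rw [this]
    exact (abs_sub _ _).trans (by linarith)
  rw [abs_mul, abs_of_pos hβ, mul_comm, ← le_div_iff₀ hβ] at h3
  have h4 : |(y i : ℝ)| ≤ (⌈(|z i| + |r|) / β⌉ : ℝ) := h3.trans (Int.le_ceil _)
  have h5 : |y i| ≤ ⌈(|z i| + |r|) / β⌉ := by exact_mod_cast h4
  exact ⟨(abs_le.1 h5).1, (abs_le.1 h5).2⟩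

/-- The grid points `β y` in a ball. -/
def gridBall {ι : Type*} [Fintype ι] {β : ℝ} (hβ : 0 < β) (z : ι → ℝ) (r : ℝ) : Finset (ι → ℤ) :=
  (finite_gridPt_ball hβ z r).toFinset

lemma mem_gridBall {ι : Type*} [Fintype ι] {β : ℝ} (hβ : 0 < β) {z : ι → ℝ} {r : ℝ} {y : ι → ℤ} :
    y ∈ gridBall hβ z r ↔ normSq (z - gridPt β y) ≤ r ^ 2 := by
  simp [gridBall]

lemma volume_ball_translate {ι : Type*} [Fintype ι] (z : ι → ℝ) (r : ℝ) :
    volume {x | normSq (x - z) ≤ r ^ 2} = volume (ballSq ι r) := by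
  have : {x | normSq (x - z) ≤ r ^ 2} = (fun x => x + -z) ⁻¹' ballSq ι r := by
    ext x; simp [ballSq, sub_eq_add_neg]
  rw [this, measure_preimage_add_right]

/-- The grid cubes at these points are disjoint and stay in the ball enlarged by their diameter `β
√d`. -/
lemma card_gridBall_mul_le {ι : Type*} [Fintype ι] {β : ℝ} (hβ : 0 < β) (z : ι → ℝ) {r : ℝ}
    (hr : 0 ≤ r) :
    ((gridBall hβ z r).card : ℝ≥0∞) * ENNReal.ofReal (β ^ Fintype.card ι) ≤
      volume (ballSq ι (r + β * √(Fintype.card ι))) := by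
  rw [← volume_ball_translate z]
  have hdisj : Set.PairwiseDisjoint (↑(gridBall hβ z r)) fun y : ι → ℤ => gridCube β y := by
    intro y _ y' _ hne
    refine Set.disjoint_left.2 fun x hx hx' => hne ?_
    rw [eq_of_mem_gridCube hβ hx, eq_of_mem_gridCube hβ hx']
  have h1 : ((gridBall hβ z r).card : ℝ≥0∞) * ENNReal.ofReal (β ^ Fintype.card ι) =
      volume (⋃ y ∈ gridBall hβ z r, gridCube β y) := by
    rw [measure_biUnion_finset hdisj fun y _ => measurableSet_gridCube β y]
    simp [volume_gridCube hβ]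
  rw [h1]
  refine measure_mono ?_
  intro x hx
  simp only [Set.mem_iUnion, exists_prop] at hx
  obtain ⟨y, hy, hxy⟩ := hx
  rw [mem_gridBall] at hy
  have : x - z = -(z - gridPt β y) + (x - gridPt β y) := by abel
  change normSq (x - z) ≤ _
  rw [this]
  exact normSq_add_le hr (by positivity) (by rwa [normSq_neg]) (normSq_sub_gridPt_le hxy)

/-- Conversely, the grid cubes at the points of the enlarged ball cover the ball. -/
lemma volume_le_card_gridBall_mul {ι : Type*} [Fintype ι] {β : ℝ} (hβ : 0 < β) (z : ι → ℝ) {r : ℝ}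
    (hr : 0 ≤ r) :
    volume (ballSq ι r) ≤ ((gridBall hβ z (r + β * √(Fintype.card ι))).card : ℝ≥0∞) *
      ENNReal.ofReal (β ^ Fintype.card ι) := by
  rw [← volume_ball_translate z]
  have hsub : {x | normSq (x - z) ≤ r ^ 2} ⊆
      ⋃ y ∈ gridBall hβ z (r + β * √(Fintype.card ι)), gridCube β y := by
    intro x hx
    have hx' : normSq (x - z) ≤ r ^ 2 := hx
    have hc := mem_gridCube_floor hβ x
    simp only [Set.mem_iUnion, exists_prop]
    refine ⟨_, ?_, hc⟩
    rw [mem_gridBall]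
    have : z - gridPt β (fun i => ⌊x i / β⌋) = (z - x) + (x - gridPt β fun i => ⌊x i / β⌋) := by abel
    rw [this]
    exact normSq_add_le hr (by positivity) (by rwa [normSq_sub_comm]) (normSq_sub_gridPt_le hc)
  refine (measure_mono hsub).trans ((measure_biUnion_finset_le _ _).trans ?_)
  simp [volume_gridCube hβ]


/-! ### Random lattices of Construction A from lines over a prime field -/

/-- Generator matrix of the lattice `β (ℤ (1, g) + p ℤ^n)`. -/
def lineMatrix {n p : ℕ} (β : ℝ) (g : Fin n → ZMod p) : Matrix (Fin (n + 1)) (Fin (n + 1)) ℝ :=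
  Matrix.of fun i j => Fin.cases (if j = 0 then β else 0)
    (fun i' => Fin.cases (β * ((g i').val : ℝ)) (fun j' => if i' = j' then β * p else 0) j) i

lemma lineMatrix_zero {n p : ℕ} (β : ℝ) (g : Fin n → ZMod p) (j : Fin (n + 1)) :
    lineMatrix β g 0 j = if j = 0 then β else 0 := rfl

lemma lineMatrix_succ_zero {n p : ℕ} (β : ℝ) (g : Fin n → ZMod p) (i : Fin n) :
    lineMatrix β g i.succ 0 = β * ((g i).val : ℝ) := rfl

lemma lineMatrix_succ_succ {n p : ℕ} (β : ℝ) (g : Fin n → ZMod p) (i j : Fin n) :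
    lineMatrix β g i.succ j.succ = if i = j then β * p else 0 := rfl

lemma det_lineMatrix {n p : ℕ} (β : ℝ) (g : Fin n → ZMod p) :
    (lineMatrix β g).det = β * (β * p) ^ n := by
  rw [Matrix.det_of_isLowerTriangular, Fin.prod_univ_succ]
  · simp [lineMatrix_zero, lineMatrix_succ_succ]
  · intro i j hij
    have hij' : i < j := hij
    induction i using Fin.cases with
    | zero => rw [lineMatrix_zero, if_neg hij'.ne']
    | succ i =>
      induction j using Fin.cases with
      | zero => exact absurd hij' (Fin.not_lt_zero _)
      | succ j =>
        rw [lineMatrix_succ_succ, if_neg (fun h => hij'.ne (by rw [h]))]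

lemma latticeHom_lineMatrix_zero {n p : ℕ} (β : ℝ) (g : Fin n → ZMod p) (k : Fin (n + 1) → ℤ) :
    latticeHom (lineMatrix β g) k 0 = β * k 0 := by
  simp [latticeHom_apply, Matrix.mulVec, dotProduct, lineMatrix_zero]

lemma latticeHom_lineMatrix_succ {n p : ℕ} (β : ℝ) (g : Fin n → ZMod p) (k : Fin (n + 1) → ℤ)
    (i : Fin n) :
    latticeHom (lineMatrix β g) k i.succ = β * ((g i).val * k 0 + p * k i.succ) := by
  simp [latticeHom_apply, Matrix.mulVec, dotProduct, Fin.sum_univ_succ, lineMatrix_succ_zero,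
    lineMatrix_succ_succ]
  ring

/-- Construction A: the residues modulo `p` of the grid coordinates must lie on the line spanned by
`(1, g)`. -/
lemma mem_range_lineMatrix {n p : ℕ} [NeZero p] (β : ℝ) (g : Fin n → ZMod p)
    (x : Fin (n + 1) → ℝ) :
    (∃ k, latticeHom (lineMatrix β g) k = x) ↔
      ∃ y : Fin (n + 1) → ℤ, x = gridPt β y ∧ ∀ i : Fin n, (y i.succ : ZMod p) = y 0 * g i := by
  constructor
  · rintro ⟨k, rfl⟩
    refine ⟨Fin.cons (k 0) fun i => (g i).val * k 0 + p * k i.succ, ?_, ?_⟩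
    · ext i
      induction i using Fin.cases with
      | zero => simp [latticeHom_lineMatrix_zero, gridPt]
      | succ i => simp [latticeHom_lineMatrix_succ, gridPt]
    · intro i
      simp [mul_comm]
  · rintro ⟨y, rfl, hy⟩
    have hdvd : ∀ i : Fin n, (p : ℤ) ∣ y i.succ - (g i).val * y 0 := by
      intro i
      rw [← ZMod.intCast_zmod_eq_zero_iff_dvd]
      push_cast
      rw [hy i, ZMod.natCast_zmod_val]
      ring
    choose c hc using hdvd
    refine ⟨Fin.cons (y 0) c, ?_⟩
    ext i
    induction i using Fin.cases with
    | zero => simp [latticeHom_lineMatrix_zero, gridPt]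
    | succ i =>
      simp only [latticeHom_lineMatrix_succ, gridPt, Fin.cons_zero, Fin.cons_succ]
      have : (y i.succ : ℝ) = (g i).val * y 0 + p * c i := by
        have := hc i
        have h2 : y i.succ = (g i).val * y 0 + p * c i := by linarith
        exact_mod_cast h2
      rw [this]

/-- A box which is a fundamental domain of all the lattices `β (ℤ (1, g) + p ℤ^n)`. -/
def lineBox (n p : ℕ) (β : ℝ) : Set (Fin (n + 1) → ℝ) :=
  Set.univ.pi fun i => Set.Ico 0 (Fin.cases (motive := fun _ => ℝ) β (fun _ => β * p) i)

lemma volume_lineBox (n p : ℕ) {β : ℝ} (hβ : 0 ≤ β) :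
    volume (lineBox n p β) = ENNReal.ofReal (β * (β * p) ^ n) := by
  rw [lineBox, volume_pi_pi, Fin.prod_univ_succ]
  simp only [Real.volume_Ico, sub_zero, Fin.cases_zero, Fin.cases_succ, Finset.prod_const,
    Finset.card_univ, Fintype.card_fin]
  rw [ENNReal.ofReal_mul (q := (β * p) ^ n) hβ, ENNReal.ofReal_pow (by positivity)]

/-- The generator matrix is lower triangular: coordinate `0` fixes the first integer, and then each
further coordinate fixes its own. As the box is the same for every `g`, averages over the random
lattice can be taken over one fixed region. -/
lemma isAddFundamentalDomain_lineBox {n p : ℕ} [NeZero p] {β : ℝ} (hβ : 0 < β)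
    (g : Fin n → ZMod p) (Λ : ModLattice (n + 1)) (hΛ : Λ.G = lineMatrix β g) :
    IsAddFundamentalDomain Λ.points (lineBox n p β) volume := by
  have hp : (0 : ℝ) < p := by exact_mod_cast NeZero.pos p
  refine IsAddFundamentalDomain.mk' (MeasurableSet.univ_pi fun _ => measurableSet_Ico).nullMeasurableSet
    fun x => ?_
  have hfl : ∀ {b t : ℝ} (_ : 0 < b) {m : ℤ}, b * m + t ∈ Set.Ico 0 b ↔ m = -⌊t / b⌋ := by
    intro b t hb m
    rw [eq_comm, neg_eq_iff_eq_neg, Int.floor_eq_iff, le_div_iff₀ hb, div_lt_iff₀ hb, Set.mem_Ico]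
    push_cast
    constructor <;> rintro ⟨h1, h2⟩ <;> constructor <;> nlinarith
  let k₀ : ℤ := -⌊x 0 / β⌋
  let k : Fin (n + 1) → ℤ := Fin.cons k₀ fun i =>
    -⌊(β * ((g i).val * k₀) + x i.succ) / (β * p)⌋
  have hkey : ∀ k' : Fin (n + 1) → ℤ,
      latticeHom (lineMatrix β g) k' + x ∈ lineBox n p β ↔ k' = k := by
    intro k'
    have h1 : latticeHom (lineMatrix β g) k' + x ∈ lineBox n p β ↔
        (β * k' 0 + x 0 ∈ Set.Ico 0 β ∧ ∀ i : Fin n,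
          (β * p) * k' i.succ + (β * ((g i).val * k' 0) + x i.succ) ∈ Set.Ico 0 (β * p)) := by
      simp only [lineBox, Set.mem_univ_pi, Fin.forall_fin_succ, Pi.add_apply,
        latticeHom_lineMatrix_zero, latticeHom_lineMatrix_succ, Fin.cases_zero, Fin.cases_succ]
      have : ∀ i : Fin n, β * ((g i).val * (k' 0 : ℝ) + p * k' i.succ) + x i.succ =
        (β * p) * k' i.succ + (β * ((g i).val * k' 0) + x i.succ) := fun i => by ring
      simp only [this]
    rw [h1, hfl hβ]
    simp only [hfl (mul_pos hβ hp)]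
    constructor
    · rintro ⟨h0, hs⟩
      ext i
      induction i using Fin.cases with
      | zero => exact h0
      | succ i => rw [hs i, h0]; rfl
    · rintro rfl
      exact ⟨rfl, fun i => rfl⟩
  refine ⟨⟨latticeHom Λ.G k, ⟨k, rfl⟩⟩, ?_, ?_⟩
  · change latticeHom Λ.G k + x ∈ _
    rw [hΛ]
    exact (hkey k).2 rfl
  · rintro ⟨_, ⟨k', rfl⟩⟩ h
    have h' : latticeHom Λ.G k' + x ∈ lineBox n p β := h
    rw [hΛ] at h'
    exact Subtype.ext (by rw [(hkey k').1 h'])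

/-- The squared distance to the lattice is at most `(n+1) (β p)²`. -/
lemma normSq_modulo_lineMatrix_le {n p : ℕ} [NeZero p] {β : ℝ} (hβ : 0 < β)
    (g : Fin n → ZMod p) (Λ : ModLattice (n + 1)) (hΛ : Λ.G = lineMatrix β g)
    (x : Fin (n + 1) → ℝ) : normSq (Λ.modulo x) ≤ (n + 1) * (β * p) ^ 2 := by
  have hp : (0 : ℝ) < p := by exact_mod_cast NeZero.pos p
  have hmem := mem_gridCube_floor (mul_pos hβ hp) x
  -- The lattice contains `β p ℤ^(n+1)`, so rounding to this coarse grid already bounds the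
  -- distance.
  have hpt : gridPt (β * p) (fun i => ⌊x i / (β * p)⌋) ∈ Λ.points := by
    rw [ModLattice.mem_points, hΛ, mem_range_lineMatrix]
    refine ⟨fun i => p * ⌊x i / (β * p)⌋, ?_, ?_⟩
    · ext i
      simp only [gridPt]
      push_cast
      ring
    · intro i
      simp
  refine (ModLattice.normSq_modulo_le hpt x).trans ((normSq_sub_gridPt_le hmem).trans ?_)
  rw [mul_pow, Real.sq_sqrt (Nat.cast_nonneg _), Fintype.card_fin]
  push_cast
  linarith

/-! ### The aliasing event -/

/-- The event that some nonzero lattice point is at least as close to `x` as the origin. -/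
def aliased {L : ℕ} (Λ : ModLattice L) : Set (Fin L → ℝ) :=
  {x | ∃ k, latticeHom Λ.G k ≠ 0 ∧ normSq (x - latticeHom Λ.G k) ≤ normSq x}

lemma measurableSet_aliased {L : ℕ} (Λ : ModLattice L) : MeasurableSet (aliased Λ) := by
  have : aliased Λ = ⋃ k ∈ {k | latticeHom Λ.G k ≠ 0},
      {x | normSq (x - latticeHom Λ.G k) ≤ normSq x} := by
    ext x; simp [aliased]
  rw [this]
  exact MeasurableSet.biUnion (Set.to_countable _) fun k _ => measurableSet_le
    (measurable_normSq.comp (measurable_id.sub_const _)) measurable_normSq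

/-- Unlike the complement of the cell, `aliased` counts all ties as failures and so does not depend
on the quantizer's choices. This makes it easy to count and gives it the monotonicity under scaling
proved next. -/
lemma mem_cell_of_notMem_aliased {L : ℕ} {Λ : ModLattice L} {x : Fin L → ℝ} (hx : x ∉ aliased Λ) :
    x ∈ Λ.cell := by
  obtain ⟨k, hk⟩ := Λ.quant_mem x
  by_contra h
  refine hx ⟨k, ?_, ?_⟩
  · intro h0
    exact h (hk.trans h0)
  · have := Λ.nearest x 0
    rw [hk] at this
    refine this.trans (le_of_eq ?_)
    simp [normSq, Matrix.mulVec, dotProduct]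

/-- The complement of the aliasing event is star-shaped. -/
lemma smul_notMem_aliased {L : ℕ} {Λ : ModLattice L} {x : Fin L → ℝ} (hx : x ∉ aliased Λ) {t : ℝ}
    (h0 : 0 ≤ t) (h1 : t ≤ 1) : t • x ∉ aliased Λ := by
  rintro ⟨k, hk, hle⟩
  -- That `λ` is as close to `t x` as the origin means `|λ|² ≤ 2 t ⟨x, λ⟩`. Since `λ ≠ 0` this
  -- forces `⟨x, λ⟩ ≥ 0`, and then the inequality persists when `t` is raised to `1`.
  refine hx ⟨k, hk, ?_⟩
  have hexp : ∀ z : Fin L → ℝ, normSq (z - latticeHom Λ.G k) =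
      normSq z - 2 * ∑ i, z i * latticeHom Λ.G k i + normSq (latticeHom Λ.G k) := by
    intro z
    simp only [normSq, Finset.mul_sum, ← Finset.sum_sub_distrib, ← Finset.sum_add_distrib]
    exact Finset.sum_congr rfl fun i _ => by simp only [Pi.sub_apply]; ring
  rw [hexp] at hle ⊢
  have h2 : ∑ i, (t • x) i * latticeHom Λ.G k i = t * ∑ i, x i * latticeHom Λ.G k i := by
    rw [Finset.mul_sum]
    exact Finset.sum_congr rfl fun i _ => by simp only [Pi.smul_apply, smul_eq_mul]; ring
  rw [h2] at hle
  set s := ∑ i, x i * latticeHom Λ.G k i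
  have := normSq_nonneg (latticeHom Λ.G k)
  have h3 : normSq (latticeHom Λ.G k) ≤ 2 * (t * s) := by linarith
  have hs : 0 ≤ s := by
    by_contra hs
    push Not at hs
    have h4 : normSq (latticeHom Λ.G k) = 0 := le_antisymm (by nlinarith) this
    refine hk (funext fun i => ?_)
    have := sq_le_normSq (latticeHom Λ.G k) i
    rw [h4] at this
    exact pow_eq_zero_iff (two_ne_zero) |>.1 (le_antisymm this (sq_nonneg _))
  nlinarith


/-- Within a ball of diameter less than `β p`, integer coordinates differ by less than `p`, so
reduction modulo `p` loses nothing there. -/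
lemma eq_of_gridPt_near_of_cast_eq {ι : Type*} [Fintype ι] {p : ℕ} {β : ℝ} (hβ : 0 < β) {z : ι → ℝ}
    {r : ℝ} (hr : 0 ≤ r) (hrp : 2 * r < β * p) {y y' : ι → ℤ}
    (hy : normSq (z - gridPt β y) ≤ r ^ 2) (hy' : normSq (z - gridPt β y') ≤ r ^ 2)
    (h : ∀ i, (y i : ZMod p) = y' i) : y = y' := by
  ext i
  have h1 : ∀ {y : ι → ℤ}, normSq (z - gridPt β y) ≤ r ^ 2 → |z i - β * y i| ≤ r := fun hy =>
    abs_le_of_sq_le_sq ((sq_le_normSq _ i).trans hy) hr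
  have h2 : |β * (y i - y' i : ℝ)| < β * p := by
    have : β * (y i - y' i : ℝ) = (z i - β * y' i) - (z i - β * y i) := by ring
    rw [this]
    refine (abs_sub _ _).trans_lt ?_
    linarith [h1 hy, h1 hy']
  rw [abs_mul, abs_of_pos hβ] at h2
  have h3 : |y i - y' i| < p := by
    have := lt_of_mul_lt_mul_left h2 hβ.le
    exact_mod_cast this
  have h4 : (p : ℤ) ∣ y i - y' i := by
    rw [← ZMod.intCast_zmod_eq_zero_iff_dvd]
    push_cast
    rw [h i, sub_self]
  exact sub_eq_zero.1 (Int.eq_zero_of_abs_lt_dvd h4 h3)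

/-- Minkowski–Hlawka bound: the aliasing probability within a ball, summed over the random
lattices. -/
lemma sum_measure_aliased_le {n p : ℕ} [Fact p.Prime] {β : ℝ} (hβ : 0 < β)
    (Λ : (Fin n → ZMod p) → ModLattice (n + 1)) (hΛ : ∀ g, (Λ g).G = lineMatrix β g)
    (ν : Measure (Fin (n + 1) → ℝ)) [IsProbabilityMeasure ν] {ρ : ℝ} (hρ : 0 ≤ ρ)
    (hρp : 2 * ρ < β * p) :
    (∑ g, ν (aliased (Λ g) ∩ ballSq _ ρ)) * ENNReal.ofReal (β ^ (n + 1)) ≤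
      volume (ballSq (Fin (n + 1)) (ρ + β * √(n + 1 : ℕ))) := by
  classical
  -- A point `y` that aliases with `x` and has `y 0 ≠ 0` modulo `p` determines `g` as `y / y 0`.
  -- Hence there are no more bad lattices than grid points in the ball.
  have hcount : ∀ x ∈ ballSq (Fin (n + 1)) ρ,
      (Finset.univ.filter fun g => x ∈ aliased (Λ g)).card ≤ (gridBall hβ x ρ).card := by
    intro x hx
    have hx' : normSq x ≤ ρ ^ 2 := hx
    have hex : ∀ g, x ∈ aliased (Λ g) → ∃ y : Fin (n + 1) → ℤ, y ∈ gridBall hβ x ρ ∧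
        (y 0 : ZMod p) ≠ 0 ∧ ∀ i : Fin n, (y i.succ : ZMod p) = y 0 * g i := by
      rintro g ⟨k, hk, hle⟩
      obtain ⟨y, hy, hyg⟩ := (mem_range_lineMatrix β g _).1 ⟨k, rfl⟩
      rw [hΛ] at hk hle
      rw [hy] at hk hle
      -- If `y 0` vanished modulo `p`, so would all residues; but `0` lies in the same ball around
      -- `x`, so `y = 0`, which is excluded.
      refine ⟨y, (mem_gridBall hβ).2 (hle.trans hx'), fun h0 => hk ?_, hyg⟩
      have : y = 0 := by
        refine eq_of_gridPt_near_of_cast_eq hβ hρ hρp (z := x) (hle.trans hx') ?_ ?_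
        · have : gridPt β (0 : Fin (n + 1) → ℤ) = 0 := by ext; simp [gridPt]
          rw [this, sub_zero]; exact hx'
        · intro i
          induction i using Fin.cases with
          | zero => simp [h0]
          | succ i => rw [hyg, h0]; simp
      rw [this]; ext; simp [gridPt]
    choose! f hf hf0 hfg using hex
    refine Finset.card_le_card_of_injOn f (fun g hg => ?_) fun g hg g' hg' heq => ?_
    · exact hf g (by simpa using hg)
    · have hg1 : x ∈ aliased (Λ g) := by simpa using hg
      have hg2 : x ∈ aliased (Λ g') := by simpa using hg'
      ext1 i
      have h1 := hfg g hg1 i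
      have h2 := hfg g' hg2 i
      rw [heq] at h1
      exact mul_left_cancel₀ (hf0 g' hg2) (h1.symm.trans h2)
  have hmeas : ∀ g, MeasurableSet (aliased (Λ g) ∩ ballSq (Fin (n + 1)) ρ) := fun g =>
    (measurableSet_aliased _).inter (measurableSet_ballSq ρ)
  calc (∑ g, ν (aliased (Λ g) ∩ ballSq _ ρ)) * ENNReal.ofReal (β ^ (n + 1))
      = ∫⁻ x, (∑ g, (aliased (Λ g) ∩ ballSq _ ρ).indicator 1 x) *
          ENNReal.ofReal (β ^ (n + 1)) ∂ν := by
        rw [lintegral_mul_const _ (Finset.measurable_sum _ fun g _ =>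
          measurable_one.indicator (hmeas g)), lintegral_finsetSum _ fun g _ =>
          measurable_one.indicator (hmeas g)]
        simp only [lintegral_indicator_one (hmeas _)]
    _ ≤ ∫⁻ _, volume (ballSq (Fin (n + 1)) (ρ + β * √(n + 1 : ℕ))) ∂ν := by
        refine lintegral_mono fun x => ?_
        by_cases hx : x ∈ ballSq (Fin (n + 1)) ρ
        · have h1 : ∑ g, (aliased (Λ g) ∩ ballSq _ ρ).indicator (1 : (Fin (n + 1) → ℝ) → ℝ≥0∞) x =
              ((Finset.univ.filter fun g => x ∈ aliased (Λ g)).card : ℝ≥0∞) := by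
            rw [Finset.card_filter]
            push_cast
            refine Finset.sum_congr rfl fun g _ => ?_
            by_cases hg : x ∈ aliased (Λ g) <;> simp [hg, hx]
          rw [h1]
          have h2 := card_gridBall_mul_le hβ x hρ
          rw [Fintype.card_fin] at h2
          refine le_trans ?_ h2
          gcongr
          exact hcount x hx
        · have h1 : ∑ g, (aliased (Λ g) ∩ ballSq _ ρ).indicator (1 : (Fin (n + 1) → ℝ) → ℝ≥0∞) x = 0 :=
            Finset.sum_eq_zero fun g _ => by simp [hx]
          rw [h1]; simp
    _ = _ := by simp

/-- The lifts of `F_p^n` to the grid, with first coordinate `0`. -/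
def liftPt {n p : ℕ} (u : Fin n → ZMod p) : Fin (n + 1) → ℤ := Fin.cons 0 fun i => ((u i).val : ℤ)

/-- Covering bound: the volume of the points of the fundamental box at distance more than `r` from
the lattice, summed over the random lattices. -/
lemma sum_volume_uncovered_le {n p : ℕ} [Fact p.Prime] {β : ℝ} (hβ : 0 < β)
    (Λ : (Fin n → ZMod p) → ModLattice (n + 1)) (hΛ : ∀ g, (Λ g).G = lineMatrix β g)
    {r₁ : ℝ} (hr₁ : 0 ≤ r₁) (hrp : 2 * (r₁ + β * √(n + 1 : ℕ)) < β * p) :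
    (∑ g, volume (lineBox n p β ∩ {x | (r₁ + β * √(n + 1 : ℕ)) ^ 2 < normSq ((Λ g).modulo x)})) *
      volume (ballSq (Fin (n + 1)) r₁) ≤
      (p : ℝ≥0∞) ^ n * volume (lineBox n p β) ^ 2 := by
  classical
  set r : ℝ := r₁ + β * √(n + 1 : ℕ) with hr
  have hr0 : 0 ≤ r := by positivity
  have hpp : (0 : ℝ) < p := by exact_mod_cast (Fact.out : p.Prime).pos
  let bad : (Fin n → ZMod p) → Set (Fin (n + 1) → ℝ) := fun g => {x | r ^ 2 < normSq ((Λ g).modulo x)}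
  have hbad : ∀ g, MeasurableSet (bad g) := fun g => measurableSet_lt measurable_const
    (measurable_normSq.comp (Λ g).measurable_modulo)
  let C : Set (Fin (n + 1) → ℝ) := gridCube β 0
  have hC : MeasurableSet C := measurableSet_gridCube β 0
  -- The box is a union of `p^n` grid cubes indexed by `u`. Integrating over the box becomes
  -- integrating over one cube `C` and summing over `u`, which supplies the offset of a random
  -- affine line.
  let E : (Fin n → ZMod p) × (Fin n → ZMod p) → Set (Fin (n + 1) → ℝ) := fun gu =>
    C ∩ (fun θ => θ + gridPt β (liftPt gu.2)) ⁻¹' bad gu.1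
  have hE : ∀ gu, MeasurableSet (E gu) := fun gu => hC.inter ((measurable_add_const _) (hbad _))
  have hsplit : ∀ g, volume (lineBox n p β ∩ bad g) ≤ ∑ u, volume (E (g, u)) := by
    intro g
    have h1 : ∀ u, volume (E (g, u)) = volume (gridCube β (liftPt u) ∩ bad g) := by
      intro u
      rw [← measure_preimage_add_right volume (gridPt β (liftPt u)) (gridCube β (liftPt u) ∩ bad g)]
      have h2 : (fun θ => θ + gridPt β (liftPt u)) ⁻¹' gridCube β (liftPt u) = C := by
        ext θ
        simp [C, gridCube, gridPt, add_comm]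
      rw [Set.preimage_inter, h2]
    simp only [h1]
    refine (measure_mono ?_).trans (measure_biUnion_finset_le _ _)
    rintro x ⟨hx, hxb⟩
    simp only [Set.mem_iUnion, Finset.mem_univ, exists_prop, true_and]
    refine ⟨fun i => ((⌊x i.succ / β⌋ : ℤ) : ZMod p), ?_, hxb⟩
    have heq : liftPt (fun i => ((⌊x (Fin.succ i) / β⌋ : ℤ) : ZMod p)) =
        fun i => ⌊x i / β⌋ := by
      ext i
      have hxi := hx i trivial
      induction i using Fin.cases with
      | zero =>
        symm
        simp only [Fin.cases_zero] at hxi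
        simp only [liftPt, Fin.cons_zero]
        rw [Int.floor_eq_iff, le_div_iff₀ hβ, div_lt_iff₀ hβ]
        simpa using hxi
      | succ i =>
        simp only [liftPt, Fin.cons_succ, ZMod.val_intCast]
        simp only [Fin.cases_succ] at hxi
        refine Int.emod_eq_of_lt (Int.floor_nonneg.2 (div_nonneg hxi.1 hβ.le)) ?_
        rw [Int.floor_lt, div_lt_iff₀ hβ]
        push_cast
        linarith [hxi.2]
    rw [heq]
    exact mem_gridCube_floor hβ x
  have hpt : ∀ θ, ((Finset.univ.filter fun gu => θ ∈ E gu).card : ℝ≥0∞) *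
      volume (ballSq (Fin (n + 1)) r₁) ≤ (p : ℝ≥0∞) ^ (3 * n) * ENNReal.ofReal (β ^ (n + 1)) := by
    intro θ
    let red : (Fin (n + 1) → ℤ) → ZMod p × (Fin n → ZMod p) := fun y =>
      ((y 0 : ZMod p), fun i => (y i.succ : ZMod p))
    let S : Finset (ZMod p × (Fin n → ZMod p)) := (gridBall hβ θ r).image red
    have hinj : Set.InjOn red (gridBall hβ θ r) := by
      intro y hy y' hy' h
      refine eq_of_gridPt_near_of_cast_eq hβ hr0 hrp ((mem_gridBall hβ).1 hy)
        ((mem_gridBall hβ).1 hy') fun i => ?_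
      induction i using Fin.cases with
      | zero => exact congrArg Prod.fst h
      | succ i => exact congrFun (congrArg Prod.snd h) i
    have hScard : S.card = (gridBall hβ θ r).card := Finset.card_image_of_injOn hinj
    -- If `u = y 0 • g - y'` for a grid point `y` near `θ`, then `y + u` is a lattice point and lies
    -- equally near `θ + u`. So an uncovered point yields a line that misses the residues of the
    -- ball, and `card_line_disjoint_mul_card_le` applies.
    have hsub : (Finset.univ.filter fun gu => θ ∈ E gu) ⊆
        Finset.univ.filter fun gu : (Fin n → ZMod p) × (Fin n → ZMod p) =>
          ∀ y ∈ S, gu.2 ≠ y.1 • gu.1 - y.2 := by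
      rintro ⟨g, u⟩ hgu
      simp only [Finset.mem_filter, Finset.mem_univ, true_and] at hgu ⊢
      rintro z hz heq
      obtain ⟨y, hy, rfl⟩ := Finset.mem_image.1 hz
      have hbd : r ^ 2 < normSq ((Λ g).modulo (θ + gridPt β (liftPt u))) := hgu.2
      refine absurd hbd (not_lt.2 ?_)
      have hmem : gridPt β (y + liftPt u) ∈ (Λ g).points := by
        rw [ModLattice.mem_points, hΛ, mem_range_lineMatrix]
        refine ⟨_, rfl, fun i => ?_⟩
        have := congrFun heq i
        simp only [red, Pi.sub_apply, Pi.smul_apply, smul_eq_mul] at this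
        simp [liftPt, this]
      refine (ModLattice.normSq_modulo_le hmem _).trans ?_
      have : θ + gridPt β (liftPt u) - gridPt β (y + liftPt u) = θ - gridPt β y := by
        ext i; simp [gridPt]; ring
      rw [this]
      exact (mem_gridBall hβ).1 hy
    have h1 := card_line_disjoint_mul_card_le (F := ZMod p) (A := Fin n → ZMod p) S
    have h2 : ((Finset.univ.filter fun gu => θ ∈ E gu).card) * S.card ≤ p ^ (3 * n) := by
      have h3 : ((Finset.univ.filter fun gu : (Fin n → ZMod p) × (Fin n → ZMod p) =>
          ∀ y ∈ S, gu.2 ≠ y.1 • gu.1 - y.2).card) * S.card ≤ p ^ (3 * n) := by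
        have : (Fintype.card (Fin n → ZMod p)) = p ^ n := by simp [ZMod.card]
        rw [this] at h1
        rw [mul_comm 3 n, pow_mul]
        exact_mod_cast h1
      exact (Nat.mul_le_mul_right _ (Finset.card_le_card hsub)).trans h3
    have h4 := volume_le_card_gridBall_mul hβ θ hr₁
    rw [Fintype.card_fin] at h4
    calc _ ≤ ((Finset.univ.filter fun gu => θ ∈ E gu).card : ℝ≥0∞) *
          ((S.card : ℝ≥0∞) * ENNReal.ofReal (β ^ (n + 1))) := by
          rw [hScard]
          gcongr
      _ ≤ _ := by
          rw [← mul_assoc]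
          gcongr
          exact_mod_cast h2
  have hbox : volume (lineBox n p β) = (p : ℝ≥0∞) ^ n * ENNReal.ofReal (β ^ (n + 1)) := by
    rw [volume_lineBox n p hβ.le, ← ENNReal.ofReal_natCast, ← ENNReal.ofReal_pow hpp.le,
      ← ENNReal.ofReal_mul (by positivity)]
    congr 1
    ring
  calc (∑ g, volume (lineBox n p β ∩ bad g)) * volume (ballSq (Fin (n + 1)) r₁)
      ≤ (∑ gu, volume (E gu)) * volume (ballSq (Fin (n + 1)) r₁) := by
        gcongr
        rw [Fintype.sum_prod_type]
        exact Finset.sum_le_sum fun g _ => hsplit g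
    _ = ∫⁻ θ in C, ((Finset.univ.filter fun gu => θ ∈ E gu).card : ℝ≥0∞) *
          volume (ballSq (Fin (n + 1)) r₁) := by
        have h1 : ∀ θ, ((Finset.univ.filter fun gu => θ ∈ E gu).card : ℝ≥0∞) =
            ∑ gu, (E gu).indicator 1 θ := by
          intro θ
          rw [Finset.card_filter]
          push_cast
          exact Finset.sum_congr rfl fun gu _ => by by_cases h : θ ∈ E gu <;> simp [h]
        simp only [h1]
        rw [lintegral_mul_const _ (Finset.measurable_sum _ fun g _ =>
          measurable_one.indicator (hE g)), lintegral_finsetSum _ fun g _ =>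
          measurable_one.indicator (hE g)]
        simp only [lintegral_indicator_one (hE _), Measure.restrict_apply (hE _)]
        congr 1
        refine Finset.sum_congr rfl fun gu _ => ?_
        rw [Set.inter_eq_left.2 (fun x hx => hx.1)]
    _ ≤ ∫⁻ θ in C, (p : ℝ≥0∞) ^ (3 * n) * ENNReal.ofReal (β ^ (n + 1)) :=
        lintegral_mono fun θ => hpt θ
    _ = _ := by
        rw [lintegral_const, Measure.restrict_apply_univ, volume_gridCube hβ, Fintype.card_fin, hbox]
        ring


/-! ### Gaussian concentration -/

/-- Exponential tilting turns the density of variance `v` into a multiple of the density of variance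
`v / (1 - 2t)`. -/
lemma lintegral_exp_sq_gaussianReal {v : ℝ} (hv : 0 < v) {t : ℝ} (ht : t < 1 / 2) :
    ∫⁻ x, ENNReal.ofReal (Real.exp (t * x ^ 2 / v)) ∂gaussianReal 0 v.toNNReal =
      ENNReal.ofReal (√(1 - 2 * t))⁻¹ := by
  have h1t : 0 < 1 - 2 * t := by linarith
  have hv0 : v.toNNReal ≠ 0 := (Real.toNNReal_pos.2 hv).ne'
  have hw : 0 < v / (1 - 2 * t) := div_pos hv h1t
  have hw0 : (v / (1 - 2 * t)).toNNReal ≠ 0 := (Real.toNNReal_pos.2 hw).ne'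
  rw [gaussianReal_of_var_ne_zero _ hv0, lintegral_withDensity_eq_lintegral_mul _
    (measurable_gaussianPDF _ _) (by fun_prop)]
  have h : ∀ x, (gaussianPDF 0 v.toNNReal * fun x => ENNReal.ofReal (Real.exp (t * x ^ 2 / v))) x =
      ENNReal.ofReal (√(1 - 2 * t))⁻¹ * gaussianPDF 0 (v / (1 - 2 * t)).toNNReal x := by
    intro x
    simp only [Pi.mul_apply, gaussianPDF, gaussianPDFReal, Real.coe_toNNReal _ hv.le,
      Real.coe_toNNReal _ hw.le]
    rw [← ENNReal.ofReal_mul (by positivity), ← ENNReal.ofReal_mul (by positivity)]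
    congr 1
    rw [mul_assoc, ← Real.exp_add, ← mul_assoc, ← mul_inv, ← Real.sqrt_mul h1t.le]
    congr 3
    · field_simp
    · field_simp
      ring
  simp only [h]
  rw [lintegral_const_mul _ (measurable_gaussianPDF _ _), lintegral_gaussianPDF_eq_one _ hw0, mul_one]

/-- Since `-½ log(1 - 2t) = t + t² + O(t³)`, a doubled quadratic term covers the remainder on this
range. -/
lemma inv_sqrt_one_sub_le {t : ℝ} (h0 : 0 ≤ t) (h1 : t ≤ 1 / 4) :
    (√(1 - 2 * t))⁻¹ ≤ Real.exp (t + 2 * t ^ 2) := by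
  have h2 : Real.exp (-(t + 2 * t ^ 2)) ≤ √(1 - 2 * t) := by
    apply Real.le_sqrt_of_sq_le
    rw [← Real.exp_nat_mul]
    have h3 := Real.quadratic_le_exp_of_nonneg (by positivity : 0 ≤ 2 * t + 4 * t ^ 2)
    have h4 : ((2 : ℕ) : ℝ) * -(t + 2 * t ^ 2) = -(2 * t + 4 * t ^ 2) := by push_cast; ring
    rw [h4, Real.exp_neg, inv_le_comm₀ (Real.exp_pos _) (by linarith)]
    refine le_trans ?_ h3
    rw [inv_le_iff_one_le_mul₀ (by linarith)]
    have h5 : (0 : ℝ) ≤ 1 - 4 * t := by linarith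
    nlinarith [mul_nonneg (sq_nonneg t) h5, mul_nonneg (pow_nonneg h0 3) h5,
      mul_nonneg (pow_nonneg h0 4) h5, sq_nonneg t]
  rw [inv_le_comm₀ (lt_of_lt_of_le (Real.exp_pos _) h2) (Real.exp_pos _), ← Real.exp_neg]
  exact h2

lemma lintegral_pi_prod {ι : Type*} [Fintype ι] (μ : Measure ℝ) [IsProbabilityMeasure μ]
    {f : ℝ → ℝ≥0∞} (hf : Measurable f) :
    ∫⁻ x : ι → ℝ, ∏ i, f (x i) ∂Measure.pi (fun _ => μ) = (∫⁻ x, f x ∂μ) ^ Fintype.card ι := by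
  have hind : iIndepFun (fun (i : ι) (x : ι → ℝ) => f (x i)) (Measure.pi fun _ => μ) :=
    iIndepFun_pi (X := fun _ => f) fun _ => hf.aemeasurable
  have h := lintegral_prod_eq_prod_lintegral_of_indepFun Finset.univ
    (fun (i : ι) (x : ι → ℝ) => f (x i)) hind fun i => hf.comp (measurable_pi_apply i)
  rw [h, Finset.prod_congr rfl fun i _ => (measurePreserving_eval (fun _ : ι => μ) i).lintegral_comp hf]
  simp

/-- Chernoff bound for the squared norm of a white Gaussian vector. -/
lemma gaussian_normSq_tail {L : ℕ} {v a : ℝ} (hv : 0 < v) (ha : 0 < a) (ha1 : a ≤ 1) :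
    (Measure.pi fun _ : Fin L => gaussianReal 0 v.toNNReal) {x | L * v * (1 + a) < normSq x} ≤
      ENNReal.ofReal (Real.exp (-(L * a ^ 2 / 8))) := by
  -- This `t` maximises the exponent `t (1 + a) - (t + 2 t²)`, whose value becomes `a²/8`.
  set t := a / 4 with ht
  set ν := Measure.pi fun _ : Fin L => gaussianReal 0 v.toNNReal
  have hexp : ∀ x : Fin L → ℝ, ∏ i, ENNReal.ofReal (Real.exp (t * x i ^ 2 / v)) =
      ENNReal.ofReal (Real.exp (t * normSq x / v)) := by
    intro x
    rw [← ENNReal.ofReal_prod_of_nonneg fun _ _ => (Real.exp_pos _).le, ← Real.exp_sum]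
    congr 2
    rw [normSq, Finset.mul_sum, Finset.sum_div]
  have hint : ∫⁻ x, ENNReal.ofReal (Real.exp (t * normSq x / v)) ∂ν ≤
      ENNReal.ofReal (Real.exp (L * (t + 2 * t ^ 2))) := by
    simp only [← hexp]
    rw [lintegral_pi_prod (ι := Fin L) (gaussianReal 0 v.toNNReal)
      (f := fun x => ENNReal.ofReal (Real.exp (t * x ^ 2 / v))) (by fun_prop), lintegral_exp_sq_gaussianReal hv (by linarith),
      Fintype.card_fin, ← ENNReal.ofReal_pow (by positivity), Real.exp_nat_mul]
    exact ENNReal.ofReal_le_ofReal (pow_le_pow_left₀ (by positivity)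
      (inv_sqrt_one_sub_le (by positivity) (by linarith)) _)
  have hmk := mul_meas_ge_le_lintegral (μ := ν)
    (f := fun x => ENNReal.ofReal (Real.exp (t * normSq x / v)))
    (((measurable_normSq.const_mul t).div_const v).exp.ennreal_ofReal)
    (ENNReal.ofReal (Real.exp (t * L * (1 + a))))
  have hsub : {x : Fin L → ℝ | L * v * (1 + a) < normSq x} ⊆
      {x | ENNReal.ofReal (Real.exp (t * L * (1 + a))) ≤
        ENNReal.ofReal (Real.exp (t * normSq x / v))} := by
    intro x hx
    have hx' : L * v * (1 + a) < normSq x := hx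
    refine ENNReal.ofReal_le_ofReal (Real.exp_le_exp.2 ?_)
    rw [le_div_iff₀ hv]
    have ht0 : 0 < t := by positivity
    nlinarith
  have hc : ENNReal.ofReal (Real.exp (t * L * (1 + a))) ≠ 0 := by
    simp [Real.exp_pos]
  calc ν {x | L * v * (1 + a) < normSq x}
      ≤ (ENNReal.ofReal (Real.exp (t * L * (1 + a))))⁻¹ *
          ENNReal.ofReal (Real.exp (L * (t + 2 * t ^ 2))) := by
        rw [← ENNReal.div_eq_inv_mul, ENNReal.le_div_iff_mul_le (Or.inl hc)
          (Or.inl ENNReal.ofReal_ne_top), mul_comm]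
        refine le_trans ?_ (hmk.trans hint)
        gcongr
    _ = _ := by
        rw [← ENNReal.ofReal_inv_of_pos (Real.exp_pos _), ← ENNReal.ofReal_mul (by positivity),
          ← Real.exp_neg, ← Real.exp_add]
        congr 2
        rw [ht]; ring

/-- White Gaussian vectors of smaller variance are scaled-down versions. -/
lemma pi_gaussianReal_eq_map_smul {L : ℕ} {v v' : ℝ} (hv : 0 < v) (hv' : 0 ≤ v') :
    (Measure.pi fun _ : Fin L => gaussianReal 0 v'.toNNReal) =
      (Measure.pi fun _ : Fin L => gaussianReal 0 v.toNNReal).map fun x => √(v' / v) • x := by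
  have h1 : (gaussianReal 0 v.toNNReal).map (√(v' / v) * ·) = gaussianReal 0 v'.toNNReal := by
    rw [gaussianReal_map_const_mul]
    congr 1
    · simp
    · ext
      simp only [NNReal.coe_mul, NNReal.coe_mk, Real.coe_toNNReal _ hv.le, Real.coe_toNNReal _ hv']
      rw [Real.sq_sqrt (by positivity)]
      field_simp
  have h2 := Measure.pi_map_pi (μ := fun _ : Fin L => gaussianReal 0 v.toNNReal)
    (f := fun _ x => √(v' / v) * x) (fun _ => by fun_prop)
  simp only [h1] at h2
  rw [← h2]
  rfl

/-- Noise of smaller variance is a shrunken copy, and the complement of `aliased` is star-shaped.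
One estimate at the largest variance thus serves all steps of the scheme, whose variances differ. -/
lemma gaussian_compl_cell_le {L : ℕ} (Λ : ModLattice L) {v v' : ℝ} (hv : 0 < v) (hv' : 0 ≤ v')
    (hle : v' ≤ v) :
    (Measure.pi fun _ : Fin L => gaussianReal 0 v'.toNNReal) Λ.cellᶜ ≤
      (Measure.pi fun _ : Fin L => gaussianReal 0 v.toNNReal) (aliased Λ) := by
  rw [pi_gaussianReal_eq_map_smul hv hv', Measure.map_apply (by fun_prop) Λ.measurableSet_cell.compl]
  refine measure_mono fun x hx => ?_
  by_contra h
  refine hx (mem_cell_of_notMem_aliased (smul_notMem_aliased h (Real.sqrt_nonneg _) ?_))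
  rw [Real.sqrt_le_one]
  exact (div_le_one hv).2 hle


/-! ### Existence of good lattices -/

/-- If the density of the lattices is that of the ball of radius `a`, some lattice has both few
aliased points in a slightly smaller ball and few uncovered points for a slightly larger ball. -/
lemma exists_good_line {n p : ℕ} [Fact p.Prime] {β a κ : ℝ} (hβ : 0 < β) (ha : 0 < a)
    (hκ : 0 < κ) (hκ1 : κ ≤ 1 / 4) (hV : volume (lineBox n p β) = volume (ballSq (Fin (n + 1)) a))
    (hβκ : β * √(n + 1 : ℕ) ≤ κ * a) (hap : 3 * a < β * p)
    (Λ : (Fin n → ZMod p) → ModLattice (n + 1)) (hΛ : ∀ g, (Λ g).G = lineMatrix β g)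
    (ν : Measure (Fin (n + 1) → ℝ)) [IsProbabilityMeasure ν] :
    ∃ g, ν (aliased (Λ g) ∩ ballSq _ ((1 - 2 * κ) * a)) +
        volume (lineBox n p β ∩ {x | ((1 + 2 * κ) * a) ^ 2 < normSq ((Λ g).modulo x)}) /
          volume (lineBox n p β) ≤
      ENNReal.ofReal ((1 - κ) ^ (n + 1) + ((1 + κ) ^ (n + 1))⁻¹) := by
  have hpp : (0 : ℝ) < p := by exact_mod_cast (Fact.out : p.Prime).pos
  set V := volume (lineBox n p β) with hVdef
  have hV0 : V ≠ 0 := by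
    rw [hVdef, volume_lineBox n p hβ.le]
    simp only [ne_eq, ENNReal.ofReal_eq_zero, not_le]
    positivity
  have hVt : V ≠ ⊤ := by
    rw [hVdef, volume_lineBox n p hβ.le]; exact ENNReal.ofReal_ne_top
  set q : ℝ≥0∞ := (p : ℝ≥0∞) ^ n with hq
  have hVq : V = q * ENNReal.ofReal (β ^ (n + 1)) := by
    rw [hVdef, volume_lineBox n p hβ.le, hq, ← ENNReal.ofReal_natCast, ← ENNReal.ofReal_pow hpp.le,
      ← ENNReal.ofReal_mul (by positivity)]
    congr 1
    ring
  have hscale : ∀ c : ℝ, 0 < c → volume (ballSq (Fin (n + 1)) (c * a)) =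
      ENNReal.ofReal (c ^ (n + 1)) * V := by
    intro c hc
    rw [hV, volume_ballSq (mul_pos hc ha), volume_ballSq ha, Fintype.card_fin, ← mul_assoc,
      ← ENNReal.ofReal_mul (by positivity), mul_pow]
  have hmono : ∀ {r s : ℝ}, 0 ≤ r → r ≤ s → ballSq (Fin (n + 1)) r ⊆ ballSq (Fin (n + 1)) s := by
    intro r s hr hrs x hx
    have hx' : normSq x ≤ r ^ 2 := hx
    exact hx'.trans (pow_le_pow_left₀ hr hrs 2)
  have hρ : 0 ≤ (1 - 2 * κ) * a := mul_nonneg (by linarith) ha.le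
  -- The discretisation error `β √(n+1) ≤ κ a` uses one of the two margins `κ`; the other leaves the
  -- volume ratio `(1 - κ)^(n+1)`. The covering bound is treated in the same way.
  have h1 : (∑ g, ν (aliased (Λ g) ∩ ballSq _ ((1 - 2 * κ) * a))) ≤
      ENNReal.ofReal ((1 - κ) ^ (n + 1)) * q := by
    have h2 := (sum_measure_aliased_le hβ Λ hΛ ν hρ (by nlinarith)).trans
      (measure_mono (hmono (s := (1 - κ) * a) (by positivity) (by nlinarith)))
    rw [hscale _ (by linarith), hVq, ← mul_assoc] at h2
    exact (ENNReal.mul_le_mul_iff_left (by simp; positivity) ENNReal.ofReal_ne_top).1 h2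
  have h2 : (∑ g, volume (lineBox n p β ∩
      {x | ((1 + 2 * κ) * a) ^ 2 < normSq ((Λ g).modulo x)}) / V) ≤
      ENNReal.ofReal (((1 + κ) ^ (n + 1))⁻¹) * q := by
    have hr₁ : 0 ≤ (1 + 2 * κ) * a - β * √(n + 1 : ℕ) := by nlinarith
    have h3 := sum_volume_uncovered_le hβ Λ hΛ hr₁ (by rw [sub_add_cancel]; nlinarith)
    rw [sub_add_cancel] at h3
    have h4 : ENNReal.ofReal ((1 + κ) ^ (n + 1)) * V ≤
        volume (ballSq (Fin (n + 1)) ((1 + 2 * κ) * a - β * √(n + 1 : ℕ))) := by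
      rw [← hscale _ (by linarith)]
      exact measure_mono (hmono (by positivity) (by nlinarith))
    simp only [div_eq_mul_inv]
    rw [← Finset.sum_mul, ← div_eq_mul_inv, ENNReal.ofReal_inv_of_pos (by positivity), mul_comm _ q,
      ← div_eq_mul_inv, ENNReal.div_le_iff hV0 hVt,
      ← ENNReal.mul_div_right_comm,
      ENNReal.le_div_iff_mul_le (Or.inl (by simp; positivity)) (Or.inl ENNReal.ofReal_ne_top)]
    refine (ENNReal.mul_le_mul_iff_left hV0 hVt).1 ?_
    calc _ = (∑ g, volume (lineBox n p β ∩
          {x | ((1 + 2 * κ) * a) ^ 2 < normSq ((Λ g).modulo x)})) *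
          (ENNReal.ofReal ((1 + κ) ^ (n + 1)) * V) := by rw [mul_assoc]
      _ ≤ _ := mul_le_mul_right h4 _
      _ ≤ _ := h3
      _ = q * V * V := by rw [sq, mul_assoc]
  have hcard : ((Finset.univ : Finset (Fin n → ZMod p)).card : ℝ≥0∞) = q := by
    rw [Finset.card_univ, Fintype.card_fun, ZMod.card, Fintype.card_fin, hq]; push_cast; rfl
  -- Averaging the sum of the two failure fractions yields one `g` good for both.
  obtain ⟨g, _, hg⟩ := ENNReal.exists_le_of_sum_le (s := (Finset.univ : Finset (Fin n → ZMod p)))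
    ⟨0, Finset.mem_univ _⟩
    (f := fun g => ν (aliased (Λ g) ∩ ballSq _ ((1 - 2 * κ) * a)) +
        volume (lineBox n p β ∩ {x | ((1 + 2 * κ) * a) ^ 2 < normSq ((Λ g).modulo x)}) / V)
    (g := fun _ => ENNReal.ofReal ((1 - κ) ^ (n + 1) + ((1 + κ) ^ (n + 1))⁻¹)) (by
      rw [Finset.sum_add_distrib, Finset.sum_const, nsmul_eq_mul, hcard,
        ENNReal.ofReal_add (pow_nonneg (by linarith) _) (by positivity), mul_add, mul_comm q,
        mul_comm q]
      exact add_le_add h1 h2)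
  exact ⟨g, hg⟩

/-- Second moment of a lattice all but a fraction `D` of whose cell is within distance `r`. -/
lemma lintegral_normSq_uniformCell_le {L : ℕ} (Λ : ModLattice L) {B : Set (Fin L → ℝ)}
    (hB : IsAddFundamentalDomain Λ.points B volume) (hB0 : volume B ≠ 0) (hBt : volume B ≠ ⊤)
    {r R D : ℝ} (hR : ∀ x, normSq (Λ.modulo x) ≤ R) (hD0 : 0 ≤ D)
    (hD : volume (B ∩ {x | r ^ 2 < normSq (Λ.modulo x)}) / volume B ≤ ENNReal.ofReal D) :
    ∫⁻ x, ENNReal.ofReal (normSq x) ∂Λ.uniformCell ≤ ENNReal.ofReal (r ^ 2 + R * D) := by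
  have hR0 : 0 ≤ R := (normSq_nonneg _).trans (hR 0)
  set A := {x | r ^ 2 < normSq (Λ.modulo x)}
  have hA : MeasurableSet A := measurableSet_lt measurable_const
    (measurable_normSq.comp Λ.measurable_modulo)
  rw [Λ.lintegral_uniformCell_eq hB]
  have h1 : ∫⁻ x in B, ENNReal.ofReal (normSq (Λ.modulo x)) ≤
      ENNReal.ofReal (r ^ 2) * volume B + ENNReal.ofReal R * volume (B ∩ A) := by
    calc _ ≤ ∫⁻ x in B, (ENNReal.ofReal (r ^ 2) + A.indicator (fun _ => ENNReal.ofReal R) x) := by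
          refine lintegral_mono fun x => ?_
          by_cases hx : x ∈ A
          · rw [Set.indicator_of_mem hx]
            exact (ENNReal.ofReal_le_ofReal (hR x)).trans le_add_self
          · rw [Set.indicator_of_notMem hx, add_zero]
            exact ENNReal.ofReal_le_ofReal (not_lt.1 hx)
      _ = _ := by
          rw [lintegral_add_left measurable_const, lintegral_indicator hA, setLIntegral_const,
            setLIntegral_const, Measure.restrict_apply hA, Set.inter_comm A B]
  calc _ ≤ (volume B)⁻¹ * (ENNReal.ofReal (r ^ 2) * volume B +
        ENNReal.ofReal R * volume (B ∩ A)) := mul_le_mul_right h1 _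
    _ = ENNReal.ofReal (r ^ 2) + ENNReal.ofReal R * (volume (B ∩ A) / volume B) := by
        rw [mul_add, mul_comm, mul_assoc, ENNReal.mul_inv_cancel hB0 hBt, mul_one]
        congr 1
        rw [div_eq_mul_inv]; ring
    _ ≤ ENNReal.ofReal (r ^ 2) + ENNReal.ofReal R * ENNReal.ofReal D := by gcongr
    _ = _ := by
        rw [← ENNReal.ofReal_mul hR0, ← ENNReal.ofReal_add (by positivity) (by positivity)]

/-- A fine grid spacing for which the box has the volume of the ball of radius `a`. -/
lemma exists_grid_spacing (n : ℕ) (hn : 4 ≤ n + 1) {a : ℝ} (ha : 0 < a) :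
    ∃ p : ℕ, p.Prime ∧ ∃ β : ℝ, 0 < β ∧ volume (lineBox n p β) = volume (ballSq (Fin (n + 1)) a) ∧
      3 * a < β * p ∧ β * p ≤ 4 * a * (n + 1) ∧ β * √(n + 1 : ℕ) ≤ 4 * a / (n + 1) ^ 2 := by
  set L : ℝ := (n : ℝ) + 1 with hL
  have hL4 : 4 ≤ L := by rw [hL]; exact_mod_cast hn
  have hL0 : 0 < L := by linarith
  have hLc : ((n + 1 : ℕ) : ℝ) = L := by push_cast; rfl
  -- Bertrand's postulate. With `p ≈ L^L`, `L = n + 1`, the `L`-th root of `p` is about `L`, so `β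
  -- p` exceeds `a` by a factor polynomial in `L`, while `β` itself is tiny.
  obtain ⟨p, hp, hlow, hup⟩ := Nat.exists_prime_lt_and_le_two_mul ((n + 1) ^ (n + 1)) (by positivity)
  have hp0 : (0 : ℝ) < p := by exact_mod_cast hp.pos
  have hlow' : L ^ (n + 1) ≤ p := by rw [← hLc]; exact_mod_cast hlow.le
  have hup' : (p : ℝ) ≤ 2 * L ^ (n + 1) := by rw [← hLc]; exact_mod_cast hup
  have hu0 : volume (ballSq (Fin (n + 1)) 1) ≤ ENNReal.ofReal (2 ^ (n + 1)) := by
    simpa using volume_ballSq_one_le (ι := Fin (n + 1))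
  have hl0 : ENNReal.ofReal ((2 / √L) ^ (n + 1)) ≤ volume (ballSq (Fin (n + 1)) 1) := by
    have := le_volume_ballSq_one (ι := Fin (n + 1))
    rwa [Fintype.card_fin, hLc] at this
  have hfin : volume (ballSq (Fin (n + 1)) 1) ≠ ⊤ := ne_top_of_le_ne_top ENNReal.ofReal_ne_top hu0
  set b := (volume (ballSq (Fin (n + 1)) 1)).toReal with hb
  have hbe : volume (ballSq (Fin (n + 1)) 1) = ENNReal.ofReal b := (ENNReal.ofReal_toReal hfin).symm
  have hb2 : b ≤ 2 ^ (n + 1) := by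
    rw [hbe] at hu0
    exact (ENNReal.ofReal_le_ofReal_iff (by positivity)).1 hu0
  have hb1 : (2 / √L) ^ (n + 1) ≤ b := by
    rw [hbe] at hl0
    exact (ENNReal.ofReal_le_ofReal_iff ENNReal.toReal_nonneg).1 hl0
  have hsL : 0 < √L := Real.sqrt_pos.2 hL0
  have hb0 : 0 < b := lt_of_lt_of_le (by positivity) hb1
  set V := a ^ (n + 1) * b with hV
  have hV0 : 0 < V := by positivity
  -- The solution of `β^(n+1) p^n = V`, that is, of equality of the volumes of box and ball.
  set β := (V / p ^ n) ^ (((n + 1 : ℕ) : ℝ)⁻¹) with hβ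
  have hβ0 : 0 < β := by positivity
  have hβpow : β ^ (n + 1) = V / p ^ n :=
    Real.rpow_inv_natCast_pow (by positivity) (by simp)
  have hβp : (β * p) ^ (n + 1) = V * p := by
    rw [mul_pow, hβpow]; field_simp; ring
  have h1 : 2 * a * √L ≤ β * p := by
    refine le_of_pow_le_pow_left₀ (Nat.succ_ne_zero n) (by positivity) ?_
    rw [hβp]
    calc (2 * a * √L) ^ (n + 1) = a ^ (n + 1) * (2 / √L) ^ (n + 1) * L ^ (n + 1) := by
          rw [← mul_pow, ← mul_pow]
          congr 1
          field_simp
          rw [Real.sq_sqrt hL0.le]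
      _ ≤ V * p := by rw [hV]; gcongr
  have h2 : β * p ≤ 4 * a * L := by
    refine le_of_pow_le_pow_left₀ (Nat.succ_ne_zero n) (by positivity) ?_
    rw [hβp]
    calc V * p ≤ (a ^ (n + 1) * 2 ^ (n + 1)) * (2 ^ (n + 1) * L ^ (n + 1)) := by
          rw [hV]
          gcongr
          refine hup'.trans ?_
          gcongr
          exact le_self_pow₀ (by norm_num) (Nat.succ_ne_zero n)
      _ = _ := by
          rw [← mul_pow, ← mul_pow, ← mul_pow]; congr 1; ring
  have hs2 : 2 ≤ √L := by
    rw [show (2 : ℝ) = √(2 ^ 2) by rw [Real.sqrt_sq (by norm_num)]]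
    exact Real.sqrt_le_sqrt (by linarith)
  refine ⟨p, hp, β, hβ0, ?_, ?_, h2, ?_⟩
  · rw [volume_lineBox n p hβ0.le, volume_ballSq ha, hbe, Fintype.card_fin,
      ← ENNReal.ofReal_mul (by positivity)]
    congr 1
    have : β * (β * p) ^ n = β ^ (n + 1) * p ^ n := by ring
    rw [this, hβpow]; field_simp; rw [hV]
  · nlinarith
  · rw [hLc, le_div_iff₀ (by positivity)]
    have h3 : L ^ 4 ≤ p := (pow_le_pow_right₀ (by linarith) hn).trans hlow'
    have h4 : √L ≤ L := by
      rw [Real.sqrt_le_left hL0.le]; nlinarith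
    have h5 : β * L ^ 4 ≤ 4 * a * L := (mul_le_mul_of_nonneg_left h3 hβ0.le).trans h2
    have h6 : β * √L * L ^ 2 * L ≤ 4 * a * L := by
      refine le_trans ?_ h5
      have : β * √L * L ^ 2 * L ≤ β * L * L ^ 2 * L := by gcongr
      refine this.trans (le_of_eq (by ring))
    exact le_of_mul_le_mul_right h6 hL0


lemma one_sub_pow_add_inv_one_add_pow_le {κ : ℝ} (h0 : 0 < κ) (h1 : κ ≤ 1 / 4) (L : ℕ) :
    (1 - κ) ^ L + ((1 + κ) ^ L)⁻¹ ≤ 2 * Real.exp (-(L * κ / 2)) := by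
  have h2 : 1 - κ ≤ Real.exp (-(κ / 2)) := by
    linarith [Real.add_one_le_exp (-(κ / 2))]
  have h3 : (1 + κ)⁻¹ ≤ Real.exp (-(κ / 2)) := by
    refine le_trans ?_ (Real.add_one_le_exp (-(κ / 2)))
    rw [inv_le_iff_one_le_mul₀ (by linarith)]
    nlinarith
  have h4 : Real.exp (-(κ / 2)) ^ L = Real.exp (-(L * κ / 2)) := by
    rw [← Real.exp_nat_mul]; congr 1; ring
  have h5 : (1 - κ) ^ L ≤ Real.exp (-(L * κ / 2)) := by
    rw [← h4]; exact pow_le_pow_left₀ (by linarith) h2 _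
  have h6 : ((1 + κ) ^ L)⁻¹ ≤ Real.exp (-(L * κ / 2)) := by
    rw [← h4, ← inv_pow]; exact pow_le_pow_left₀ (by positivity) h3 _
  linarith

set_option maxHeartbeats 800000 in
/-- In dimension `L = m⁴` there are lattices of second moment `v (1 + 1/m)` per dimension, whose
cell contains white Gaussian noise of variance `v` up to an exponentially small probability, and
whose covering radius is polynomial in `m`. -/
theorem exists_good_modLattice : ∃ m₀ : ℕ, ∀ m ≥ m₀, ∀ L : ℕ, L = m ^ 4 → ∀ v : ℝ, 0 < v →
    ∃ Λ : ModLattice L,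
      (∫⁻ x, ENNReal.ofReal (normSq x) ∂Λ.uniformCell ≤ ENNReal.ofReal (L * (v * (1 + 1 / m)))) ∧
      (∀ v', 0 ≤ v' → v' ≤ v → (Measure.pi fun _ : Fin L => gaussianReal 0 v'.toNNReal) Λ.cellᶜ ≤
        ENNReal.ofReal (3 * Real.exp (-(m / 128 : ℝ)))) ∧
      ∀ x, normSq (Λ.modulo x) ≤ 32 * v * m ^ 16 := by
  -- The uncovered fraction, at most `2 exp(-m)`, is weighted by the squared covering radius `32 v
  -- m^16` and must cost at most `v m³ / 4`; hence `13` and `256`.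
  have hlim : ∀ᶠ m : ℕ in atTop, (m : ℝ) ^ 13 * Real.exp (-m) ≤ 1 / 256 :=
    ((Real.tendsto_pow_mul_exp_neg_atTop_nhds_zero 13).comp
      tendsto_natCast_atTop_atTop).eventually_le_const (by norm_num)
  obtain ⟨m₁, hm₁⟩ := eventually_atTop.1 hlim
  refine ⟨max m₁ 8, fun m hm L hL v hv => ?_⟩
  have hm8 : (8 : ℝ) ≤ m := by exact_mod_cast (le_max_right _ _).trans hm
  have hmlim := hm₁ m ((le_max_left _ _).trans hm)
  have hm0 : (0 : ℝ) < m := by linarith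
  have hLm : (L : ℝ) = (m : ℝ) ^ 4 := by rw [hL]; push_cast; rfl
  have hL0 : (0 : ℝ) < L := by rw [hLm]; positivity
  obtain ⟨n, rfl⟩ : ∃ n, L = n + 1 := Nat.exists_eq_succ_of_ne_zero (by
    rintro rfl; simp at hL0)
  have hL4 : 4 ≤ n + 1 := by
    have : (4 : ℝ) ≤ ((n + 1 : ℕ) : ℝ) := by
      rw [hLm]; calc (4 : ℝ) ≤ 8 ^ 4 := by norm_num
        _ ≤ _ := by gcongr
    exact_mod_cast this
  -- Budget for the excess `s`: the ball has `a² = L v (1 + s/2)`. With `κ = s/32` the reduced ball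
  -- still contains radius² `L v (1 + s/4)`, enough for the Gaussian tail, and the enlarged ball has
  -- radius² at most `L v (1 + 3s/4)`. The last `s/4` is for uncovered points. In dimension `m⁴` the
  -- tail exponent is of order `L s² = m²`.
  set s : ℝ := 1 / m with hs
  have hs0 : 0 < s := by positivity
  have hs1 : s ≤ 1 / 8 := by rw [hs]; exact one_div_le_one_div_of_le (by norm_num) hm8
  have hsm : s * m = 1 := by rw [hs]; field_simp
  set N : ℝ := ((n + 1 : ℕ) : ℝ) with hN
  set a := √(N * v * (1 + s / 2)) with ha
  have ha0 : 0 < a := by positivity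
  have ha2 : a ^ 2 = N * v * (1 + s / 2) := Real.sq_sqrt (by positivity)
  set κ := s / 32 with hκ
  obtain ⟨p, hp, β, hβ, hV, hap, hpa, hβL⟩ := exists_grid_spacing n hL4 ha0
  have : Fact p.Prime := ⟨hp⟩
  have hNn : (n : ℝ) + 1 = N := by rw [hN]; push_cast; rfl
  rw [hNn] at hpa hβL
  have hβκ : β * √(n + 1 : ℕ) ≤ κ * a := by
    refine hβL.trans ?_
    rw [div_le_iff₀ (by positivity), hLm, hκ, hs]
    have h1 : (128 : ℝ) ≤ m ^ 7 := by
      calc (128 : ℝ) ≤ 8 ^ 7 := by norm_num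
        _ ≤ _ := by gcongr
    have : 1 / (m : ℝ) / 32 * a * (m ^ 4) ^ 2 = a * m ^ 7 / 32 := by field_simp
    rw [this]
    nlinarith
  have hdet : ∀ g : Fin n → ZMod p, (lineMatrix β g).det ≠ 0 := fun g => by
    rw [det_lineMatrix]
    have : (0 : ℝ) < p := by exact_mod_cast hp.pos
    positivity
  choose Λ hΛ using fun g : Fin n → ZMod p => exists_modLattice _ (hdet g)
  set ν := Measure.pi fun _ : Fin (n + 1) => gaussianReal 0 v.toNNReal
  obtain ⟨g, hg⟩ := exists_good_line hβ ha0 (by positivity : 0 < κ) (by rw [hκ]; linarith) hV hβκ hap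
    Λ hΛ ν
  have hbox0 : volume (lineBox n p β) ≠ 0 := by
    rw [hV, volume_ballSq ha0]
    refine mul_ne_zero (by simp; positivity) (fun h0 => ?_)
    have := le_volume_ballSq_one (ι := Fin (n + 1))
    rw [h0, nonpos_iff_eq_zero, ENNReal.ofReal_eq_zero] at this
    rw [Fintype.card_fin] at this
    have h2 : 0 < (2 / √((n + 1 : ℕ) : ℝ)) ^ (n + 1) := by positivity
    linarith
  have hboxt : volume (lineBox n p β) ≠ ⊤ := by
    rw [volume_lineBox n p hβ.le]; exact ENNReal.ofReal_ne_top
  set E := Real.exp (-(N * κ / 2)) with hE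
  have hD := one_sub_pow_add_inv_one_add_pow_le (by positivity : 0 < κ) (by rw [hκ]; linarith) (n + 1)
  have hNκ : N * κ / 2 = m ^ 3 / 64 := by rw [hLm, hκ, hs]; field_simp; norm_num
  have hEm : E ≤ Real.exp (-m) := by
    rw [hE, hNκ]
    refine Real.exp_le_exp.2 (neg_le_neg ?_)
    nlinarith [mul_nonneg (mul_nonneg hm0.le (by linarith : (0 : ℝ) ≤ m - 8))
      (by linarith : (0 : ℝ) ≤ m + 8)]
  have hg' := hg.trans (ENNReal.ofReal_le_ofReal hD)
  have hR : ∀ x, normSq ((Λ g).modulo x) ≤ 32 * v * m ^ 16 := by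
    intro x
    refine (normSq_modulo_lineMatrix_le hβ g (Λ g) (hΛ g) x).trans ?_
    have hp0 : (0 : ℝ) ≤ p := Nat.cast_nonneg _
    rw [hNn]
    calc N * (β * p) ^ 2 ≤ N * (4 * a * N) ^ 2 := by gcongr
      _ = 16 * N ^ 4 * v * (1 + s / 2) := by rw [mul_pow, mul_pow, ha2]; ring
      _ ≤ 16 * N ^ 4 * v * 2 := by gcongr; linarith
      _ = _ := by rw [hLm]; ring
  refine ⟨Λ g, ?_, ?_, hR⟩
  · refine (lintegral_normSq_uniformCell_le (Λ g)
      (isAddFundamentalDomain_lineBox hβ g (Λ g) (hΛ g)) hbox0 hboxt hR (by positivity)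
      (le_add_self.trans hg')).trans (ENNReal.ofReal_le_ofReal ?_)
    have h1 : ((1 + 2 * κ) * a) ^ 2 ≤ N * v * (1 + 3 * s / 4) := by
      rw [mul_pow, ha2, mul_comm, mul_assoc]
      gcongr
      rw [hκ]
      nlinarith [mul_pos hs0 hs0, mul_pos (mul_pos hs0 hs0) hs0]
    have h2 : 32 * v * (m : ℝ) ^ 16 * (2 * E) ≤ N * v * (s / 4) := by
      have h3 : (m : ℝ) ^ 13 * E ≤ 1 / 256 := le_trans (by gcongr) hmlim
      have h4 : N * v * (s / 4) = v * m ^ 3 / 4 := by rw [hLm, hs]; field_simp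
      rw [h4]
      have h5 : 32 * v * (m : ℝ) ^ 16 * (2 * E) = 64 * v * m ^ 3 * (m ^ 13 * E) := by ring
      rw [h5]
      calc _ ≤ 64 * v * (m : ℝ) ^ 3 * (1 / 256) := by gcongr
        _ = _ := by ring
    have h3 : N * (v * (1 + s)) = N * v * (1 + 3 * s / 4) + N * v * (s / 4) := by ring
    rw [h3]
    exact add_le_add h1 h2
  · intro v' hv' hle
    refine (gaussian_compl_cell_le (Λ g) hv hv' hle).trans ?_
    have hsub : aliased (Λ g) ⊆ (aliased (Λ g) ∩ ballSq _ ((1 - 2 * κ) * a)) ∪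
        {x | (n + 1 : ℕ) * v * (1 + s / 4) < normSq x} := by
      intro x hx
      by_cases h : normSq x ≤ ((1 - 2 * κ) * a) ^ 2
      · exact Or.inl ⟨hx, h⟩
      · right
        refine lt_of_le_of_lt ?_ (not_le.1 h)
        rw [mul_pow, ha2, ← hN, mul_comm ((1 - 2 * κ) ^ 2), mul_assoc (N * v)]
        gcongr
        rw [hκ]
        nlinarith [mul_pos hs0 hs0, mul_pos (mul_pos hs0 hs0) hs0]
    have htail := gaussian_normSq_tail (L := n + 1) hv (a := s / 4) (by positivity) (by linarith)
    have h4 : Real.exp (-(((n + 1 : ℕ) : ℝ) * (s / 4) ^ 2 / 8)) ≤ Real.exp (-(m / 128 : ℝ)) := by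
      refine Real.exp_le_exp.2 (neg_le_neg ?_)
      rw [← hN, hLm]
      have : (m : ℝ) ^ 4 * (s / 4) ^ 2 / 8 = m ^ 2 / 128 := by rw [hs]; field_simp; norm_num
      rw [this]
      have h7 : (m : ℝ) ≤ m ^ 2 := le_self_pow₀ (by linarith) two_ne_zero
      linarith
    have h5 : E ≤ Real.exp (-(m / 128 : ℝ)) :=
      hEm.trans (Real.exp_le_exp.2 (by linarith))
    calc ν (aliased (Λ g)) ≤ _ := (measure_mono hsub).trans (measure_union_le _ _)
      _ ≤ ENNReal.ofReal (2 * Real.exp (-(m / 128 : ℝ))) +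
          ENNReal.ofReal (Real.exp (-(m / 128 : ℝ))) := by
          refine add_le_add ((le_self_add.trans hg').trans (ENNReal.ofReal_le_ofReal ?_))
            (htail.trans (ENNReal.ofReal_le_ofReal h4))
          linarith
      _ = _ := by
          rw [← ENNReal.ofReal_add (by positivity) (by positivity)]
          congr 1; ring


/-! ### Linear feedback coding: response to the noise -/

namespace LFC

/-- The noise part of the channel input, i.e. the input when the codebook is zero. -/
def noiseResponse (S : LFC) (z : Fin S.N → NoisePair) (n : Fin S.N) : ℝ :=
  -∑ i : Fin 2, ∑ j : Set.Iio n, S.coef i n j * (S.noiseResponse z j + z j i)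
termination_by n.val
decreasing_by exact j.2

variable {S : LFC}

lemma input_eq (w : ∀ i, Fin (S.M i)) (z : Fin S.N → NoisePair) (n : Fin S.N) :
    S.input w z n = S.codebook n w -
      ∑ i : Fin 2, ∑ j : Set.Iio n, S.coef i n j * S.output w z i j := by
  rw [input]; rfl

/-- The recursion for the input is affine in codebook and noise, so the two responses superpose. -/
lemma input_eq_codebookBar_add (w : ∀ i, Fin (S.M i)) (z : Fin S.N → NoisePair) (n : Fin S.N) :
    S.input w z n = S.codebookBar n w + S.noiseResponse z n := by
  induction n using WellFoundedLT.induction with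
  | ind n ih =>
    rw [codebookBar, input, noiseResponse, input, ← sub_eq_add_neg, sub_sub,
      ← Finset.sum_add_distrib]
    congr 1
    refine Finset.sum_congr rfl fun i _ => ?_
    rw [← Finset.sum_add_distrib]
    refine Finset.sum_congr rfl fun j _ => ?_
    rw [ih j j.2, codebookBar]
    simp only [Pi.zero_apply, PiLp.zero_apply]
    ring

lemma codebookBar_of_val_eq_zero {n : Fin S.N} (hn : n.val = 0) (w : ∀ i, Fin (S.M i)) :
    S.codebookBar n w = S.codebook n w := by
  rw [codebookBar, input]
  have : IsEmpty (Set.Iio n) := ⟨fun j => by have : j.1.val < n.val := j.2; omega⟩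
  simp

/-- The noise response depends on past noise only. -/
lemma noiseResponse_congr {z z' : Fin S.N → NoisePair} {n : Fin S.N} (h : ∀ j < n, z j = z' j) :
    S.noiseResponse z n = S.noiseResponse z' n := by
  induction n using WellFoundedLT.induction with
  | ind n ih =>
    rw [noiseResponse, noiseResponse]
    congr 1
    refine Finset.sum_congr rfl fun i _ => Finset.sum_congr rfl fun j _ => ?_
    rw [ih j j.2 fun k hk => h k (lt_trans hk j.2), h j j.2]

/-- Linearity gives measurability, oddness (orthogonality to the codebook part), and Gaussianity of
the response to Gaussian noise. -/
lemma exists_noiseResponse_eq_continuousLinearMap (S : LFC) (n : Fin S.N) :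
    ∃ ℓ : (Fin S.N → NoisePair) →L[ℝ] ℝ, ∀ z, S.noiseResponse z n = ℓ z := by
  induction n using WellFoundedLT.induction with
  | ind n ih =>
    choose ℓ hℓ using ih
    refine ⟨-∑ i : Fin 2, ∑ j : Set.Iio n, S.coef i n j • (ℓ j j.2 +
      (EuclideanSpace.proj i : NoisePair →L[ℝ] ℝ).comp (ContinuousLinearMap.proj j.1)), fun z => ?_⟩
    rw [noiseResponse]
    simp only [neg_apply, sum_apply, smul_apply,
      add_apply, ContinuousLinearMap.comp_apply, ContinuousLinearMap.proj_apply,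
      smul_eq_mul]
    congr 1
    refine Finset.sum_congr rfl fun i _ => Finset.sum_congr rfl fun j _ => ?_
    rw [hℓ j j.2]
    rfl

lemma measurable_noiseResponse (n : Fin S.N) : Measurable fun z => S.noiseResponse z n := by
  obtain ⟨ℓ, hℓ⟩ := S.exists_noiseResponse_eq_continuousLinearMap n
  simp only [hℓ]
  exact ℓ.continuous.measurable

lemma noiseResponse_neg (z : Fin S.N → NoisePair) (n : Fin S.N) :
    S.noiseResponse (-z) n = -S.noiseResponse z n := by
  obtain ⟨ℓ, hℓ⟩ := S.exists_noiseResponse_eq_continuousLinearMap n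
  rw [hℓ, hℓ, map_neg]

lemma measurable_input (w : ∀ i, Fin (S.M i)) (n : Fin S.N) : Measurable fun z => S.input w z n := by
  simp only [input_eq_codebookBar_add]
  exact measurable_const.add (measurable_noiseResponse n)

lemma measurable_output (w : ∀ i, Fin (S.M i)) (i : Fin 2) : Measurable fun z => S.output w z i := by
  refine measurable_pi_lambda _ fun n => (measurable_input w n).add ?_
  fun_prop

end LFC

/-! ### Modulo-lattice schemes: dither cancellation and the aliasing-free regime -/

namespace InteractiveScheme

variable {N : ℕ} {W : Fin 2 → Type} {U : Type} [MeasurableSpace U]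
  (S : InteractiveScheme N W U)

lemma macOutput_eq (w : ∀ i, W i) (ω : Sample N U) (n : Fin N) :
    S.macOutput w ω n = ∑ i, S.fbInput w ω i n + ω.1.2 n := by
  rw [macOutput]; rfl

lemma measurable_macOutput (w : ∀ i, W i) (n : Fin N) :
    Measurable fun ω : Sample N U => S.macOutput w ω n := by
  induction n using WellFoundedLT.induction with
  | ind n ih =>
    simp only [macOutput_eq]
    refine (Finset.measurable_sum _ fun i _ => ?_).add (by fun_prop)
    refine (S.measurable_fb i n).comp (measurable_snd.prodMk (measurable_pi_lambda _ fun m => ?_))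
    refine Measurable.add ?_ (by fun_prop)
    refine (S.measurable_enc m w).comp (measurable_snd.prodMk (measurable_pi_lambda _ fun j => ?_))
    exact ih j (lt_of_lt_of_le j.2 m.2)

lemma measurable_input (w : ∀ i, W i) (n : Fin N) :
    Measurable fun ω : Sample N U => S.input w ω n :=
  (S.measurable_enc n w).comp (measurable_snd.prodMk
    (measurable_pi_lambda _ fun j => S.measurable_macOutput w j))

lemma measurable_output (w : ∀ i, W i) (i : Fin 2) (n : Fin N) :
    Measurable fun ω : Sample N U => S.output w ω i n :=
  (S.measurable_input w n).add (by fun_prop)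

lemma measurable_fbInput (w : ∀ i, W i) (i : Fin 2) (n : Fin N) :
    Measurable fun ω : Sample N U => S.fbInput w ω i n :=
  (S.measurable_fb i n).comp (measurable_snd.prodMk
    (measurable_pi_lambda _ fun j => S.measurable_output w i j))

end InteractiveScheme

namespace MLLFC

variable {C : MLLFC}

@[simp] lemma blockOf_time (b : C.Block) (ℓ : Fin C.L) : C.blockOf (C.time b ℓ) = b := by
  simp [blockOf, time]

@[simp] lemma posOf_time (b : C.Block) (ℓ : Fin C.L) : C.posOf (C.time b ℓ) = ℓ := by
  simp [posOf, time]

@[simp] lemma time_blockOf_posOf (t : Fin C.len) : C.time (C.blockOf t) (C.posOf t) = t :=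
  finProdFinEquiv.apply_symm_apply t

@[simp] lemma step_block (n : Fin C.lfc.N) (π : Fin 2) : C.step (C.block n π) = n := by
  simp [step, block]

@[simp] lemma parity_block (n : Fin C.lfc.N) (π : Fin 2) : C.parity (C.block n π) = π := by
  simp [parity, block]

@[simp] lemma block_step_parity (b : C.Block) : C.block (C.step b) (C.parity b) = b :=
  finProdFinEquiv.apply_symm_apply b

lemma val_time (b : C.Block) (ℓ : Fin C.L) : (C.time b ℓ).val = ℓ + C.L * b := by
  simp [time]

lemma val_block (n : Fin C.lfc.N) (π : Fin 2) : (C.block n π).val = π + 2 * n := by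
  simp [block]

lemma val_eq (b : C.Block) : b.val = C.parity b + 2 * C.step b := by
  conv_lhs => rw [← block_step_parity b]
  exact val_block _ _

lemma time_lt_time {b b' : C.Block} (h : b < b') (ℓ ℓ' : Fin C.L) : C.time b ℓ < C.time b' ℓ' := by
  rw [Fin.lt_def, val_time, val_time]
  have h1 : b.val + 1 ≤ b'.val := h
  have h2 := Nat.mul_le_mul_left C.L h1
  have h3 := ℓ.2
  rw [Nat.mul_add, mul_one] at h2
  omega

/-- The block preceding `b` in time (the first block is its own predecessor). -/
def prevBlock (b : C.Block) : C.Block := ⟨b.val - 1, lt_of_le_of_lt (Nat.sub_le _ _) b.2⟩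

lemma complete_of_mem {N : ℕ} {s : Set (Fin N)} (y : Fin N → ℝ) {j : Fin N} (hj : j ∈ s) :
    complete (fun k : s => y k) j = y j := by
  simp [complete, hj]

lemma fbVec_block (i : Fin 2) (n : Fin C.lfc.N) (π : Fin 2) (y : Fin C.len → ℝ) (ℓ : Fin C.L) :
    C.fbVec i (C.block n π) y ℓ =
      ∑ j : Set.Iio n, C.lfc.coef i n j * y (C.time (C.block j π) ℓ) := by
  rw [fbVec, step_block, parity_block]

/-- This is causality, and the reason for interleaving two parities: the outputs needed for block
`(n, π)` lie at least two blocks before it, so they are complete when the block preceding `(n, π)`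
begins, and the zeros of `complete` are never read. -/
lemma fbVec_complete (i : Fin 2) (b : C.Block) (y : Fin C.len → ℝ) {t : Fin C.len}
    (ht : C.blockOf t = prevBlock b) :
    C.fbVec i b (complete fun m : Set.Iic t => y m) = C.fbVec i b y := by
  ext ℓ
  refine Finset.sum_congr rfl fun j _ => ?_
  congr 1
  refine complete_of_mem y (Set.mem_Iic.2 (le_of_lt ?_))
  rw [← time_blockOf_posOf t]
  refine time_lt_time ?_ _ _
  rw [ht, Fin.lt_def, val_block]
  have h1 : j.1.val < (C.step b).val := j.2
  have h2 := val_eq b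
  have h3 : (prevBlock b).val = b.val - 1 := rfl
  have := (C.parity b).2
  omega

lemma fbInput_eq (w : ∀ i, C.Msg i) (ω : Sample C.len C.Dither) (i : Fin 2) (b : C.Block)
    (hb : (C.step b).val ≠ 0) (ℓ : Fin C.L) :
    C.toScheme.fbInput w ω i (C.time (prevBlock b) ℓ) =
      C.lattice.modulo (C.γ (C.step b) • C.fbVec i b (C.toScheme.output w ω i) + ω.2 i b) ℓ := by
  have hv := val_eq b
  have hlt : (C.blockOf (C.time (prevBlock b) ℓ)).val + 1 < C.lfc.N * 2 := by
    rw [blockOf_time]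
    have := b.2
    change b.val - 1 + 1 < _
    omega
  have hbeq : (⟨(C.blockOf (C.time (prevBlock b) ℓ)).val + 1, hlt⟩ : C.Block) = b := by
    have h1 : (C.blockOf (C.time (prevBlock b) ℓ)).val = b.val - 1 := by rw [blockOf_time]; rfl
    refine Fin.ext ?_
    change (C.blockOf (C.time (prevBlock b) ℓ)).val + 1 = b.val
    omega
  change C.fbFun i _ ω.2 _ = _
  simp only [fbFun]
  rw [dif_pos hlt]
  rw [hbeq, if_neg hb, posOf_time, fbVec_complete i b _ (blockOf_time _ _)]

lemma fbInput_eq_zero (w : ∀ i, C.Msg i) (ω : Sample C.len C.Dither) (i : Fin 2) (t : Fin C.len)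
    (h : ∀ b : C.Block, (C.step b).val ≠ 0 → C.blockOf t ≠ prevBlock b) :
    C.toScheme.fbInput w ω i t = 0 := by
  change C.fbFun i _ ω.2 _ = _
  simp only [fbFun]
  split_ifs with h1 h2
  · rfl
  · exact absurd (Fin.ext (by simp [prevBlock])) (h _ h2)
  · rfl

lemma input_of_step_eq_zero (w : ∀ i, C.Msg i) (ω : Sample C.len C.Dither) (b : C.Block)
    (hb : (C.step b).val = 0) (ℓ : Fin C.L) :
    C.toScheme.input w ω (C.time b ℓ) = C.codeVec w b ℓ := by
  change C.encFun _ w ω.2 _ = _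
  simp only [encFun, blockOf_time, posOf_time, if_pos hb]

/-- The dithers cancel in the transmission of Terminal A. -/
lemma input_of_step_ne_zero (w : ∀ i, C.Msg i) (ω : Sample C.len C.Dither) (b : C.Block)
    (hb : (C.step b).val ≠ 0) (ℓ : Fin C.L) :
    C.toScheme.input w ω (C.time b ℓ) = (C.γ (C.step b))⁻¹ *
      C.lattice.modulo (C.γ (C.step b) • (C.codeVec w b -
        ∑ i, C.fbVec i b (C.toScheme.output w ω i) - C.codeBarVec w b) -
        fun ℓ' => ω.1.2 (C.time (prevBlock b) ℓ')) ℓ + C.codeBarVec w b ℓ := by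
  have hv := val_eq b
  change C.encFun _ w ω.2 (fun j : Set.Iio (C.time b ℓ) => C.toScheme.macOutput w ω j) = _
  simp only [encFun, blockOf_time, posOf_time, if_neg hb]
  congr 2
  have hY : (fun ℓ' => complete (fun j : Set.Iio (C.time b ℓ) => C.toScheme.macOutput w ω j)
      (C.time (prevBlock b) ℓ')) = (∑ i, C.lattice.modulo (C.γ (C.step b) •
        C.fbVec i b (C.toScheme.output w ω i) + ω.2 i b)) +
        fun ℓ' => ω.1.2 (C.time (prevBlock b) ℓ') := by
    ext ℓ'
    have hmem : C.time (prevBlock b) ℓ' ∈ Set.Iio (C.time b ℓ) := by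
      refine time_lt_time ?_ _ _
      rw [Fin.lt_def]
      change b.val - 1 < b.val
      omega
    rw [complete_of_mem _ hmem, InteractiveScheme.macOutput_eq]
    simp only [fbInput_eq w ω _ b hb, Pi.add_apply, Finset.sum_apply]
  change C.lattice.modulo (C.γ (C.step b) • C.codeVec w b -
    ((fun ℓ' => complete (fun j : Set.Iio (C.time b ℓ) => C.toScheme.macOutput w ω j)
      (C.time (prevBlock b) ℓ')) - ∑ i, ω.2 i b) - C.γ (C.step b) • C.codeBarVec w b) ℓ = _
  rw [hY]
  -- The users' reductions are isolated as `x`, so that `modulo_sub_sum_modulo` removes them; the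
  -- dithers inside them then cancel against `T`.
  have h1 : ∀ A B x T Z : Fin C.L → ℝ, A - (x + Z - T) - B = (A - B + T - Z) - x := by
    intros; abel
  rw [h1, ModLattice.modulo_sub_sum_modulo]
  refine congrFun (congrArg C.lattice.modulo ?_) ℓ
  rw [Finset.sum_add_distrib, ← Finset.smul_sum, smul_sub, smul_sub]
  abel

/-- The channel outputs do not depend on the dithers. -/
lemma output_eq_of_fst_eq (w : ∀ i, C.Msg i) {ω ω' : Sample C.len C.Dither} (h : ω.1 = ω'.1)
    (i : Fin 2) (t : Fin C.len) : C.toScheme.output w ω i t = C.toScheme.output w ω' i t := by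
  suffices ∀ n : Fin C.lfc.N, ∀ π ℓ, C.toScheme.input w ω (C.time (C.block n π) ℓ) =
      C.toScheme.input w ω' (C.time (C.block n π) ℓ) by
    have h2 := this (C.step (C.blockOf t)) (C.parity (C.blockOf t)) (C.posOf t)
    rw [block_step_parity, time_blockOf_posOf] at h2
    simp only [InteractiveScheme.output, h2, h]
  -- By `input_of_step_ne_zero` the dithers can enter a block only through the outputs of earlier
  -- steps of the same parity, which are free of them by induction.
  intro n
  induction n using WellFoundedLT.induction with
  | ind n ih =>
    intro π ℓ
    by_cases hn : n.val = 0
    · rw [input_of_step_eq_zero _ _ _ (by simpa using hn), input_of_step_eq_zero _ _ _ (by simpa using hn)]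
    · rw [input_of_step_ne_zero _ _ _ (by simpa using hn), input_of_step_ne_zero _ _ _ (by simpa using hn),
        h]
      have : ∀ i, C.fbVec i (C.block n π) (C.toScheme.output w ω i) =
          C.fbVec i (C.block n π) (C.toScheme.output w ω' i) := by
        intro i
        ext ℓ
        refine Finset.sum_congr rfl fun j _ => ?_
        simp only [parity_block, InteractiveScheme.output, h]
        rw [ih j (by simpa using j.2)]
      simp only [this]

variable (C)

/-- The noise of the equivalent noiseless-feedback channel seen by instance `(ℓ, π)`. -/
def effNoise (z : (Fin C.len → NoisePair) × (Fin C.len → ℝ)) (ℓ : Fin C.L) (π : Fin 2)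
    (n : Fin C.lfc.N) : NoisePair :=
  z.1 (C.time (C.block n π) ℓ) - (if n.val = 0 then 0 else
    (C.γ n)⁻¹ * z.2 (C.time (prevBlock (C.block n π)) ℓ)) • WithLp.toLp 2 fun _ => 1

/-- The vector reduced modulo the lattice by Terminal A in the absence of earlier aliasing. -/
def preMod (z : (Fin C.len → NoisePair) × (Fin C.len → ℝ)) (n : Fin C.lfc.N) (π : Fin 2)
    (ℓ : Fin C.L) : ℝ :=
  C.γ n * C.lfc.noiseResponse (C.effNoise z ℓ π) n - z.2 (C.time (prevBlock (C.block n π)) ℓ)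

/-- The event that aliasing occurs in some block. -/
def aliasing : Set ((Fin C.len → NoisePair) × (Fin C.len → ℝ)) :=
  {z | ∃ n π, n.val ≠ 0 ∧ C.preMod z n π ∉ C.lattice.cell}

variable {C}

/-- The input of the equivalent linear feedback scheme, with the feedback noise added. -/
def virtualInput (C : MLLFC) (w : ∀ i, C.Msg i)
    (z : (Fin C.len → NoisePair) × (Fin C.len → ℝ)) (n : Fin C.lfc.N)
    (π : Fin 2) (ℓ : Fin C.L) : ℝ :=
  C.lfc.input (C.msg w ℓ π) (C.effNoise z ℓ π) n - (if n.val = 0 then 0 else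
    (C.γ n)⁻¹ * z.2 (C.time (prevBlock (C.block n π)) ℓ))

/-- Without aliasing, the scheme is equivalent to its linear feedback scheme. -/
lemma input_eq_virtualInput (w : ∀ i, C.Msg i) (ω : Sample C.len C.Dither) (h : ω.1 ∉ C.aliasing)
    (n : Fin C.lfc.N) (π : Fin 2) (ℓ : Fin C.L) :
    C.toScheme.input w ω (C.time (C.block n π) ℓ) = C.virtualInput w ω.1 n π ℓ := by
  induction n using WellFoundedLT.induction generalizing ℓ with
  | ind n ih =>
    have hout : ∀ (j : Set.Iio n) i ℓ, C.toScheme.output w ω i (C.time (C.block j π) ℓ) =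
        C.lfc.output (C.msg w ℓ π) (C.effNoise ω.1 ℓ π) i j := by
      intro j i ℓ
      simp only [InteractiveScheme.output, LFC.output]
      rw [ih j j.2]
      simp only [virtualInput, effNoise, PiLp.sub_apply, PiLp.smul_apply, smul_eq_mul, mul_one]
      ring
    rw [virtualInput]
    by_cases hn : n.val = 0
    · rw [input_of_step_eq_zero _ _ _ (by simpa using hn), if_pos hn, sub_zero,
        LFC.input_eq]
      have : IsEmpty (Set.Iio n) := ⟨fun j => by have : j.1.val < n.val := j.2; omega⟩
      simp [codeVec]
    · have hγ := C.γ_pos n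
      have hcell : C.preMod ω.1 n π ∈ C.lattice.cell := by
        by_contra hc
        exact h ⟨n, π, hn, hc⟩
      -- By induction, the codebook element minus the feedback elements is the LFC input under the
      -- effective noise; subtracting `Θ̄` leaves the pure noise response, free of the message.
      have hpre : C.γ n • (C.codeVec w (C.block n π) -
          ∑ i, C.fbVec i (C.block n π) (C.toScheme.output w ω i) - C.codeBarVec w (C.block n π)) -
          (fun ℓ' => ω.1.2 (C.time (prevBlock (C.block n π)) ℓ')) = C.preMod ω.1 n π := by
        ext ℓ'
        have h1 : C.codeVec w (C.block n π) ℓ' - ∑ i, C.fbVec i (C.block n π)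
            (C.toScheme.output w ω i) ℓ' = C.lfc.input (C.msg w ℓ' π) (C.effNoise ω.1 ℓ' π) n := by
          rw [LFC.input_eq]
          simp only [codeVec, fbVec_block, step_block, parity_block, hout]
        simp only [Pi.sub_apply, Pi.smul_apply, Finset.sum_apply, smul_eq_mul, h1, preMod,
          codeBarVec, step_block, parity_block, LFC.input_eq_codebookBar_add]
        ring
      rw [input_of_step_ne_zero _ _ _ (by simpa using hn)]
      simp only [step_block]
      rw [hpre, ModLattice.modulo_of_mem_cell hcell, if_neg hn, preMod,
        LFC.input_eq_codebookBar_add, codeBarVec, step_block, parity_block]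
      field_simp
      ring

lemma output_eq_of_notMem_aliasing (w : ∀ i, C.Msg i) (ω : Sample C.len C.Dither)
    (h : ω.1 ∉ C.aliasing) (i : Fin 2) (n : Fin C.lfc.N) (π : Fin 2) (ℓ : Fin C.L) :
    C.toScheme.output w ω i (C.time (C.block n π) ℓ) =
      C.lfc.output (C.msg w ℓ π) (C.effNoise ω.1 ℓ π) i n := by
  simp only [InteractiveScheme.output, LFC.output, input_eq_virtualInput w ω h, virtualInput,
    effNoise, PiLp.sub_apply, PiLp.smul_apply, smul_eq_mul, mul_one]
  ring

/-- A bound on the transmission of Terminal A which holds even under aliasing. -/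
lemma input_sq_le (w : ∀ i, C.Msg i) (ω : Sample C.len C.Dither) {R : ℝ}
    (hR : ∀ x, normSq (C.lattice.modulo x) ≤ R) (n : Fin C.lfc.N) (π : Fin 2) (ℓ : Fin C.L) :
    C.toScheme.input w ω (C.time (C.block n π) ℓ) ^ 2 ≤
      2 * (C.γ n)⁻¹ ^ 2 * R + 2 * C.lfc.codebookBar n (C.msg w ℓ π) ^ 2 := by
  have hR0 : 0 ≤ R := (normSq_nonneg _).trans (hR 0)
  have hbar : C.codeBarVec w (C.block n π) ℓ = C.lfc.codebookBar n (C.msg w ℓ π) := by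
    simp [codeBarVec]
  by_cases hn : n.val = 0
  · rw [input_of_step_eq_zero _ _ _ (by simpa using hn)]
    have : C.codeVec w (C.block n π) ℓ = C.lfc.codebookBar n (C.msg w ℓ π) := by
      rw [LFC.codebookBar_of_val_eq_zero hn]; simp [codeVec]
    rw [this]
    have : 0 ≤ 2 * (C.γ n)⁻¹ ^ 2 * R := by positivity
    nlinarith [sq_nonneg (C.lfc.codebookBar n (C.msg w ℓ π))]
  · rw [input_of_step_ne_zero _ _ _ (by simpa using hn), hbar]
    simp only [step_block]
    set K := C.lattice.modulo (C.γ n • (C.codeVec w (C.block n π) -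
          ∑ i, C.fbVec i (C.block n π) (C.toScheme.output w ω i) - C.codeBarVec w (C.block n π)) -
          (fun ℓ' => ω.1.2 (C.time (prevBlock (C.block n π)) ℓ')))
    have h1 : K ℓ ^ 2 ≤ R := (sq_le_normSq K ℓ).trans (hR _)
    have h2 : ((C.γ n)⁻¹ * K ℓ) ^ 2 ≤ (C.γ n)⁻¹ ^ 2 * R := by
      rw [mul_pow]; gcongr
    nlinarith [sq_nonneg ((C.γ n)⁻¹ * K ℓ - C.lfc.codebookBar n (C.msg w ℓ π))]

end MLLFC


/-! ### Reindexing of product measures -/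

lemma measurePreserving_pi_comp_equiv {ι κ α : Type*} [Fintype ι] [Fintype κ] [MeasurableSpace α]
    (e : ι ≃ κ) (μ : Measure α) [IsProbabilityMeasure μ] :
    MeasurePreserving (fun (x : κ → α) i => x (e i)) (Measure.pi fun _ => μ)
      (Measure.pi fun _ => μ) where
  measurable := by fun_prop
  map_eq := by
    refine (Measure.pi_eq fun s hs => ?_).symm
    rw [Measure.map_apply (by fun_prop) (MeasurableSet.univ_pi hs)]
    have : (fun (x : κ → α) i => x (e i)) ⁻¹' Set.univ.pi s =
        Set.univ.pi fun k => s (e.symm k) := by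
      ext x
      simp only [Set.mem_preimage, Set.mem_univ_pi]
      constructor
      · intro h k; simpa using h (e.symm k)
      · intro h i; simpa using h (e i)
    rw [this, Measure.pi_pi]
    exact Equiv.prod_comp e.symm fun i => μ (s i)

lemma measurePreserving_pi_curry {ι κ α : Type*} [Fintype ι] [Fintype κ] [MeasurableSpace α]
    (μ : Measure α) [IsProbabilityMeasure μ] :
    MeasurePreserving (fun (x : ι × κ → α) i j => x (i, j)) (Measure.pi fun _ => μ)
      (Measure.pi fun _ => Measure.pi fun _ => μ) where
  measurable := by fun_prop
  map_eq := by
    have h := Measure.infinitePi_map_curry (ι := ι) (κ := κ) fun _ _ => μ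
    simp only [Measure.infinitePi_eq_pi] at h
    exact h

lemma measurePreserving_pi_prodMk {ι α β : Type*} [Fintype ι] [MeasurableSpace α]
    [MeasurableSpace β] (μ : Measure α) (ν : Measure β) [IsProbabilityMeasure μ]
    [IsProbabilityMeasure ν] :
    MeasurePreserving (fun (p : (ι → α) × (ι → β)) i => (p.1 i, p.2 i))
      ((Measure.pi fun _ => μ).prod (Measure.pi fun _ => ν)) (Measure.pi fun _ => μ.prod ν) :=
  (measurePreserving_arrowProdEquivProdArrow α β ι (fun _ => μ) fun _ => ν).symm

/-! ### Gaussian laws -/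

/-- Adding independent common noise to a Gaussian pair. -/
lemma map_sub_smul_one_multivariateGaussian {K : Matrix (Fin 2) (Fin 2) ℝ} (hK : K.PosSemidef)
    {v : ℝ} (hv : 0 ≤ v) (c : ℝ) :
    ((multivariateGaussian 0 K).prod (gaussianReal 0 v.toNNReal)).map
      (fun p : NoisePair × ℝ => p.1 - (c * p.2) • WithLp.toLp 2 fun _ => (1 : ℝ)) =
      multivariateGaussian 0 (K + (v * c ^ 2) • !![1, 1; 1, 1]) := by
  have hJ : (!![1, 1; 1, 1] : Matrix (Fin 2) (Fin 2) ℝ).PosSemidef := by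
    refine Matrix.PosSemidef.of_dotProduct_mulVec_nonneg ?_ fun x => ?_
    · ext i j; fin_cases i <;> fin_cases j <;> rfl
    · simp [Matrix.mulVec, dotProduct, Fin.sum_univ_two]
      nlinarith [sq_nonneg (x 0 + x 1)]
  have hK' : (K + (v * c ^ 2) • !![1, 1; 1, 1]).PosSemidef :=
    hK.add (hJ.smul (by positivity))
  have hmeas : Measurable (fun p : NoisePair × ℝ =>
      p.1 - (c * p.2) • (WithLp.toLp 2 fun _ => (1 : ℝ) : NoisePair)) := by fun_prop
  have := Measure.isProbabilityMeasure_map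
    (μ := (multivariateGaussian 0 K).prod (gaussianReal 0 v.toNNReal)) hmeas.aemeasurable
  -- By independence the characteristic functions multiply; the common noise contributes the
  -- quadratic form `v c² (t₀ + t₁)²`, whose matrix is the all-ones matrix.
  refine Measure.ext_of_charFun ?_
  ext t
  rw [charFun_multivariateGaussian hK', charFun_apply, integral_map hmeas.aemeasurable
    (Measurable.aestronglyMeasurable (by fun_prop))]
  have h1 : ∀ p : NoisePair × ℝ, Complex.exp (inner ℝ (p.1 - (c * p.2) •
      (WithLp.toLp 2 fun _ => (1 : ℝ) : NoisePair)) t * Complex.I) =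
      Complex.exp (inner ℝ p.1 t * Complex.I) *
        Complex.exp (inner ℝ p.2 (-(c * (t 0 + t 1))) * Complex.I) := by
    intro p
    rw [← Complex.exp_add]
    congr 1
    rw [inner_sub_left, inner_smul_left]
    simp only [PiLp.inner_apply, Fin.sum_univ_two]
    simp
    ring
  simp only [h1]
  rw [integral_prod_mul (fun x : NoisePair => Complex.exp (inner ℝ x t * Complex.I))
    (fun y : ℝ => Complex.exp (inner ℝ y (-(c * (t 0 + t 1))) * Complex.I)), ← charFun_apply,
    ← charFun_apply, charFun_multivariateGaussian hK, charFun_gaussianReal, ← Complex.exp_add]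
  congr 1
  simp [Matrix.mulVec, dotProduct, Fin.sum_univ_two, Real.coe_toNNReal _ hv]
  ring

lemma isGaussian_pi {ι E : Type*} [Fintype ι] [NormedAddCommGroup E] [NormedSpace ℝ E]
    [MeasurableSpace E] [BorelSpace E] [SecondCountableTopology E] [CompleteSpace E]
    (μ : ι → Measure E) [∀ i, IsGaussian (μ i)] : IsGaussian (Measure.pi μ) := by
  have hind : iIndepFun (fun (i : ι) (x : ι → E) => x i) (Measure.pi μ) :=
    iIndepFun_pi (X := fun _ => id) fun _ => aemeasurable_id
  have h := iIndepFun.hasGaussianLaw (fun i => ?_) hind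
  · have h2 := h.isGaussian_map
    have h3 : (fun (ω : ι → E) => fun i => ω i) = id := rfl
    rwa [h3, Measure.map_id] at h2
  · refine ⟨?_⟩
    rw [(measurePreserving_eval μ i).map_eq]
    infer_instance

lemma lintegral_sq_gaussianReal (v : NNReal) :
    ∫⁻ x, ENNReal.ofReal (x ^ 2) ∂gaussianReal 0 v = v := by
  have hm : MemLp (fun x : ℝ => x) 2 (gaussianReal 0 v) := memLp_id_gaussianReal 2
  have h := variance_fun_id_gaussianReal (μ := 0) (v := v)
  rw [variance_of_integral_eq_zero (by fun_prop) (by simp)] at h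
  rw [← ofReal_integral_eq_lintegral_ofReal hm.integrable_sq (ae_of_all _ fun x => sq_nonneg x), h]
  simp

/-- A symmetric Gaussian functional is a centred Gaussian variable. -/
lemma exists_map_eq_gaussianReal {E : Type*} [NormedAddCommGroup E] [NormedSpace ℝ E]
    [MeasurableSpace E] [BorelSpace E] (μ : Measure E) [IsGaussian μ]
    (hneg : MeasurePreserving (fun x => -x) μ μ) (ℓ : E →L[ℝ] ℝ) {V : ℝ} (hV : 0 ≤ V)
    (h : ∫⁻ x, ENNReal.ofReal (ℓ x ^ 2) ∂μ ≤ ENNReal.ofReal V) :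
    ∃ v, 0 ≤ v ∧ v ≤ V ∧ μ.map ℓ = gaussianReal 0 v.toNNReal := by
  have h1 := IsGaussian.map_eq_gaussianReal (μ := μ) ℓ
  have h2 : ∫ x, ℓ x ∂μ = 0 := by
    have h3 := hneg.integral_comp (MeasurableEquiv.neg E).measurableEmbedding ℓ
    simp only [map_neg, integral_neg] at h3
    linarith
  rw [h2] at h1
  refine ⟨Var[ℓ; μ], variance_nonneg _ _, ?_, h1⟩
  have h4 : ∫⁻ x, ENNReal.ofReal (ℓ x ^ 2) ∂μ = ENNReal.ofReal Var[ℓ; μ] := by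
    have h5 := lintegral_sq_gaussianReal Var[ℓ; μ].toNNReal
    rw [← h1, lintegral_map (by fun_prop) ℓ.continuous.measurable] at h5
    exact h5
  rw [h4] at h
  exact (ENNReal.ofReal_le_ofReal_iff hV).1 h


/-! ### Orthogonality by symmetry -/

/-- If a measure-preserving map fixes `a` and flips the sign of `b`, then `a` and `b` are
orthogonal. -/
lemma lintegral_add_sq_of_symm {Ω : Type*} [MeasurableSpace Ω] {μ : Measure Ω} {T : Ω → Ω}
    (hT : MeasurePreserving T μ μ) {a b : Ω → ℝ} (ha : Measurable a) (hb : Measurable b)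
    (haT : ∀ x, a (T x) = a x) (hbT : ∀ x, b (T x) = -b x) :
    ∫⁻ x, ENNReal.ofReal ((a x + b x) ^ 2) ∂μ =
      ∫⁻ x, ENNReal.ofReal (a x ^ 2) ∂μ + ∫⁻ x, ENNReal.ofReal (b x ^ 2) ∂μ := by
  -- By symmetry `(a + b)²` and `(a - b)²` have equal integrals, and the parallelogram law gives
  -- their sum. No integrability is required.
  have h1 : ∫⁻ x, ENNReal.ofReal ((a x + b x) ^ 2) ∂μ =
      ∫⁻ x, ENNReal.ofReal ((a x - b x) ^ 2) ∂μ := by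
    rw [← hT.lintegral_comp (by fun_prop)]
    simp only [haT, hbT, sub_eq_add_neg]
  have h2 : 2 * ∫⁻ x, ENNReal.ofReal ((a x + b x) ^ 2) ∂μ =
      2 * (∫⁻ x, ENNReal.ofReal (a x ^ 2) ∂μ + ∫⁻ x, ENNReal.ofReal (b x ^ 2) ∂μ) := by
    rw [two_mul]
    nth_rewrite 2 [h1]
    rw [← lintegral_add_left (by fun_prop), ← lintegral_add_left (by fun_prop),
      ← lintegral_const_mul _ (by fun_prop)]
    refine lintegral_congr fun x => ?_
    rw [← ENNReal.ofReal_add (by positivity) (by positivity),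
      ← ENNReal.ofReal_add (by positivity) (by positivity),
      show (2 : ℝ≥0∞) = ENNReal.ofReal 2 by simp, ← ENNReal.ofReal_mul (by norm_num)]
    congr 1
    ring
  exact (ENNReal.mul_right_inj (by norm_num) (by norm_num)).1 h2

lemma measurePreserving_neg_multivariateGaussian {K : Matrix (Fin 2) (Fin 2) ℝ} (hK : K.PosSemidef) :
    MeasurePreserving (fun x => -x) (multivariateGaussian (0 : NoisePair) K)
      (multivariateGaussian 0 K) where
  measurable := measurable_neg
  map_eq := by
    have := Measure.isProbabilityMeasure_map (μ := multivariateGaussian (0 : NoisePair) K)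
      (f := fun x => -x) measurable_neg.aemeasurable
    refine Measure.ext_of_charFun ?_
    ext t
    rw [charFun_apply, integral_map measurable_neg.aemeasurable
      (Measurable.aestronglyMeasurable (by fun_prop))]
    have h1 : ∀ x : NoisePair, (inner ℝ (-x) t : ℝ) = inner ℝ x (-t) := fun x => by
      rw [inner_neg_left, inner_neg_right]
    simp only [h1]
    rw [← charFun_apply, charFun_multivariateGaussian hK, charFun_multivariateGaussian hK]
    simp only [Matrix.mulVec_neg, WithLp.ofLp_neg, neg_dotProduct, dotProduct_neg, neg_neg, inner_zero_right]

lemma measurePreserving_neg_gaussianReal (v : NNReal) :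
    MeasurePreserving (fun x => -x) (gaussianReal 0 v) (gaussianReal 0 v) where
  measurable := measurable_neg
  map_eq := by rw [gaussianReal_map_neg, neg_zero]

/-! ### The noise of one instance -/

/-- Joint law of the forward noise and the feedback noise attached to one use of the channel. -/
def noiseLaw (K : Matrix (Fin 2) (Fin 2) ℝ) (v : ℝ) : Measure (NoisePair × ℝ) :=
  (multivariateGaussian 0 K).prod (gaussianReal 0 v.toNNReal)

instance (K : Matrix (Fin 2) (Fin 2) ℝ) (v : ℝ) : IsProbabilityMeasure (noiseLaw K v) := by
  unfold noiseLaw; infer_instance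

instance (K : Matrix (Fin 2) (Fin 2) ℝ) (v : ℝ) : IsGaussian (noiseLaw K v) := by
  unfold noiseLaw; infer_instance

/-- Noise of the equivalent noiseless-feedback channel, when there is no feedback in round `0`. -/
def combine {N : ℕ} (γ : Fin N → ℝ) (ξ : Fin N → NoisePair × ℝ) (n : Fin N) : NoisePair :=
  (ξ n).1 - (if n.val = 0 then 0 else (γ n)⁻¹ * (ξ n).2) • WithLp.toLp 2 fun _ => 1

/-- Law of the noise of the equivalent noiseless-feedback channel. -/
def effLaw (N : ℕ) (K K' : Matrix (Fin 2) (Fin 2) ℝ) : Measure (Fin N → NoisePair) :=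
  Measure.pi fun n => multivariateGaussian 0 (if n.val = 0 then K else K')

instance (N : ℕ) (K K' : Matrix (Fin 2) (Fin 2) ℝ) : IsProbabilityMeasure (effLaw N K K') := by
  unfold effLaw; infer_instance

lemma measurable_combine {N : ℕ} (γ : Fin N → ℝ) : Measurable (combine γ) := by
  refine measurable_pi_lambda _ fun n => ?_
  unfold combine
  split_ifs <;> fun_prop

/-- The rounds are independent, and each round adds its own scaled feedback noise to both forward
noises, except round `0`, which keeps the covariance `K`. -/
lemma measurePreserving_combine {N : ℕ} {γ : Fin N → ℝ} {K K' : Matrix (Fin 2) (Fin 2) ℝ}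
    (hK : K.PosSemidef) {v : ℝ} (hv : 0 ≤ v)
    (hK' : ∀ n : Fin N, n.val ≠ 0 → K' = K + (v * (γ n)⁻¹ ^ 2) • !![1, 1; 1, 1]) :
    MeasurePreserving (combine γ) (Measure.pi fun _ => noiseLaw K v) (effLaw N K K') := by
  refine measurePreserving_pi (fun _ : Fin N => noiseLaw K v)
    (fun n : Fin N => multivariateGaussian 0 (if n.val = 0 then K else K'))
    (f := fun n p => p.1 - (if n.val = 0 then 0 else (γ n)⁻¹ * p.2) • WithLp.toLp 2 fun _ => 1)
    fun n => ⟨?_, ?_⟩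
  · split_ifs <;> fun_prop
  · by_cases hn : n.val = 0
    · simp only [hn, if_true, zero_smul, sub_zero]
      exact Measure.map_fst_prod.trans (by simp)
    · simp only [hn, if_false]
      rw [hK' n hn]
      exact map_sub_smul_one_multivariateGaussian hK hv _

/-- Changing the sign of the feedback noise in round `n`. -/
def flipAt {N : ℕ} (n : Fin N) (ξ : Fin N → NoisePair × ℝ) (m : Fin N) : NoisePair × ℝ :=
  if m = n then ((ξ m).1, -(ξ m).2) else ξ m

/-- The LFC input of round `n` depends only on noises of earlier rounds; this symmetry thus makes it
orthogonal to the feedback noise of round `n` in `lintegral_add_sq_of_symm`. -/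
lemma measurePreserving_flipAt {N : ℕ} (n : Fin N) (K : Matrix (Fin 2) (Fin 2) ℝ) (v : ℝ) :
    MeasurePreserving (flipAt n) (Measure.pi fun _ => noiseLaw K v)
      (Measure.pi fun _ => noiseLaw K v) := by
  refine measurePreserving_pi (fun _ : Fin N => noiseLaw K v) (fun _ : Fin N => noiseLaw K v)
    (f := fun m p => if m = n then (p.1, -p.2) else p) fun m => ?_
  by_cases hm : m = n
  · simp only [hm, if_true]
    exact (MeasurePreserving.id _).prod (measurePreserving_neg_gaussianReal _)
  · simp only [hm, if_false]
    exact MeasurePreserving.id _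

lemma measurePreserving_neg_pi_noiseLaw {N : ℕ} {K : Matrix (Fin 2) (Fin 2) ℝ} (hK : K.PosSemidef)
    (v : ℝ) :
    MeasurePreserving (fun ξ : Fin N → NoisePair × ℝ => -ξ) (Measure.pi fun _ => noiseLaw K v)
      (Measure.pi fun _ => noiseLaw K v) :=
  measurePreserving_pi (fun _ : Fin N => noiseLaw K v) (fun _ : Fin N => noiseLaw K v)
    (f := fun _ p => -p) fun _ => (measurePreserving_neg_multivariateGaussian hK).prod
      (measurePreserving_neg_gaussianReal _)

lemma measurePreserving_neg_effLaw {N : ℕ} {K K' : Matrix (Fin 2) (Fin 2) ℝ} (hK : K.PosSemidef)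
    (hK' : K'.PosSemidef) :
    MeasurePreserving (fun z : Fin N → NoisePair => -z) (effLaw N K K') (effLaw N K K') :=
  measurePreserving_pi (fun n : Fin N => multivariateGaussian 0 (if n.val = 0 then K else K'))
    (fun n : Fin N => multivariateGaussian 0 (if n.val = 0 then K else K'))
    (f := fun _ p => -p) fun n => measurePreserving_neg_multivariateGaussian (by split_ifs <;> assumption)

lemma combine_flipAt_of_lt {N : ℕ} (γ : Fin N → ℝ) (ξ : Fin N → NoisePair × ℝ) {n j : Fin N}
    (h : j < n) : combine γ (flipAt n ξ) j = combine γ ξ j := by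
  simp [combine, flipAt, h.ne]

lemma lintegral_feedbackNoise_sq {N : ℕ} (n : Fin N) (K : Matrix (Fin 2) (Fin 2) ℝ) {v : ℝ} (c : ℝ) :
    ∫⁻ ξ, ENNReal.ofReal ((-(c * (ξ n).2)) ^ 2) ∂(Measure.pi fun _ : Fin N => noiseLaw K v) =
      ENNReal.ofReal (c ^ 2 * v) := by
  have h1 : MeasurePreserving (fun ξ : Fin N → NoisePair × ℝ => (ξ n).2)
      (Measure.pi fun _ : Fin N => noiseLaw K v) (gaussianReal 0 v.toNNReal) :=
    measurePreserving_snd.comp (measurePreserving_eval (fun _ : Fin N => noiseLaw K v) n)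
  have h2 := h1.lintegral_comp (f := fun x => ENNReal.ofReal ((-(c * x)) ^ 2)) (by fun_prop)
  rw [h2]
  have h3 : ∀ x : ℝ, ENNReal.ofReal ((-(c * x)) ^ 2) = ENNReal.ofReal (c ^ 2) * ENNReal.ofReal (x ^ 2) := by
    intro x
    rw [← ENNReal.ofReal_mul (sq_nonneg c)]
    congr 1; ring
  simp only [h3]
  rw [lintegral_const_mul _ (by fun_prop), lintegral_sq_gaussianReal,
    ENNReal.ofReal_mul (sq_nonneg c)]
  rfl

/-! ### Second moments of the input and of the vector to be reduced -/

namespace LFC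

variable {S : LFC} {γ : Fin S.N → ℝ} {K K' : Matrix (Fin 2) (Fin 2) ℝ} {v : ℝ}

/-- The noise law is symmetric and the noise response odd, so there is no cross term. -/
lemma lintegral_input_sq (hK : K.PosSemidef) (hK' : K'.PosSemidef) (w : ∀ i, Fin (S.M i))
    (n : Fin S.N) :
    ∫⁻ z, ENNReal.ofReal (S.input w z n ^ 2) ∂effLaw S.N K K' =
      ENNReal.ofReal (S.codebookBar n w ^ 2) +
        ∫⁻ z, ENNReal.ofReal (S.noiseResponse z n ^ 2) ∂effLaw S.N K K' := by
  simp only [input_eq_codebookBar_add]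
  rw [lintegral_add_sq_of_symm (measurePreserving_neg_effLaw hK hK') measurable_const
    (measurable_noiseResponse n) (fun _ => rfl) fun z => noiseResponse_neg z n]
  simp

lemma noiseResponse_combine_flipAt (γ : Fin S.N → ℝ) (n : Fin S.N) (ξ : Fin S.N → NoisePair × ℝ) :
    S.noiseResponse (combine γ (flipAt n ξ)) n = S.noiseResponse (combine γ ξ) n :=
  noiseResponse_congr fun _ hj => combine_flipAt_of_lt γ ξ hj

/-- Power of the input of the scheme with feedback noise. -/
lemma lintegral_noisy_input_sq (hK : K.PosSemidef) (hv : 0 ≤ v)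
    (hK' : ∀ n : Fin S.N, n.val ≠ 0 → K' = K + (v * (γ n)⁻¹ ^ 2) • !![1, 1; 1, 1])
    (w : ∀ i, Fin (S.M i)) (n : Fin S.N) :
    ∫⁻ ξ, ENNReal.ofReal ((S.input w (combine γ ξ) n -
        (if n.val = 0 then 0 else (γ n)⁻¹ * (ξ n).2)) ^ 2) ∂(Measure.pi fun _ => noiseLaw K v) =
      ∫⁻ z, ENNReal.ofReal (S.input w z n ^ 2) ∂effLaw S.N K K' +
        ENNReal.ofReal (if n.val = 0 then 0 else (γ n)⁻¹ ^ 2 * v) := by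
  have hmp := measurePreserving_combine hK hv hK'
  have h1 := hmp.lintegral_comp (f := fun z => ENNReal.ofReal (S.input w z n ^ 2))
    (((measurable_input w n).pow_const 2).ennreal_ofReal)
  rw [← h1]
  by_cases hn : n.val = 0
  · simp [hn]
  · simp only [hn, if_false, sub_eq_add_neg]
    rw [lintegral_add_sq_of_symm (a := fun ξ => S.input w (combine γ ξ) n)
      (b := fun ξ => -((γ n)⁻¹ * (ξ n).2)) (measurePreserving_flipAt n K v)
      ((measurable_input w n).comp (measurable_combine γ)) (by fun_prop) (fun ξ => ?_) fun ξ => ?_,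
      lintegral_feedbackNoise_sq]
    · rw [input_eq_codebookBar_add, input_eq_codebookBar_add, noiseResponse_combine_flipAt]
    · simp [flipAt]

/-- The law of the vector reduced modulo the lattice is Gaussian with controlled variance. -/
lemma exists_map_preMod_eq_gaussianReal (hK : K.PosSemidef) (hv : 0 ≤ v)
    (hK' : ∀ n : Fin S.N, n.val ≠ 0 → K' = K + (v * (γ n)⁻¹ ^ 2) • !![1, 1; 1, 1])
    (n : Fin S.N) {Q : ℝ} (hQ : 0 ≤ Q)
    (hS : ∫⁻ z, ENNReal.ofReal (S.noiseResponse z n ^ 2) ∂effLaw S.N K K' ≤ ENNReal.ofReal Q) :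
    ∃ v', 0 ≤ v' ∧ v' ≤ γ n ^ 2 * Q + v ∧
      (Measure.pi fun _ => noiseLaw K v).map
        (fun ξ => γ n * S.noiseResponse (combine γ ξ) n - (ξ n).2) = gaussianReal 0 v'.toNNReal := by
  obtain ⟨ℓ, hℓ⟩ := S.exists_noiseResponse_eq_continuousLinearMap n
  have hmp := measurePreserving_combine hK hv hK'
  let cmb : (Fin S.N → NoisePair × ℝ) →L[ℝ] (Fin S.N → NoisePair) := ContinuousLinearMap.pi fun m =>
    (ContinuousLinearMap.fst ℝ NoisePair ℝ).comp (ContinuousLinearMap.proj m) -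
    (((if m.val = 0 then (0 : ℝ) else (γ m)⁻¹) • (ContinuousLinearMap.snd ℝ NoisePair ℝ).comp
      (ContinuousLinearMap.proj m)).smulRight (WithLp.toLp 2 fun _ => (1 : ℝ) : NoisePair))
  have hcmb : ∀ ξ, cmb ξ = combine γ ξ := by
    intro ξ
    ext m : 1
    by_cases hm : m.val = 0 <;> simp [cmb, combine, hm]
  let f : (Fin S.N → NoisePair × ℝ) →L[ℝ] ℝ := γ n • ℓ.comp cmb -
    (ContinuousLinearMap.snd ℝ NoisePair ℝ).comp (ContinuousLinearMap.proj n)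
  have hf : ∀ ξ, f ξ = γ n * S.noiseResponse (combine γ ξ) n - (ξ n).2 := by
    intro ξ
    simp [f, hcmb, hℓ]
  have hGauss : IsGaussian (Measure.pi fun _ : Fin S.N => noiseLaw K v) := isGaussian_pi _
  have hint : ∫⁻ ξ, ENNReal.ofReal (f ξ ^ 2) ∂(Measure.pi fun _ : Fin S.N => noiseLaw K v) ≤
      ENNReal.ofReal (γ n ^ 2 * Q + v) := by
    -- The two summands are orthogonal by the sign flip in round `n`, whence the variance bound `γ²
    -- Q + v`.
    have h0 : ∀ ξ, f ξ = γ n * S.noiseResponse (combine γ ξ) n + -(1 * (ξ n).2) := by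
      intro ξ; rw [hf]; ring
    simp only [h0]
    rw [lintegral_add_sq_of_symm (a := fun ξ => γ n * S.noiseResponse (combine γ ξ) n)
      (b := fun ξ => -(1 * (ξ n).2)) (measurePreserving_flipAt n K v)
      (((measurable_noiseResponse n).comp (measurable_combine γ)).const_mul _) (by fun_prop)
      (fun ξ => by rw [noiseResponse_combine_flipAt]) (fun ξ => by simp [flipAt]),
      lintegral_feedbackNoise_sq, one_pow, one_mul,
      ENNReal.ofReal_add (by positivity) hv, ENNReal.ofReal_mul (sq_nonneg _)]
    gcongr
    have h1 := hmp.lintegral_comp (f := fun z => ENNReal.ofReal (S.noiseResponse z n ^ 2))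
      (((measurable_noiseResponse n).pow_const 2).ennreal_ofReal)
    simp only [mul_pow, ENNReal.ofReal_mul (sq_nonneg (γ n))]
    rw [lintegral_const_mul' _ _ ENNReal.ofReal_ne_top, h1]
    gcongr
  obtain ⟨v', h0, h1, h2⟩ := exists_map_eq_gaussianReal _ (measurePreserving_neg_pi_noiseLaw hK v) f
    (by positivity) hint
  refine ⟨v', h0, h1, ?_⟩
  rw [← h2]
  congr 1
  ext ξ
  exact (hf ξ).symm

end LFC


/-! ### Distribution of the equivalent noise in a modulo-lattice scheme -/

instance (N : ℕ) (K : Matrix (Fin 2) (Fin 2) ℝ) : IsProbabilityMeasure (bcNoise N K) := by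
  unfold bcNoise; infer_instance

instance (N : ℕ) (v : ℝ) : IsProbabilityMeasure (macNoise N v) := by
  unfold macNoise; infer_instance

/-- The predecessor map is closed up cyclically into a permutation, so that assigning feedback noise
samples to blocks is a reindexing of a product measure. Its values on step-`0` blocks are
irrelevant, since those blocks use no feedback. -/
lemma exists_equiv_val_sub_one (m : ℕ) :
    ∃ e : Fin m ≃ Fin m, ∀ b, b.val ≠ 0 → (e b).val = b.val - 1 := by
  cases m with
  | zero => exact ⟨Equiv.refl _, fun b => b.elim0⟩
  | succ m =>
    refine ⟨Equiv.subRight 1, fun b hb => ?_⟩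
    exact Fin.val_sub_one_of_ne_zero fun h => hb (by simp [h])

namespace MLLFC

variable (C : MLLFC)

/-- The predecessor map on blocks, completed to a permutation. -/
def cycBlock : C.Block ≃ C.Block := (exists_equiv_val_sub_one (C.lfc.N * 2)).choose

variable {C}

lemma cycBlock_eq {b : C.Block} (hb : b.val ≠ 0) : C.cycBlock b = prevBlock b :=
  Fin.ext ((exists_equiv_val_sub_one (C.lfc.N * 2)).choose_spec b hb)

lemma cycBlock_block {n : Fin C.lfc.N} (hn : n.val ≠ 0) (π : Fin 2) :
    C.cycBlock (C.block n π) = prevBlock (C.block n π) :=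
  cycBlock_eq (by rw [val_block]; omega)

variable (C)

/-- The times at which the instances are served. -/
def timeEquiv (σ : C.Block ≃ C.Block) : Fin 2 × (Fin C.L × Fin C.lfc.N) ≃ Fin C.len where
  toFun q := C.time (σ (C.block q.2.2 q.1)) q.2.1
  invFun t := (C.parity (σ.symm (C.blockOf t)), C.posOf t, C.step (σ.symm (C.blockOf t)))
  left_inv q := by simp
  right_inv t := by simp

/-- The noise samples used by the instances. -/
def instNoise (z : (Fin C.len → NoisePair) × (Fin C.len → ℝ)) (π : Fin 2) (ℓ : Fin C.L)
    (n : Fin C.lfc.N) : NoisePair × ℝ :=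
  (z.1 (C.time (C.block n π) ℓ), z.2 (C.time (C.cycBlock (C.block n π)) ℓ))

/-- Forward and feedback samples are each permuted bijectively among the triples (parity, position,
step), then paired and curried: all instances get independent noise of the same law. -/
lemma measurePreserving_instNoise (K : Matrix (Fin 2) (Fin 2) ℝ) (v : ℝ) :
    MeasurePreserving C.instNoise ((bcNoise C.len K).prod (macNoise C.len v))
      (Measure.pi fun _ => Measure.pi fun _ => Measure.pi fun _ => noiseLaw K v) := by
  have h1 := (measurePreserving_pi_comp_equiv (C.timeEquiv (Equiv.refl _))
    (multivariateGaussian (0 : NoisePair) K)).prod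
    (measurePreserving_pi_comp_equiv (C.timeEquiv C.cycBlock) (gaussianReal 0 v.toNNReal))
  have h2 := (measurePreserving_pi_prodMk (ι := Fin 2 × (Fin C.L × Fin C.lfc.N))
    (multivariateGaussian (0 : NoisePair) K) (gaussianReal 0 v.toNNReal)).comp h1
  have h3 := (measurePreserving_pi_curry (ι := Fin 2) (κ := Fin C.L × Fin C.lfc.N)
    (noiseLaw K v)).comp h2
  have h4 := (measurePreserving_pi
    (fun _ : Fin 2 => Measure.pi fun _ : Fin C.L × Fin C.lfc.N => noiseLaw K v)
    (fun _ : Fin 2 => Measure.pi fun _ : Fin C.L => Measure.pi fun _ : Fin C.lfc.N => noiseLaw K v)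
    (f := fun _ x ℓ n => x (ℓ, n)) fun _ => measurePreserving_pi_curry (noiseLaw K v)).comp h3
  exact h4

lemma effNoise_eq (z : (Fin C.len → NoisePair) × (Fin C.len → ℝ)) (ℓ : Fin C.L) (π : Fin 2) :
    C.effNoise z ℓ π = combine C.γ (C.instNoise z π ℓ) := by
  ext n : 1
  by_cases hn : n.val = 0
  · simp [effNoise, combine, instNoise, hn]
  · simp [effNoise, combine, instNoise, hn, cycBlock_block hn]

lemma preMod_eq (z : (Fin C.len → NoisePair) × (Fin C.len → ℝ)) {n : Fin C.lfc.N} (hn : n.val ≠ 0)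
    (π : Fin 2) (ℓ : Fin C.L) :
    C.preMod z n π ℓ = C.γ n * C.lfc.noiseResponse (combine C.γ (C.instNoise z π ℓ)) n -
      (C.instNoise z π ℓ n).2 := by
  rw [preMod, effNoise_eq, instNoise, cycBlock_block hn]

lemma virtualInput_eq (w : ∀ i, C.Msg i) (z : (Fin C.len → NoisePair) × (Fin C.len → ℝ))
    (n : Fin C.lfc.N) (π : Fin 2) (ℓ : Fin C.L) :
    C.virtualInput w z n π ℓ = C.lfc.input (C.msg w ℓ π) (combine C.γ (C.instNoise z π ℓ)) n -
      (if n.val = 0 then 0 else (C.γ n)⁻¹ * (C.instNoise z π ℓ n).2) := by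
  rw [virtualInput, effNoise_eq]
  by_cases hn : n.val = 0
  · simp [hn]
  · rw [if_neg hn, if_neg hn, instNoise, cycBlock_block hn]

lemma measurable_instNoise : Measurable C.instNoise :=
  (C.measurePreserving_instNoise 0 0).measurable

lemma measurable_preMod (n : Fin C.lfc.N) (π : Fin 2) : Measurable fun z => C.preMod z n π := by
  refine measurable_pi_lambda _ fun ℓ => Measurable.sub (Measurable.const_mul ?_ _) (by fun_prop)
  simp only [effNoise_eq]
  refine (LFC.measurable_noiseResponse n).comp ((measurable_combine _).comp ?_)
  exact (measurable_pi_apply ℓ).comp ((measurable_pi_apply π).comp C.measurable_instNoise)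

lemma aliasing_eq : C.aliasing = ⋃ n : Fin C.lfc.N, ⋃ π : Fin 2,
    {z | n.val ≠ 0 ∧ C.preMod z n π ∉ C.lattice.cell} := by
  ext z; simp [aliasing]

lemma measurableSet_aliasing : MeasurableSet C.aliasing := by
  rw [aliasing_eq]
  refine MeasurableSet.iUnion fun n => MeasurableSet.iUnion fun π => ?_
  by_cases hn : n.val = 0
  · simp [hn]
  · simp only [hn, ne_eq, not_false_eq_true, true_and]
    exact C.measurable_preMod n π C.lattice.measurableSet_cell.compl

variable {C} {K K' : Matrix (Fin 2) (Fin 2) ℝ} {v : ℝ}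

lemma measurePreserving_instance (π : Fin 2) (ℓ : Fin C.L) :
    MeasurePreserving (fun z => C.instNoise z π ℓ) ((bcNoise C.len K).prod (macNoise C.len v))
      (Measure.pi fun _ => noiseLaw K v) :=
  (measurePreserving_eval (fun _ : Fin C.L => Measure.pi fun _ : Fin C.lfc.N => noiseLaw K v) ℓ).comp
    ((measurePreserving_eval (fun _ : Fin 2 => Measure.pi fun _ : Fin C.L =>
      Measure.pi fun _ : Fin C.lfc.N => noiseLaw K v) π).comp (C.measurePreserving_instNoise K v))

lemma measurePreserving_effNoise (hK : K.PosSemidef) (hv : 0 ≤ v)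
    (hK' : ∀ n : Fin C.lfc.N, n.val ≠ 0 → K' = K + (v * (C.γ n)⁻¹ ^ 2) • !![1, 1; 1, 1])
    (π : Fin 2) (ℓ : Fin C.L) :
    MeasurePreserving (fun z => C.effNoise z ℓ π) ((bcNoise C.len K).prod (macNoise C.len v))
      (effLaw C.lfc.N K K') := by
  simp only [effNoise_eq]
  exact (measurePreserving_combine hK hv hK').comp (measurePreserving_instance π ℓ)

/-- Power of the transmission of Terminal A in the absence of aliasing. -/
lemma lintegral_virtualInput_sq (hK : K.PosSemidef) (hv : 0 ≤ v)
    (hK' : ∀ n : Fin C.lfc.N, n.val ≠ 0 → K' = K + (v * (C.γ n)⁻¹ ^ 2) • !![1, 1; 1, 1])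
    (w : ∀ i, C.Msg i) (n : Fin C.lfc.N) (π : Fin 2) (ℓ : Fin C.L) :
    ∫⁻ z, ENNReal.ofReal (C.virtualInput w z n π ℓ ^ 2)
        ∂((bcNoise C.len K).prod (macNoise C.len v)) =
      ∫⁻ z, ENNReal.ofReal (C.lfc.input (C.msg w ℓ π) z n ^ 2) ∂effLaw C.lfc.N K K' +
        ENNReal.ofReal (if n.val = 0 then 0 else (C.γ n)⁻¹ ^ 2 * v) := by
  rw [← LFC.lintegral_noisy_input_sq hK hv hK']
  simp only [virtualInput_eq]
  refine (measurePreserving_instance π ℓ).lintegral_comp (f := fun ξ => ENNReal.ofReal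
    ((C.lfc.input (C.msg w ℓ π) (combine C.γ ξ) n -
      (if n.val = 0 then 0 else (C.γ n)⁻¹ * (ξ n).2)) ^ 2)) ?_
  refine ((Measurable.sub ((LFC.measurable_input _ n).comp (measurable_combine _)) ?_).pow_const
    2).ennreal_ofReal
  split_ifs <;> fun_prop

/-- The probability of aliasing. -/
lemma measure_aliasing_le (hK : K.PosSemidef) (hv : 0 ≤ v)
    (hK' : ∀ n : Fin C.lfc.N, n.val ≠ 0 → K' = K + (v * (C.γ n)⁻¹ ^ 2) • !![1, 1; 1, 1])
    {Q V : ℝ} (hQ : 0 ≤ Q)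
    (hS : ∀ n, ∫⁻ z, ENNReal.ofReal (C.lfc.noiseResponse z n ^ 2) ∂effLaw C.lfc.N K K' ≤
      ENNReal.ofReal Q)
    (hV : ∀ n, C.γ n ^ 2 * Q + v ≤ V) {p : ℝ≥0∞}
    (hp : ∀ v', 0 ≤ v' → v' ≤ V →
      (Measure.pi fun _ : Fin C.L => gaussianReal 0 v'.toNNReal) C.lattice.cellᶜ ≤ p) :
    ((bcNoise C.len K).prod (macNoise C.len v)) C.aliasing ≤ 2 * C.lfc.N * p := by
  have key : ∀ (n : Fin C.lfc.N) (π : Fin 2), ((bcNoise C.len K).prod (macNoise C.len v))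
      {z | n.val ≠ 0 ∧ C.preMod z n π ∉ C.lattice.cell} ≤ p := by
    intro n π
    by_cases hn : n.val = 0
    · simp [hn]
    · simp only [hn, ne_eq, not_false_eq_true, true_and]
      obtain ⟨v', h0, h1, h2⟩ := LFC.exists_map_preMod_eq_gaussianReal hK hv hK' n hQ (hS n)
      have h3 : MeasurePreserving (fun ξ => C.γ n * C.lfc.noiseResponse (combine C.γ ξ) n - (ξ n).2)
          (Measure.pi fun _ => noiseLaw K v) (gaussianReal 0 v'.toNNReal) :=
        ⟨((LFC.measurable_noiseResponse n).comp (measurable_combine _)).const_mul _ |>.sub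
          (by fun_prop), h2⟩
      -- The `L` instances of a block use disjoint noise samples, so the vector is white Gaussian
      -- and the bound `hp` on the cell applies to it.
      have h4 := (measurePreserving_pi (fun _ : Fin C.L => Measure.pi fun _ : Fin C.lfc.N =>
        noiseLaw K v) (fun _ => gaussianReal 0 v'.toNNReal) fun _ => h3).comp
        ((measurePreserving_eval (fun _ : Fin 2 => Measure.pi fun _ : Fin C.L =>
      Measure.pi fun _ : Fin C.lfc.N => noiseLaw K v) π).comp (C.measurePreserving_instNoise K v))
      have h5 := h4.measure_preimage C.lattice.measurableSet_cell.compl.nullMeasurableSet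
      refine le_trans (le_of_eq ?_) (hp v' h0 (h1.trans (hV n)))
      rw [← h5]
      congr 1
      ext z
      simp only [Set.mem_ofPred_eq, Set.mem_preimage, Set.mem_compl_iff]
      have : C.preMod z n π = fun ℓ => C.γ n * C.lfc.noiseResponse (combine C.γ
          (C.instNoise z π ℓ)) n - (C.instNoise z π ℓ n).2 := by
        ext ℓ; rw [preMod_eq C z hn]
      rw [this]; rfl
  rw [aliasing_eq]
  refine (measure_iUnion_fintype_le _ _).trans ?_
  refine (Finset.sum_le_sum fun n _ => (measure_iUnion_fintype_le _ _).trans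
    (Finset.sum_le_sum fun π _ => key n π)).trans (le_of_eq ?_)
  simp
  ring

end MLLFC


/-! ### Uniform averages -/

section UniformAvg

variable {W A B : Type} [Fintype W] [Fintype A] [Fintype B]

lemma uniformAvg_mono {f g : W → ℝ≥0∞} (h : ∀ w, f w ≤ g w) : uniformAvg f ≤ uniformAvg g :=
  ENNReal.div_le_div_right (Finset.sum_le_sum fun w _ => h w) _

lemma uniformAvg_add (f g : W → ℝ≥0∞) :
    uniformAvg (fun w => f w + g w) = uniformAvg f + uniformAvg g := by
  simp only [uniformAvg, Finset.sum_add_distrib, ENNReal.add_div]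

lemma uniformAvg_sum {ι : Type*} (s : Finset ι) (f : ι → W → ℝ≥0∞) :
    uniformAvg (fun w => ∑ i ∈ s, f i w) = ∑ i ∈ s, uniformAvg (f i) := by
  simp only [uniformAvg, div_eq_mul_inv]
  rw [Finset.sum_comm, Finset.sum_mul]

lemma uniformAvg_const_mul (c : ℝ≥0∞) (f : W → ℝ≥0∞) :
    uniformAvg (fun w => c * f w) = c * uniformAvg f := by
  simp only [uniformAvg, ← Finset.mul_sum, mul_div_assoc]

lemma uniformAvg_const_le (c : ℝ≥0∞) : uniformAvg (fun _ : W => c) ≤ c := by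
  simp only [uniformAvg, Finset.sum_const, Finset.card_univ, nsmul_eq_mul]
  rw [mul_comm]
  exact ENNReal.div_le_of_le_mul le_rfl

/-- The average of a function of the first component of a uniform pair. -/
lemma uniformAvg_comp_fst [Nonempty B] (e : W ≃ A × B) (f : A → ℝ≥0∞) :
    uniformAvg (fun w => f (e w).1) = uniformAvg f := by
  have hB : (Fintype.card B : ℝ≥0∞) ≠ 0 := by simp
  simp only [uniformAvg]
  rw [Fintype.card_congr e, Fintype.card_prod, Equiv.sum_comp e fun p => f p.1,
    Fintype.sum_prod_type]
  simp only [Finset.sum_const, Finset.card_univ, nsmul_eq_mul, ← Finset.mul_sum]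
  rw [Nat.cast_mul, mul_comm (Fintype.card A : ℝ≥0∞),
    ENNReal.mul_div_mul_left _ _ hB (ENNReal.natCast_ne_top _)]

end UniformAvg

namespace MLLFC

variable {C : MLLFC}

/-- The messages of one instance are uniform. -/
lemma uniformAvg_msg (ℓ : Fin C.L) (π : Fin 2) (f : (∀ i, Fin (C.lfc.M i)) → ℝ≥0∞) :
    uniformAvg (fun w : ∀ i, C.Msg i => f (C.msg w ℓ π)) = uniformAvg f := by
  have : ∀ i, NeZero (C.lfc.M i) := fun i => ⟨(C.lfc.M_pos i).ne'⟩
  exact uniformAvg_comp_fst ((Equiv.piCongrRight fun i : Fin 2 =>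
    Equiv.funSplitAt (ℓ, π) (Fin (C.lfc.M i))).trans (Equiv.arrowProdEquivProdArrow (Fin 2)
      (fun i => Fin (C.lfc.M i)) fun i => {j // j ≠ (ℓ, π)} → Fin (C.lfc.M i))) f

lemma sum_time (f : Fin C.len → ℝ≥0∞) :
    ∑ t, f t = ∑ π, ∑ ℓ, ∑ n, f (C.time (C.block n π) ℓ) := by
  rw [← Equiv.sum_comp (C.timeEquiv (Equiv.refl _)), Fintype.sum_prod_type]
  simp only [Fintype.sum_prod_type]
  rfl

lemma sum_time_cycBlock (f : Fin C.len → ℝ≥0∞) :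
    ∑ t, f t = ∑ π, ∑ n, ∑ ℓ, f (C.time (C.cycBlock (C.block n π)) ℓ) := by
  rw [← Equiv.sum_comp (C.timeEquiv C.cycBlock), Fintype.sum_prod_type]
  simp only [Fintype.sum_prod_type]
  refine Finset.sum_congr rfl fun π _ => ?_
  rw [Finset.sum_comm]
  rfl

end MLLFC

lemma sum_ite_val_eq_zero (N : ℕ) (a : ℝ≥0∞) :
    ∑ n : Fin N, (if n.val = 0 then 0 else a) = (N - 1 : ℕ) * a := by
  cases N with
  | zero => simp
  | succ N => simp [Fin.sum_univ_succ]

namespace MLLFC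

variable {C : MLLFC} {K K' : Matrix (Fin 2) (Fin 2) ℝ} {v : ℝ}

/-! ### Power of the feedback transmissions -/

/-- The outputs do not depend on the dithers, so given all noise the transmitted vector is a
constant plus a uniform dither, reduced: it is uniform on the cell even under aliasing. -/
lemma lintegral_normSq_fbInput (w : ∀ i, C.Msg i) (i : Fin 2) (b : C.Block) :
    ∫⁻ ω, ENNReal.ofReal (normSq (C.lattice.modulo (C.γ (C.step b) •
        C.fbVec i b (C.toScheme.output w ω i) + ω.2 i b))) ∂C.toScheme.law K v =
      ∫⁻ x, ENNReal.ofReal (normSq x) ∂C.lattice.uniformCell := by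
  have hmeas : Measurable fun ω : Sample C.len C.Dither => C.lattice.modulo (C.γ (C.step b) •
        C.fbVec i b (C.toScheme.output w ω i) + ω.2 i b) := by
    refine C.lattice.measurable_modulo.comp (Measurable.add ?_ ?_)
    · refine measurable_pi_lambda _ fun ℓ =>
        (Finset.measurable_sum _ fun j _ => ?_).const_mul _
      exact (C.toScheme.measurable_output w i _).const_mul _
    · exact (measurable_pi_apply _).comp ((measurable_pi_apply i).comp measurable_snd)
  have hprob : IsProbabilityMeasure C.toScheme.common := C.toScheme.isProb
  have hmeas' : Measurable fun ω : Sample C.len C.Dither => ENNReal.ofReal (normSq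
      (C.lattice.modulo (C.γ (C.step b) • C.fbVec i b (C.toScheme.output w ω i) + ω.2 i b))) :=
    (measurable_normSq.comp hmeas).ennreal_ofReal
  rw [InteractiveScheme.law, lintegral_prod _ hmeas'.aemeasurable]
  have key : ∀ z, ∫⁻ u, ENNReal.ofReal (normSq (C.lattice.modulo (C.γ (C.step b) •
      C.fbVec i b (C.toScheme.output w (z, u) i) + u i b))) ∂C.toScheme.common =
      ∫⁻ x, ENNReal.ofReal (normSq x) ∂C.lattice.uniformCell := by
    intro z
    set c : Fin C.L → ℝ := C.γ (C.step b) • C.fbVec i b (C.toScheme.output w (z, 0) i)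
    have h1 : ∀ u, C.γ (C.step b) • C.fbVec i b (C.toScheme.output w (z, u) i) = c := by
      intro u
      have : C.toScheme.output w (z, u) i = C.toScheme.output w (z, 0) i :=
        funext fun t => output_eq_of_fst_eq w (ω := (z, u)) (ω' := (z, 0)) rfl i t
      rw [this]
    simp only [h1]
    have h2 : MeasurePreserving (fun u : C.Dither => u i b) C.ditherLaw C.lattice.uniformCell :=
      (measurePreserving_eval (fun _ : C.Block => C.lattice.uniformCell) b).comp
        (measurePreserving_eval (fun _ : Fin 2 => Measure.pi fun _ : C.Block =>
          C.lattice.uniformCell) i)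
    have h3 := h2.lintegral_comp (f := fun x => ENNReal.ofReal (normSq (C.lattice.modulo (c + x))))
      (measurable_normSq.comp (C.lattice.measurable_modulo.comp
        (measurable_const.add measurable_id))).ennreal_ofReal
    refine h3.trans ?_
    exact C.lattice.lintegral_modulo_add_uniformCell c (f := fun x => ENNReal.ofReal (normSq x))
  simp only [key]
  simp

/-- Only the blocks of the steps other than `0` are served, two per step. The factor `N - 1` rather
than `N` later pays for the excess second moment of the lattice. -/
lemma sum_meanPower_fbInput_le (i : Fin 2) :
    ∑ t, meanPower (C.toScheme.law K v) (fun w ω => C.toScheme.fbInput w ω i t) ≤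
      2 * ((C.lfc.N - 1 : ℕ) * ∫⁻ x, ENNReal.ofReal (normSq x) ∂C.lattice.uniformCell) := by
  simp only [meanPower]
  rw [← uniformAvg_sum]
  refine (uniformAvg_mono fun w => ?_).trans (uniformAvg_const_le _)
  rw [sum_time_cycBlock]
  have key : ∀ n π, ∑ ℓ, ∫⁻ ω, ENNReal.ofReal (C.toScheme.fbInput w ω i
      (C.time (C.cycBlock (C.block n π)) ℓ) ^ 2) ∂C.toScheme.law K v =
      if n.val = 0 then 0 else ∫⁻ x, ENNReal.ofReal (normSq x) ∂C.lattice.uniformCell := by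
    intro n π
    split_ifs with hn
    · refine Finset.sum_eq_zero fun ℓ _ => ?_
      have : ∀ ω, C.toScheme.fbInput w ω i (C.time (C.cycBlock (C.block n π)) ℓ) = 0 := by
        intro ω
        refine fbInput_eq_zero w ω i _ fun b hb h => ?_
        rw [blockOf_time, ← cycBlock_eq (by rw [val_eq]; omega)] at h
        refine hb ?_
        rw [← C.cycBlock.injective h, step_block, hn]
      simp [this]
    · rw [← lintegral_finsetSum _ fun ℓ _ =>
        ((C.toScheme.measurable_fbInput w i _).pow_const 2).ennreal_ofReal,
        ← lintegral_normSq_fbInput w i (C.block n π)]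
      refine lintegral_congr fun ω => ?_
      rw [normSq, ENNReal.ofReal_sum_of_nonneg fun _ _ => sq_nonneg _]
      refine Finset.sum_congr rfl fun ℓ _ => ?_
      rw [cycBlock_block hn, fbInput_eq _ _ _ _ (by simpa using hn)]
  simp only [key, sum_ite_val_eq_zero]
  simp

/-! ### Power of the forward transmissions -/

/-- Without aliasing the input is `virtualInput`; with aliasing the deterministic bound
`input_sq_le` holds. Its codebook part is at most twice the power of the LFC input itself, so no
uniform bound on the codebook is needed. -/
lemma lintegral_input_sq_le (hK : K.PosSemidef) (hKe : K'.PosSemidef) (hv : 0 ≤ v)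
    (hK' : ∀ n : Fin C.lfc.N, n.val ≠ 0 → K' = K + (v * (C.γ n)⁻¹ ^ 2) • !![1, 1; 1, 1])
    {R : ℝ} (hR : ∀ x, normSq (C.lattice.modulo x) ≤ R) (w : ∀ i, C.Msg i) (n : Fin C.lfc.N)
    (π : Fin 2) (ℓ : Fin C.L) :
    ∫⁻ ω, ENNReal.ofReal (C.toScheme.input w ω (C.time (C.block n π) ℓ) ^ 2)
        ∂C.toScheme.law K v ≤
      (1 + 2 * ((bcNoise C.len K).prod (macNoise C.len v)) C.aliasing) *
        ∫⁻ z, ENNReal.ofReal (C.lfc.input (C.msg w ℓ π) z n ^ 2) ∂effLaw C.lfc.N K K' +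
      (ENNReal.ofReal (if n.val = 0 then 0 else (C.γ n)⁻¹ ^ 2 * v) +
      ((bcNoise C.len K).prod (macNoise C.len v)) C.aliasing *
        ENNReal.ofReal (2 * (C.γ n)⁻¹ ^ 2 * R)) := by
  have hR0 : 0 ≤ R := (normSq_nonneg _).trans (hR 0)
  set μ := (bcNoise C.len K).prod (macNoise C.len v) with hμ
  set c := ENNReal.ofReal (2 * (C.γ n)⁻¹ ^ 2 * R + 2 * C.lfc.codebookBar n (C.msg w ℓ π) ^ 2)
    with hc
  have hprob : IsProbabilityMeasure C.toScheme.common := C.toScheme.isProb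
  have hvm : Measurable fun z => ENNReal.ofReal (C.virtualInput w z n π ℓ ^ 2) := by
    simp only [virtualInput_eq]
    have h1 : Measurable fun z => C.instNoise z π ℓ := (measurePreserving_instance (K := 0) (v := 0) π ℓ).measurable
    refine (((((LFC.measurable_input _ n).comp (measurable_combine _)).comp h1).sub ?_).pow_const 2).ennreal_ofReal
    split_ifs
    · exact measurable_const
    · exact ((measurable_snd.comp (measurable_pi_apply n)).comp h1).const_mul _
  have hpt : ∀ ω : Sample C.len C.Dither,
      ENNReal.ofReal (C.toScheme.input w ω (C.time (C.block n π) ℓ) ^ 2) ≤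
      (fun z => ENNReal.ofReal (C.virtualInput w z n π ℓ ^ 2) + C.aliasing.indicator (fun _ => c) z)
        ω.1 := by
    intro ω
    by_cases h : ω.1 ∈ C.aliasing
    · simp only [h, Set.indicator_of_mem]
      exact le_add_left (ENNReal.ofReal_le_ofReal (input_sq_le w ω hR n π ℓ))
    · rw [input_eq_virtualInput w ω h]
      exact le_self_add
  have hF := (measurePreserving_fst (μ := μ) (ν := C.toScheme.common)).lintegral_comp
    (f := fun z => ENNReal.ofReal (C.virtualInput w z n π ℓ ^ 2) +
      C.aliasing.indicator (fun _ => c) z)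
    (hvm.add (measurable_const.indicator C.measurableSet_aliasing))
  refine (lintegral_mono hpt).trans ?_
  rw [InteractiveScheme.law, hF, lintegral_add_left hvm,
    lintegral_indicator_const C.measurableSet_aliasing, lintegral_virtualInput_sq hK hv hK', hc,
    ENNReal.ofReal_add (by positivity) (by positivity)]
  have hbar : ENNReal.ofReal (2 * C.lfc.codebookBar n (C.msg w ℓ π) ^ 2) ≤
      2 * ∫⁻ z, ENNReal.ofReal (C.lfc.input (C.msg w ℓ π) z n ^ 2) ∂effLaw C.lfc.N K K' := by
    rw [ENNReal.ofReal_mul (by norm_num), LFC.lintegral_input_sq hK hKe]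
    simp only [ENNReal.ofReal_ofNat]
    gcongr
    exact le_self_add
  calc _ ≤ (∫⁻ z, ENNReal.ofReal (C.lfc.input (C.msg w ℓ π) z n ^ 2) ∂effLaw C.lfc.N K K' +
        ENNReal.ofReal (if n.val = 0 then 0 else (C.γ n)⁻¹ ^ 2 * v)) +
        (ENNReal.ofReal (2 * (C.γ n)⁻¹ ^ 2 * R) + 2 * ∫⁻ z, ENNReal.ofReal
          (C.lfc.input (C.msg w ℓ π) z n ^ 2) ∂effLaw C.lfc.N K K') * μ C.aliasing := by gcongr
    _ = _ := by ring

lemma sum_meanPower_input_le (hK : K.PosSemidef) (hKe : K'.PosSemidef) (hv : 0 ≤ v) {g : ℝ}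
    (hγ : ∀ n, (C.γ n)⁻¹ ^ 2 = g) (hK' : K' = K + (v * g) • !![1, 1; 1, 1])
    {R : ℝ} (hR : ∀ x, normSq (C.lattice.modulo x) ≤ R) :
    ∑ t, meanPower (C.toScheme.law K v) (fun w ω => C.toScheme.input w ω t) ≤
      2 * (C.L * ((1 + 2 * ((bcNoise C.len K).prod (macNoise C.len v)) C.aliasing) *
        ∑ n, meanPower (W := fun i => Fin (C.lfc.M i)) (effLaw C.lfc.N K K')
          (fun w z => C.lfc.input w z n) +
      ((C.lfc.N - 1 : ℕ) * ENNReal.ofReal (g * v) +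
        C.lfc.N * (((bcNoise C.len K).prod (macNoise C.len v)) C.aliasing *
          ENNReal.ofReal (2 * g * R))))) := by
  set μ := (bcNoise C.len K).prod (macNoise C.len v) with hμ
  have key : ∀ n π ℓ, meanPower (C.toScheme.law K v)
      (fun w ω => C.toScheme.input w ω (C.time (C.block n π) ℓ)) ≤
      (1 + 2 * μ C.aliasing) * meanPower (W := fun i => Fin (C.lfc.M i)) (effLaw C.lfc.N K K')
          (fun w z => C.lfc.input w z n) + ((if n.val = 0 then 0 else ENNReal.ofReal (g * v)) +
        μ C.aliasing * ENNReal.ofReal (2 * g * R)) := by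
    intro n π ℓ
    refine (uniformAvg_mono fun w => lintegral_input_sq_le hK hKe hv
      (fun n _ => by rw [hγ, hK']) hR w n π ℓ).trans ?_
    rw [uniformAvg_add, uniformAvg_const_mul, uniformAvg_msg ℓ π fun w =>
      ∫⁻ z, ENNReal.ofReal (C.lfc.input w z n ^ 2) ∂effLaw C.lfc.N K K', hγ]
    refine add_le_add le_rfl ((uniformAvg_const_le _).trans (le_of_eq ?_))
    congr 1
    split_ifs <;> simp
  rw [sum_time]
  refine (Finset.sum_le_sum fun π _ => Finset.sum_le_sum fun ℓ _ => Finset.sum_le_sum fun n _ =>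
    key n π ℓ).trans (le_of_eq ?_)
  simp only [Finset.sum_add_distrib, ← Finset.mul_sum, sum_ite_val_eq_zero]
  simp
  ring

/-! ### Error probability -/

/-- Every instance is decoded separately by `g`, and the union bound runs over aliasing and the `2
L` instances. The instances need not be independent here. -/
lemma errorProb_le (hK : K.PosSemidef) (hv : 0 ≤ v)
    (hK' : ∀ n : Fin C.lfc.N, n.val ≠ 0 → K' = K + (v * (C.γ n)⁻¹ ^ 2) • !![1, 1; 1, 1])
    (g : (i : Fin 2) → (Fin C.lfc.N → ℝ) → Fin (C.lfc.M i))
    (hg : ∀ i a, MeasurableSet (g i ⁻¹' {a})) :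
    C.toScheme.errorProb K v ≤ ((bcNoise C.len K).prod (macNoise C.len v)) C.aliasing +
      2 * (C.L * uniformAvg fun w : ∀ i, Fin (C.lfc.M i) =>
        effLaw C.lfc.N K K' {z | ∃ i, g i (C.lfc.output w z i) ≠ w i}) := by
  set μ := (bcNoise C.len K).prod (macNoise C.len v) with hμ
  have hprob : IsProbabilityMeasure C.toScheme.common := C.toScheme.isProb
  let G : (i : Fin 2) → (Fin C.len → ℝ) × C.Dither → C.Msg i := fun i y q =>
    g i fun n => y.1 (C.time (C.block n q.2) q.1)
  have hG : ∀ i a, MeasurableSet (G i ⁻¹' {a}) := by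
    intro i a
    have : G i ⁻¹' {a} = ⋂ q : Fin C.L × Fin 2,
        (fun y : (Fin C.len → ℝ) × C.Dither => fun n => y.1 (C.time (C.block n q.2) q.1)) ⁻¹'
          (g i ⁻¹' {a q}) := by
      ext y
      simp only [Set.mem_preimage, Set.mem_singleton_iff, Set.mem_iInter, funext_iff, G]
    rw [this]
    refine MeasurableSet.iInter fun q => ?_
    refine Measurable.comp (g := fun y : Fin C.len → ℝ => fun n => y (C.time (C.block n q.2) q.1))
      (by fun_prop) measurable_fst (hg i _)
  have hgE : ∀ w : ∀ i, Fin (C.lfc.M i),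
      MeasurableSet {z : Fin C.lfc.N → NoisePair | ∃ i, g i (C.lfc.output w z i) ≠ w i} := by
    intro w
    have : {z : Fin C.lfc.N → NoisePair | ∃ i, g i (C.lfc.output w z i) ≠ w i} =
        ⋃ i, ((fun z => C.lfc.output w z i) ⁻¹' (g i ⁻¹' {w i}))ᶜ := by
      ext z; simp
    rw [this]
    exact MeasurableSet.iUnion fun i => (LFC.measurable_output w i (hg i _)).compl
  refine (iInf_le _ ⟨G, hG⟩).trans ?_
  have hw : ∀ w : ∀ i, C.Msg i, C.toScheme.law K v
      {ω | ∃ i, G i (C.toScheme.output w ω i, ω.2) ≠ w i} ≤ μ C.aliasing +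
        ∑ π, ∑ ℓ, effLaw C.lfc.N K K'
          {z | ∃ i, g i (C.lfc.output (C.msg w ℓ π) z i) ≠ C.msg w ℓ π i} := by
    intro w
    have hsub : {ω : Sample C.len C.Dither | ∃ i, G i (C.toScheme.output w ω i, ω.2) ≠ w i} ⊆
        Prod.fst ⁻¹' (C.aliasing ∪ ⋃ π, ⋃ ℓ, (fun z => C.effNoise z ℓ π) ⁻¹'
          {z | ∃ i, g i (C.lfc.output (C.msg w ℓ π) z i) ≠ C.msg w ℓ π i}) := by
      rintro ω ⟨i, hi⟩
      by_cases h : ω.1 ∈ C.aliasing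
      · exact Or.inl h
      · obtain ⟨⟨ℓ, π⟩, hq⟩ := Function.ne_iff.1 hi
        refine Or.inr (Set.mem_iUnion.2 ⟨π, Set.mem_iUnion.2 ⟨ℓ, i, ?_⟩⟩)
        simp only [G, output_eq_of_notMem_aliasing w ω h] at hq
        exact hq
    refine (measure_mono hsub).trans ?_
    rw [InteractiveScheme.law, ← Measure.map_apply_of_aemeasurable measurable_fst.aemeasurable,
      measurePreserving_fst.map_eq]
    · refine (measure_union_le _ _).trans (add_le_add le_rfl ?_)
      refine (measure_iUnion_fintype_le _ _).trans (Finset.sum_le_sum fun π _ => ?_)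
      refine (measure_iUnion_fintype_le _ _).trans (Finset.sum_le_sum fun ℓ _ => ?_)
      exact ((measurePreserving_effNoise hK hv hK' π ℓ).measure_preimage
        (hgE _).nullMeasurableSet).le
    · refine C.measurableSet_aliasing.union (MeasurableSet.iUnion fun π => MeasurableSet.iUnion fun ℓ => ?_)
      exact (measurePreserving_effNoise hK hv hK' π ℓ).measurable (hgE _)
  refine (uniformAvg_mono hw).trans ?_
  rw [uniformAvg_add]
  refine add_le_add (uniformAvg_const_le _) (le_of_eq ?_)
  rw [uniformAvg_sum]
  simp only [uniformAvg_sum, uniformAvg_msg _ _ fun w => effLaw C.lfc.N K K'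
          {z | ∃ i, g i (C.lfc.output w z i) ≠ w i}]
  simp

end MLLFC


/-! ### Codes with large minimum distance -/

section Code

variable {A : Type} [Fintype A] [DecidableEq A] [Nonempty A]

/-- There are at most `2^T` sets of differing positions, and at most `(card A)^D` ways to fill each.
-/
lemma card_hammingBall_le (T D : ℕ) (x : Fin T → A) :
    (Finset.univ.filter fun y => hammingDist y x ≤ D).card ≤ 2 ^ T * Fintype.card A ^ D := by
  have hsub : (Finset.univ.filter fun y => hammingDist y x ≤ D) ⊆
      (Finset.univ.filter fun F : Finset (Fin T) => F.card ≤ D).biUnion fun F =>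
        Fintype.piFinset fun t => if t ∈ F then Finset.univ else {x t} := by
    intro y hy
    simp only [Finset.mem_filter, Finset.mem_univ, true_and] at hy
    refine Finset.mem_biUnion.2 ⟨Finset.univ.filter fun t => y t ≠ x t, ?_, ?_⟩
    · simpa [hammingDist] using hy
    · refine Fintype.mem_piFinset.2 fun t => ?_
      by_cases h : y t = x t <;> simp [h]
  refine (Finset.card_le_card hsub).trans (Finset.card_biUnion_le.trans ?_)
  calc _ ≤ ∑ F ∈ Finset.univ.filter (fun F : Finset (Fin T) => F.card ≤ D), Fintype.card A ^ D := by
        refine Finset.sum_le_sum fun F hF => ?_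
        rw [Fintype.card_piFinset]
        have : ∀ t, (if t ∈ F then Finset.univ else {x t} : Finset A).card =
            if t ∈ F then Fintype.card A else 1 := fun t => by split_ifs <;> simp
        simp only [this, Finset.prod_ite_mem, Finset.univ_inter, Finset.prod_const]
        exact Nat.pow_le_pow_right Fintype.card_pos (by simpa using hF)
    _ ≤ _ := by
        rw [Finset.sum_const, smul_eq_mul]
        gcongr
        refine (Finset.card_filter_le _ _).trans ?_
        simp

/-- The Gilbert–Varshamov bound. -/
lemma exists_code (A : Type) [Fintype A] [DecidableEq A] [Nonempty A] (T D : ℕ) :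
    ∃ (n : ℕ) (c : Fin n → Fin T → A), 0 < n ∧ n ≤ Fintype.card A ^ T ∧
      Fintype.card A ^ T ≤ 2 ^ T * Fintype.card A ^ D * n ∧
      ∀ x y, x ≠ y → D ≤ hammingDist (c x) (c y) := by
  -- In a code of maximal size the balls of radius `D` around the codewords cover all words;
  -- otherwise an uncovered word could be added.
  let codes : Finset (Finset (Fin T → A)) := Finset.univ.filter fun X =>
    ∀ x ∈ X, ∀ y ∈ X, x ≠ y → D ≤ hammingDist x y
  obtain ⟨X, hX, hmax⟩ := codes.exists_max_image Finset.card ⟨∅, by simp [codes]⟩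
  have hXd : ∀ x ∈ X, ∀ y ∈ X, x ≠ y → D ≤ hammingDist x y := by simpa [codes] using hX
  have hcov : (Finset.univ : Finset (Fin T → A)) ⊆ X.biUnion fun x =>
      Finset.univ.filter fun y => hammingDist y x ≤ D := by
    intro y _
    by_contra hy
    have hy' : ∀ x ∈ X, D < hammingDist y x := by simpa using hy
    have hyX : y ∉ X := fun h => by simpa using hy' y h
    have hins : insert y X ∈ codes := by
      simp only [codes, Finset.mem_filter, Finset.mem_univ, true_and]
      intro a ha b hb hab
      rcases Finset.mem_insert.1 ha with ha | ha <;> rcases Finset.mem_insert.1 hb with hb | hb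
      · exact absurd (ha.trans hb.symm) hab
      · rw [ha]; exact (hy' b hb).le
      · rw [hb, hammingDist_comm]; exact (hy' a ha).le
      · exact hXd a ha b hb hab
    have := hmax _ hins
    rw [Finset.card_insert_of_notMem hyX] at this
    omega
  have hcard : Fintype.card A ^ T ≤ 2 ^ T * Fintype.card A ^ D * X.card := by
    have h1 := (Finset.card_le_card hcov).trans Finset.card_biUnion_le
    have h2 := h1.trans (Finset.sum_le_sum fun x _ => card_hammingBall_le T D x)
    simpa [mul_comm] using h2
  refine ⟨X.card, fun n => (X.equivFin.symm n).1, ?_, ?_, hcard, fun x y hxy => ?_⟩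
  · rcases Nat.eq_zero_or_pos X.card with h | h
    · rw [h, mul_zero] at hcard
      have : 0 < Fintype.card A ^ T := pow_pos Fintype.card_pos _
      omega
    · exact h
  · simpa using Finset.card_le_univ X
  · exact hXd _ (X.equivFin.symm x).2 _ (X.equivFin.symm y).2 fun h =>
      hxy (X.equivFin.symm.injective (Subtype.ext h))

end Code

/-- Decoding a code of minimum distance at least `2 τ`, with fewer than `τ` errors. -/
lemma exists_decode {A : Type} [DecidableEq A] {n T τ : ℕ} (hn : 0 < n) (c : Fin n → Fin T → A)
    (hc : ∀ x y, x ≠ y → 2 * τ ≤ hammingDist (c x) (c y)) :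
    ∃ dec : (Fin T → A) → Fin n, ∀ a x, hammingDist a (c x) < τ → dec a = x := by
  classical
  refine ⟨fun a => if h : ∃ x, hammingDist a (c x) < τ then h.choose else ⟨0, hn⟩, fun a x hx => ?_⟩
  have h : ∃ x, hammingDist a (c x) < τ := ⟨x, hx⟩
  simp only [dif_pos h]
  by_contra hne
  have h1 := hc _ _ hne
  have h2 := hammingDist_triangle_right (c h.choose) (c x) a
  have h3 := h.choose_spec
  rw [hammingDist_comm (c h.choose) a, hammingDist_comm (c x) a] at h2
  omega

/-! ### Averages over random shifts -/

section

variable {A W : Type} [Fintype A] [Fintype W]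

lemma exists_le_uniformAvg [Nonempty W] (f : W → ℝ≥0∞) : ∃ w, f w ≤ uniformAvg f := by
  obtain ⟨w, -, hw⟩ := Finset.univ.exists_min_image f Finset.univ_nonempty
  refine ⟨w, ?_⟩
  rw [uniformAvg, ENNReal.le_div_iff_mul_le (by simp) (by simp)]
  calc f w * Fintype.card W = ∑ _w' : W, f w := by simp [mul_comm]
    _ ≤ _ := Finset.sum_le_sum fun w' _ => hw w' (Finset.mem_univ _)

lemma uniformAvg_comm (f : A → W → ℝ≥0∞) :
    uniformAvg (fun a => uniformAvg (f a)) = uniformAvg fun w => uniformAvg fun a => f a w := by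
  simp only [uniformAvg, div_eq_mul_inv, ← Finset.sum_mul]
  rw [Finset.sum_comm, mul_right_comm]

lemma uniformAvg_prod {T : ℕ} (h : Fin T → A → ℝ≥0∞) :
    uniformAvg (fun s : Fin T → A => ∏ t, h t (s t)) = ∏ t, uniformAvg (h t) := by
  classical
  simp only [uniformAvg, div_eq_mul_inv, Finset.prod_mul_distrib, Finset.prod_const,
    Finset.prod_univ_sum, Fintype.piFinset_univ, Fintype.card_fun, Finset.card_univ,
    Fintype.card_fin, ENNReal.inv_pow, Nat.cast_pow]

lemma uniformAvg_eval [Nonempty A] {T : ℕ} (t : Fin T) (f : A → ℝ≥0∞) :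
    uniformAvg (fun s : Fin T → A => f (s t)) = uniformAvg f :=
  uniformAvg_comp_fst (Equiv.funSplitAt t A) f

lemma uniformAvg_add_left [AddGroup A] (a : A) (f : A → ℝ≥0∞) :
    uniformAvg (fun s => f (a + s)) = uniformAvg f := by
  simp only [uniformAvg]
  congr 1
  exact Equiv.sum_comp (Equiv.addLeft a) f

lemma uniformAvg_one [Nonempty W] : uniformAvg (fun _ : W => 1) = 1 := by
  simp only [uniformAvg, Finset.sum_const, Finset.card_univ, nsmul_eq_mul, mul_one]
  exact ENNReal.div_self (by simp) (by simp)

/-- Under a uniform shift the letters are independent and uniform, whatever the codeword `a`. -/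
lemma uniformAvg_prod_finset [AddGroup A] {T : ℕ} (F : Finset (Fin T)) (a : Fin T → A)
    (f : A → ℝ≥0∞) :
    uniformAvg (fun s : Fin T → A => ∏ t ∈ F, f (a t + s t)) = uniformAvg f ^ F.card := by
  have h1 : ∀ s : Fin T → A, ∏ t ∈ F, f (a t + s t) =
      ∏ t, (fun t s => if t ∈ F then f (a t + s) else 1) t (s t) := by
    intro s; simp [Finset.prod_ite_mem]
  rw [funext h1, uniformAvg_prod fun t s => if t ∈ F then f (a t + s) else 1]
  have h2 : ∀ t, uniformAvg (fun s => if t ∈ F then f (a t + s) else 1) =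
      if t ∈ F then uniformAvg f else 1 := by
    intro t
    split_ifs
    · exact uniformAvg_add_left _ _
    · exact uniformAvg_one
  simp [h2, Finset.prod_ite_mem]

end


/-! ### Concatenation of an outer code and repetitions of a linear feedback scheme -/

lemma sum_Iio_eq {N : ℕ} (n : Fin N) (f : Fin N → ℝ) :
    ∑ j : Set.Iio n, f j = ∑ j, if j < n then f j else 0 := by
  rw [← Finset.sum_filter]
  exact (Finset.sum_subtype (Finset.univ.filter (· < n)) (by simp) f).symm

/-- Round `n` of repetition `t`, after one idle round. -/
def seg {T N : ℕ} (t : Fin T) (n : Fin N) : Fin (T * N + 1) := (finProdFinEquiv (t, n)).succ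

lemma seg_lt_seg {T N : ℕ} {t : Fin T} {j n : Fin N} : seg t j < seg t n ↔ j < n := by
  rw [Fin.lt_def, Fin.lt_def]
  simp [seg]

lemma sum_seg {M : Type*} [AddCommMonoid M] {T N : ℕ} (f : Fin (T * N + 1) → M) :
    ∑ j, f j = f 0 + ∑ t, ∑ n, f (seg t n) := by
  rw [Fin.sum_univ_succ, ← Equiv.sum_comp finProdFinEquiv, Fintype.sum_prod_type]
  rfl

lemma eq_zero_or_exists_seg {T N : ℕ} (j : Fin (T * N + 1)) : j = 0 ∨ ∃ t n, j = seg t n := by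
  refine Fin.cases (Or.inl rfl) (fun q => Or.inr ?_) j
  exact ⟨(finProdFinEquiv.symm q).1, (finProdFinEquiv.symm q).2, by
    rw [seg, Prod.mk.eta, Equiv.apply_symm_apply]⟩

namespace LFC

/-- One idle round followed by `T` repetitions of `S`, the messages of the repetitions being encoded
by `enc`. -/
abbrev concat (S : LFC) {T : ℕ} (Mo : Fin 2 → ℕ) (hMo : ∀ i, 0 < Mo i)
    (enc : (∀ i, Fin (Mo i)) → Fin T → ∀ i, Fin (S.M i)) : LFC where
  N := T * S.N + 1
  M := Mo
  M_pos := hMo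
  codebook := Fin.cases (fun _ => 0) fun q w =>
    S.codebook (finProdFinEquiv.symm q).2 (enc w (finProdFinEquiv.symm q).1)
  coef i := Fin.cases (fun _ => 0) fun q => Fin.cases 0 fun q' =>
    if (finProdFinEquiv.symm q).1 = (finProdFinEquiv.symm q').1 then
      S.coef i (finProdFinEquiv.symm q).2 (finProdFinEquiv.symm q').2 else 0

variable {S : LFC} {T : ℕ} {Mo : Fin 2 → ℕ} {hMo : ∀ i, 0 < Mo i}
  {enc : (∀ i, Fin (Mo i)) → Fin T → ∀ i, Fin (S.M i)}

lemma concat_codebook_seg (t : Fin T) (n : Fin S.N) (w : ∀ i, Fin (Mo i)) :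
    (S.concat Mo hMo enc).codebook (seg t n) w = S.codebook n (enc w t) := by
  simp only [seg, Fin.cases_succ, Equiv.symm_apply_apply]

lemma concat_coef_seg (i : Fin 2) (t t' : Fin T) (n n' : Fin S.N) :
    (S.concat Mo hMo enc).coef i (seg t n) (seg t' n') = if t = t' then S.coef i n n' else 0 := by
  simp only [seg, Fin.cases_succ, Equiv.symm_apply_apply]

lemma concat_coef_zero (i : Fin 2) (t : Fin T) (n : Fin S.N) :
    (S.concat Mo hMo enc).coef i (seg t n) (0 : Fin (T * S.N + 1)) = 0 := by
  simp only [seg, Fin.cases_succ, Fin.cases_zero]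

/-- The modulo-lattice scheme has no feedback noise in its first round, so the noise covariance
there is not that of the equivalent channel. Idling in that round, and ignoring its output, makes
the mismatch harmless and saves one round of power. -/
lemma concat_input_zero (w : ∀ i, Fin (Mo i)) (z : Fin (T * S.N + 1) → NoisePair) :
    (S.concat Mo hMo enc).input w z (0 : Fin (T * S.N + 1)) = 0 := by
  rw [input_eq]
  have : IsEmpty (Set.Iio (0 : Fin (T * S.N + 1))) := ⟨fun j => by simpa using j.2⟩
  change 0 - ∑ i : Fin 2, ∑ j : Set.Iio (0 : Fin (T * S.N + 1)), _ = (0 : ℝ)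
  simp

/-- The coefficients are block diagonal over the repetitions, so the repetitions do not interact. -/
lemma concat_input_seg (w : ∀ i, Fin (Mo i)) (z : Fin (T * S.N + 1) → NoisePair) (t : Fin T)
    (n : Fin S.N) :
    (S.concat Mo hMo enc).input w z (seg t n) = S.input (enc w t) (fun n => z (seg t n)) n := by
  induction n using WellFoundedLT.induction with
  | ind n ih =>
    have ho : ∀ j < n, ∀ i, (S.concat Mo hMo enc).output w z i (seg t j) =
        S.output (enc w t) (fun n => z (seg t n)) i j := fun j hj i => by
      rw [output, output, ih j hj]
    rw [input_eq, input_eq, concat_codebook_seg]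
    congr 1
    refine Finset.sum_congr rfl fun i _ => ?_
    refine (sum_Iio_eq (N := T * S.N + 1) (seg t n) fun j => (S.concat Mo hMo enc).coef i (seg t n) j *
      (S.concat Mo hMo enc).output w z i j).trans ?_
    rw [sum_Iio_eq n fun j => S.coef i n j * S.output (enc w t) (fun n => z (seg t n)) i j, sum_seg,
      concat_coef_zero, zero_mul, ite_self, zero_add, Finset.sum_eq_single t]
    · refine Finset.sum_congr rfl fun j _ => ?_
      by_cases hj : j < n
      · rw [if_pos hj, if_pos (seg_lt_seg.2 hj), ho j hj, concat_coef_seg, if_pos rfl]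
      · rw [if_neg hj, if_neg fun h => hj (seg_lt_seg.1 h)]
    · intro t' _ ht'
      refine Finset.sum_eq_zero fun j _ => ?_
      rw [concat_coef_seg, if_neg ht'.symm, zero_mul, ite_self]
    · simp

lemma concat_output_seg (w : ∀ i, Fin (Mo i)) (z : Fin (T * S.N + 1) → NoisePair) (i : Fin 2)
    (t : Fin T) (n : Fin S.N) :
    (S.concat Mo hMo enc).output w z i (seg t n) =
      S.output (enc w t) (fun n => z (seg t n)) i n := by
  rw [output, output, concat_input_seg]

lemma concat_noiseResponse_zero (z : Fin (T * S.N + 1) → NoisePair) :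
    (S.concat Mo hMo enc).noiseResponse z (0 : Fin (T * S.N + 1)) = 0 := by
  let w : ∀ i, Fin (Mo i) := fun i => ⟨0, hMo i⟩
  have h1 := input_eq_codebookBar_add (S := S.concat Mo hMo enc) w z (0 : Fin (T * S.N + 1))
  rw [codebookBar, concat_input_zero, concat_input_zero] at h1
  linarith

lemma concat_noiseResponse_seg (z : Fin (T * S.N + 1) → NoisePair) (t : Fin T) (n : Fin S.N) :
    (S.concat Mo hMo enc).noiseResponse z (seg t n) = S.noiseResponse (fun n => z (seg t n)) n := by
  let w : ∀ i, Fin (Mo i) := fun i => ⟨0, hMo i⟩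
  have h1 := input_eq_codebookBar_add (S := S.concat Mo hMo enc) w z (seg t n)
  have h2 := input_eq_codebookBar_add (enc w t) (fun n => z (seg t n)) n
  rw [codebookBar, concat_input_seg, concat_input_seg] at h1
  rw [codebookBar] at h2
  have h3 : (fun n => (0 : Fin (T * S.N + 1) → NoisePair) (seg t n)) = (0 : Fin S.N → NoisePair) := rfl
  rw [h3] at h1
  linarith

end LFC

lemma bcNoise_eq_effLaw (N : ℕ) (K : Matrix (Fin 2) (Fin 2) ℝ) : bcNoise N K = effLaw N K K := by
  simp [bcNoise, effLaw]

/-- The noises of the repetitions are independent. -/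
lemma measurePreserving_seg (T N : ℕ) (K K' : Matrix (Fin 2) (Fin 2) ℝ) :
    MeasurePreserving (fun (z : Fin (T * N + 1) → NoisePair) (t : Fin T) (n : Fin N) => z (seg t n))
      (effLaw (T * N + 1) K K') (Measure.pi fun _ => bcNoise N K') := by
  have h1 := measurePreserving_piFinSuccAbove (fun n : Fin (T * N + 1) =>
    multivariateGaussian (0 : NoisePair) (if n.val = 0 then K else K')) 0
  have h2 : MeasurePreserving (fun (z : Fin (T * N + 1) → NoisePair) q => z (Fin.succ q))
      (effLaw (T * N + 1) K K') (Measure.pi fun _ : Fin (T * N) => multivariateGaussian 0 K') := by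
    have h3 := measurePreserving_snd.comp h1
    simp only [Fin.succAbove_zero, Fin.val_succ, Nat.add_eq_zero_iff, one_ne_zero, and_false,
      if_false] at h3
    exact h3
  exact (measurePreserving_pi_curry _).comp
    ((measurePreserving_pi_comp_equiv (finProdFinEquiv : Fin T × Fin N ≃ _) _).comp h2)

/-! ### Power and error probability of the concatenated scheme -/

namespace LFC

variable {S : LFC} {K K' : Matrix (Fin 2) (Fin 2) ℝ} {Q : ℝ}

/-- The power in each round is that of `Θ̄` plus that of the response. Constant transmission power
is thus what bounds the vector to be reduced in every single round. -/
lemma lintegral_noiseResponse_sq_le (hK' : K'.PosSemidef) (hS : S.HasConstantPower K' Q)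
    (n : Fin S.N) :
    ∫⁻ z, ENNReal.ofReal (S.noiseResponse z n ^ 2) ∂bcNoise S.N K' ≤ ENNReal.ofReal Q := by
  have : ∀ i, NeZero (S.M i) := fun i => ⟨(S.M_pos i).ne'⟩
  rw [← hS n, bcNoise_eq_effLaw]
  simp only [meanPower, lintegral_input_sq hK' hK']
  rw [uniformAvg_add]
  refine le_add_left (le_of_eq ?_)
  set c := ∫⁻ z, ENNReal.ofReal (S.noiseResponse z n ^ 2) ∂effLaw S.N K' K'
  have h1 := uniformAvg_const_mul (W := ∀ i, Fin (S.M i)) c fun _ => 1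
  rw [uniformAvg_one, mul_one] at h1
  exact h1.symm

variable {T : ℕ} {Mo : Fin 2 → ℕ} {hMo : ∀ i, 0 < Mo i}
  {enc : (∀ i, Fin (Mo i)) → Fin T → ∀ i, Fin (S.M i)}

lemma lintegral_concat_noiseResponse_sq_le (hK' : K'.PosSemidef) (hS : S.HasConstantPower K' Q)
    (n : Fin (S.concat Mo hMo enc).N) :
    ∫⁻ z, ENNReal.ofReal ((S.concat Mo hMo enc).noiseResponse z n ^ 2)
      ∂effLaw (S.concat Mo hMo enc).N K K' ≤ ENNReal.ofReal Q := by
  obtain rfl | ⟨t, n, rfl⟩ := eq_zero_or_exists_seg n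
  · simp [concat_noiseResponse_zero]
  · simp only [concat_noiseResponse_seg]
    have h1 := (measurePreserving_eval (fun _ : Fin T => bcNoise S.N K') t).comp
      (measurePreserving_seg T S.N K K')
    refine le_trans (le_of_eq ?_) (lintegral_noiseResponse_sq_le hK' hS n)
    exact h1.lintegral_comp (f := fun z => ENNReal.ofReal (S.noiseResponse z n ^ 2))
      ((measurable_noiseResponse n).pow_const 2).ennreal_ofReal

lemma lintegral_concat_input_sq (w : ∀ i, Fin (Mo i)) (t : Fin T) (n : Fin S.N) :
    ∫⁻ z, ENNReal.ofReal ((S.concat Mo hMo enc).input w z (seg t n) ^ 2)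
      ∂effLaw (S.concat Mo hMo enc).N K K' =
    ∫⁻ z, ENNReal.ofReal (S.input (enc w t) z n ^ 2) ∂bcNoise S.N K' := by
  simp only [concat_input_seg]
  have h1 := (measurePreserving_eval (fun _ : Fin T => bcNoise S.N K') t).comp
      (measurePreserving_seg T S.N K K')
  exact h1.lintegral_comp (f := fun z => ENNReal.ofReal (S.input (enc w t) z n ^ 2))
      ((measurable_input _ n).pow_const 2).ennreal_ofReal

/-- The event that an inner decoder errs. -/
def errorEvent (S : LFC) (g : (i : Fin 2) → (Fin S.N → ℝ) → Fin (S.M i)) (a : ∀ i, Fin (S.M i)) :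
    Set (Fin S.N → NoisePair) := {z | ∃ i, g i (S.output a z i) ≠ a i}

lemma measurableSet_errorEvent {g : (i : Fin 2) → (Fin S.N → ℝ) → Fin (S.M i)}
    (hg : ∀ i a, MeasurableSet (g i ⁻¹' {a})) (a : ∀ i, Fin (S.M i)) :
    MeasurableSet (S.errorEvent g a) := by
  have : S.errorEvent g a = ⋃ i, ((fun z => S.output a z i) ⁻¹' (g i ⁻¹' {a i}))ᶜ := by
    ext z; simp [errorEvent]
  rw [this]
  exact MeasurableSet.iUnion fun i => (LFC.measurable_output a i (hg i _)).compl

/-- With an outer code correcting fewer than `τ` errors, decoding fails only if the inner decoders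
err in `τ` repetitions. -/
lemma exists_concat_decoder {g : (i : Fin 2) → (Fin S.N → ℝ) → Fin (S.M i)}
    (hg : ∀ i a, MeasurableSet (g i ⁻¹' {a})) (c : (i : Fin 2) → Fin (Mo i) → Fin T → Fin (S.M i))
    (henc : ∀ w t i, enc w t i = c i (w i) t) {τ : ℕ}
    (hc : ∀ i x y, x ≠ y → 2 * τ ≤ hammingDist (c i x) (c i y)) :
    ∃ G : (i : Fin 2) → (Fin (S.concat Mo hMo enc).N → ℝ) → Fin ((S.concat Mo hMo enc).M i),
      (∀ i a, MeasurableSet (G i ⁻¹' {a})) ∧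
      ∀ w : ∀ i, Fin (Mo i), effLaw (S.concat Mo hMo enc).N K K'
        ((S.concat Mo hMo enc).errorEvent G w) ≤
        ∑ F ∈ (Finset.univ : Finset (Fin T)).powersetCard τ,
          ∏ t ∈ F, bcNoise S.N K' (S.errorEvent g (enc w t)) := by
  choose dec hdec using fun i => exists_decode (hMo i) (c i) (hc i)
  have hgm : ∀ i, Measurable (g i) := fun i => measurable_to_countable' (hg i)
  refine ⟨fun i y => dec i fun t => g i fun n => y (seg t n), fun i a => ?_, fun w => ?_⟩
  · have h1 : Measurable fun (y : Fin (T * S.N + 1) → ℝ) (t : Fin T) => g i fun n => y (seg t n) :=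
      measurable_pi_lambda _ fun t => (hgm i).comp (by fun_prop)
    exact h1 ((Set.toFinite (dec i ⁻¹' {a})).measurableSet)
  · have hsub : (S.concat Mo hMo enc).errorEvent
        (fun i (y : Fin (T * S.N + 1) → ℝ) => dec i fun t => g i fun n => y (seg t n)) w ⊆
        (fun (z : Fin (T * S.N + 1) → NoisePair) (t : Fin T) (n : Fin S.N) => z (seg t n)) ⁻¹'
        ⋃ F ∈ (Finset.univ : Finset (Fin T)).powersetCard τ,
          Set.univ.pi fun t => if t ∈ F then S.errorEvent g (enc w t) else Set.univ := by
      rintro z ⟨i, hi⟩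
      -- A failure forces at least `τ` wrong inner decisions. Fixing exactly `τ` of these
      -- repetitions turns the event into a union of product sets, on which independence gives
      -- products.
      have h1 : τ ≤ hammingDist (fun t => g i fun n => (S.concat Mo hMo enc).output w z i (seg t n))
          (c i (w i)) := by
        by_contra h
        exact hi (hdec i _ _ (not_le.1 h))
      obtain ⟨F, hF, hFc⟩ := Finset.exists_subset_card_eq h1
      refine Set.mem_iUnion₂.2 ⟨F, Finset.mem_powersetCard.2 ⟨Finset.subset_univ _, hFc⟩, ?_⟩
      intro t _
      change (fun n => z (seg t n)) ∈ (if t ∈ F then S.errorEvent g (enc w t) else Set.univ)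
      split_ifs with ht
      · have h2 := (Finset.mem_filter.1 (hF ht)).2
        refine ⟨i, ?_⟩
        simp only [concat_output_seg] at h2
        rw [henc]
        exact h2
      · trivial
    refine (measure_mono hsub).trans ?_
    have hE := fun w t => measurableSet_errorEvent hg (enc w t)
    have hmeas : ∀ F : Finset (Fin T), MeasurableSet
        (Set.univ.pi fun t => if t ∈ F then S.errorEvent g (enc w t) else Set.univ) := fun F =>
      MeasurableSet.univ_pi fun t => by split_ifs; exacts [hE w t, MeasurableSet.univ]
    refine ((measurePreserving_seg T S.N K K').measure_preimage
      (Finset.measurableSet_biUnion _ fun F _ => hmeas F).nullMeasurableSet).le.trans ?_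
    refine (measure_biUnion_finset_le _ _).trans (Finset.sum_le_sum fun F _ => ?_)
    rw [Measure.pi_pi]
    refine le_of_eq ?_
    have h3 : ∀ t, bcNoise S.N K' (if t ∈ F then S.errorEvent g (enc w t) else Set.univ) =
        if t ∈ F then bcNoise S.N K' (S.errorEvent g (enc w t)) else 1 := fun t => by
      split_ifs <;> simp
    simp [h3, Finset.prod_ite_mem]

/-- Existence of a concatenated scheme with a good trade-off between error probability and power. -/
lemma exists_concat (hK' : K'.PosSemidef) (hS : S.HasConstantPower K' Q)
    {g : (i : Fin 2) → (Fin S.N → ℝ) → Fin (S.M i)} (hg : ∀ i a, MeasurableSet (g i ⁻¹' {a}))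
    {ε : ℝ≥0∞} (hε : uniformAvg (fun a => bcNoise S.N K' (S.errorEvent g a)) ≤ ε) (K)
    (T τ : ℕ) (A : ℝ≥0∞) :
    ∃ (D : LFC) (G : (i : Fin 2) → (Fin D.N → ℝ) → Fin (D.M i)), D.N = T * S.N + 1 ∧
      (∀ i, D.M i ≤ S.M i ^ T ∧ S.M i ^ T ≤ 2 ^ T * S.M i ^ (2 * τ) * D.M i) ∧
      (∀ i a, MeasurableSet (G i ⁻¹' {a})) ∧
      (∀ n, ∫⁻ z, ENNReal.ofReal (D.noiseResponse z n ^ 2) ∂effLaw D.N K K' ≤ ENNReal.ofReal Q) ∧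
      A * uniformAvg (fun w => effLaw D.N K K' (D.errorEvent G w)) +
        ∑ n, meanPower (W := fun i => Fin (D.M i)) (effLaw D.N K K') (fun w z => D.input w z n) ≤
        A * (2 ^ T * ε ^ τ) + T * (S.N * ENNReal.ofReal Q) := by
  have hne : ∀ i, NeZero (S.M i) := fun i => ⟨(S.M_pos i).ne'⟩
  choose Mo c hMo hMo1 hMo2 hc using fun i => exists_code (Fin (S.M i)) T (2 * τ)
  simp only [Fintype.card_fin] at hMo1 hMo2
  -- The shift `s` keeps all Hamming distances, and averaging over it makes the pair of messages of
  -- each repetition uniform.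
  let enc : (Fin T → ∀ i, Fin (S.M i)) → (∀ i, Fin (Mo i)) → Fin T → ∀ i, Fin (S.M i) :=
    fun s w t i => c i (w i) t + s t i
  have hdist : ∀ (s : Fin T → ∀ i, Fin (S.M i)) i x y, x ≠ y →
      2 * τ ≤ hammingDist (fun t => c i x t + s t i) (fun t => c i y t + s t i) := by
    intro s i x y hxy
    rw [hammingDist_comp (fun t a => a + s t i) fun t => add_left_injective (s t i)]
    exact hc i x y hxy
  choose G hG hGe using fun s => exists_concat_decoder (K := K) (K' := K') (hMo := hMo)
    (enc := enc s) hg (fun i x t => c i x t + s t i) (fun _ _ _ => rfl) (hdist s)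
  -- A single objective is minimised over the shifts, so that one `s` serves both error and power; a
  -- large weight `A` will force the error down at little cost in power.
  obtain ⟨s, hs⟩ := exists_le_uniformAvg fun s : Fin T → ∀ i, Fin (S.M i) =>
    A * uniformAvg (fun w => effLaw _ K K' ((S.concat Mo hMo (enc s)).errorEvent (G s) w)) +
      ∑ n, meanPower (W := fun i => Fin (Mo i)) (effLaw (T * S.N + 1) K K')
        (fun w z => (S.concat Mo hMo (enc s)).input w z n)
  refine ⟨S.concat Mo hMo (enc s), G s, rfl, fun i => ⟨hMo1 i, hMo2 i⟩, hG s,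
    fun n => lintegral_concat_noiseResponse_sq_le hK' hS n, hs.trans ?_⟩
  rw [uniformAvg_add, uniformAvg_const_mul]
  have hshift : ∀ (w : ∀ i, Fin (Mo i)) (s : Fin T → ∀ i, Fin (S.M i)) t,
      enc s w t = (fun i => c i (w i) t) + s t := fun w s t => rfl
  refine add_le_add (mul_le_mul_right ?_ A) ?_
  · refine (uniformAvg_comm fun s (w : ∀ i, Fin (Mo i)) => effLaw (T * S.N + 1) K K'
      ((S.concat Mo hMo (enc s)).errorEvent (G s) w)).le.trans ?_
    refine (uniformAvg_mono fun w => (uniformAvg_mono fun s => hGe s w).trans ?_).trans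
      (uniformAvg_const_le _)
    rw [uniformAvg_sum]
    have h1 : ∀ F ∈ (Finset.univ : Finset (Fin T)).powersetCard τ,
        uniformAvg (fun s => ∏ t ∈ F, bcNoise S.N K' (S.errorEvent g (enc s w t))) ≤ ε ^ τ := by
      intro F hF
      simp only [hshift]
      rw [uniformAvg_prod_finset F (fun t i => c i (w i) t) fun a =>
        bcNoise S.N K' (S.errorEvent g a), (Finset.mem_powersetCard.1 hF).2]
      gcongr
    refine (Finset.sum_le_sum h1).trans ?_
    rw [Finset.sum_const, nsmul_eq_mul, Finset.card_powersetCard, Finset.card_univ,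
      Fintype.card_fin]
    gcongr
    exact_mod_cast Nat.choose_le_two_pow T τ
  · refine (uniformAvg_sum Finset.univ fun (n : Fin (T * S.N + 1)) s => meanPower (W := fun i => Fin (Mo i))
      (effLaw (T * S.N + 1) K K')
      (fun w z => (S.concat Mo hMo (enc s)).input w z n)).le.trans ?_
    rw [sum_seg]
    have h0 : uniformAvg (fun s => meanPower (W := fun i => Fin (Mo i)) (effLaw (T * S.N + 1) K K')
        (fun w z => (S.concat Mo hMo (enc s)).input w z (0 : Fin (T * S.N + 1)))) = 0 := by
      simp [concat_input_zero, meanPower, uniformAvg]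
    have h1 : ∀ (t : Fin T) (n : Fin S.N), uniformAvg (fun s => meanPower (W := fun i => Fin (Mo i))
        (effLaw (T * S.N + 1) K K')
        (fun w z => (S.concat Mo hMo (enc s)).input w z (seg t n))) ≤ ENNReal.ofReal Q := by
      intro t n
      simp only [meanPower]
      rw [uniformAvg_comm]
      refine (uniformAvg_mono fun w => le_of_eq ?_).trans (uniformAvg_const_le _)
      have h2 := fun s => lintegral_concat_input_sq (K := K) (K' := K') (hMo := hMo) (enc := enc s)
        w t n
      refine (congrArg uniformAvg (funext h2)).trans ?_
      simp only [hshift]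
      rw [uniformAvg_eval t fun a => ∫⁻ z, ENNReal.ofReal
        (S.input ((fun i => c i (w i) t) + a) z n ^ 2) ∂bcNoise S.N K',
        uniformAvg_add_left (fun i => c i (w i) t) fun a => ∫⁻ z, ENNReal.ofReal
        (S.input a z n ^ 2) ∂bcNoise S.N K', ← hS n]
      rfl
    rw [h0, zero_add]
    refine (Finset.sum_le_sum fun t _ => Finset.sum_le_sum fun n _ => h1 t n).trans (le_of_eq ?_)
    simp

end LFC


/-! ### Choice of the parameters -/

lemma posSemidef_noiseCov {σ₁ σ₂ r : ℝ} (hr : |r| ≤ 1) : (noiseCov σ₁ σ₂ r).PosSemidef := by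
  refine Matrix.PosSemidef.of_dotProduct_mulVec_nonneg ?_ fun x => ?_
  · ext i j; fin_cases i <;> fin_cases j <;> rfl
  · have h1 : 0 ≤ 1 - r ^ 2 := by
      have := (sq_le_one_iff_abs_le_one r).2 hr
      linarith
    have h2 : 0 ≤ (σ₁ * x 0 + r * σ₂ * x 1) ^ 2 + (1 - r ^ 2) * (σ₂ * x 1) ^ 2 := by positivity
    refine h2.trans (le_of_eq ?_)
    simp [noiseCov, Matrix.mulVec, dotProduct, Fin.sum_univ_two]
    ring

lemma posSemidef_add_smul_one {K : Matrix (Fin 2) (Fin 2) ℝ} (hK : K.PosSemidef) {c : ℝ}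
    (hc : 0 ≤ c) : (K + c • !![1, 1; 1, 1]).PosSemidef := by
  refine hK.add (Matrix.PosSemidef.smul ?_ hc)
  refine Matrix.PosSemidef.of_dotProduct_mulVec_nonneg ?_ fun x => ?_
  · ext i j; fin_cases i <;> fin_cases j <;> rfl
  · simp [Matrix.mulVec, dotProduct, Fin.sum_univ_two]
    nlinarith [sq_nonneg (x 0 + x 1)]

lemma tendsto_pow_mul_exp_neg_div (k : ℕ) :
    Tendsto (fun m : ℕ => (m : ℝ) ^ k * Real.exp (-(m / 128))) atTop (𝓝 0) := by
  have h1 := (Real.tendsto_pow_mul_exp_neg_atTop_nhds_zero k).comp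
    ((tendsto_natCast_atTop_atTop (R := ℝ)).atTop_div_const (show (0 : ℝ) < 128 by norm_num))
  have h2 := h1.const_mul (128 ^ k : ℝ)
  rw [mul_zero] at h2
  refine h2.congr fun m => ?_
  simp only [Function.comp_apply]
  rw [← mul_assoc, ← mul_pow, mul_div_cancel₀ _ (by norm_num)]

/-- A bound on the probability of aliasing. -/
def aliasBound (m : ℕ) : ℝ := 6 * (m + 1) * Real.exp (-(m / 128))

lemma aliasBound_nonneg (m : ℕ) : 0 ≤ aliasBound m := by unfold aliasBound; positivity

lemma aliasBound_le {m : ℕ} (hm : 1 ≤ m) (k : ℕ) :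
    (m : ℝ) ^ k * aliasBound m ≤ 12 * ((m : ℝ) ^ (k + 1) * Real.exp (-(m / 128))) := by
  have hm' : (1 : ℝ) ≤ m := by exact_mod_cast hm
  have h1 : aliasBound m ≤ 12 * m * Real.exp (-(m / 128)) := by
    unfold aliasBound
    refine mul_le_mul_of_nonneg_right ?_ (Real.exp_pos _).le
    linarith
  calc (m : ℝ) ^ k * aliasBound m ≤ (m : ℝ) ^ k * (12 * m * Real.exp (-(m / 128))) := by gcongr
    _ = _ := by ring

lemma eventually_pow_mul_aliasBound_le (k : ℕ) {c : ℝ} (hc : 0 < c) :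
    ∀ᶠ m : ℕ in atTop, (m : ℝ) ^ k * aliasBound m ≤ c := by
  have h := (tendsto_pow_mul_exp_neg_div (k + 1)).const_mul 12
  rw [mul_zero] at h
  filter_upwards [h.eventually_le_const hc, eventually_ge_atTop 1] with m h1 h2
  exact (aliasBound_le h2 k).trans h1

lemma MLLFC.rate_eq (C : MLLFC) (i : Fin 2) :
    C.toScheme.rate i = Real.logb 2 (C.lfc.M i) / C.lfc.N := by
  have hL : (C.L : ℝ) ≠ 0 := by exact_mod_cast C.L_pos.ne'
  rw [InteractiveScheme.rate]
  simp only [Fintype.card_fun, Fintype.card_prod, Fintype.card_fin, Nat.cast_pow, Real.logb_pow,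
    len, Nat.cast_mul, Nat.cast_ofNat]
  rcases eq_or_ne (C.lfc.N : ℝ) 0 with h | h
  · simp [h]
  · field_simp

/-- From a linear feedback scheme with some spare power to a modulo-lattice scheme. -/
lemma exists_mllfc {P Pt vt : ℝ} {K K' : Matrix (Fin 2) (Fin 2) ℝ} (hP : 0 < P) (hvt : 0 < vt)
    (hPt : vt < Pt) (hK : K.PosSemidef) (hK' : K' = K + (vt * (P / Pt)) • !![1, 1; 1, 1]) :
    ∀ᶠ m : ℕ in atTop, ∀ (D : LFC) (G : (i : Fin 2) → (Fin D.N → ℝ) → Fin (D.M i)), D.N = m + 1 →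
      (∀ i a, MeasurableSet (G i ⁻¹' {a})) →
      (∀ n, ∫⁻ z, ENNReal.ofReal (D.noiseResponse z n ^ 2) ∂effLaw D.N K K' ≤
        ENNReal.ofReal (P * (1 - vt / Pt))) →
      ∑ n, meanPower (W := fun i => Fin (D.M i)) (effLaw D.N K K') (fun w z => D.input w z n) ≤
        ENNReal.ofReal (P / 4 + m * (P * (1 - vt / Pt))) →
      ∃ C : MLLFC, C.toScheme.SatisfiesPower K vt P Pt ∧ m ≤ C.len ∧
        (∀ i, C.toScheme.rate i = Real.logb 2 (D.M i) / (m + 1)) ∧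
        C.toScheme.errorProb K vt ≤ ENNReal.ofReal (aliasBound m) +
          2 * ((m ^ 4 : ℕ) * uniformAvg fun w => effLaw D.N K K' (D.errorEvent G w)) := by
  obtain ⟨m₀, hm₀⟩ := exists_good_modLattice
  have hPt0 : 0 < Pt := hvt.trans hPt
  filter_upwards [eventually_ge_atTop m₀, eventually_ge_atTop 1,
    eventually_pow_mul_aliasBound_le 17 (show (0 : ℝ) < 1 / 400 by norm_num)] with
    m hm hm1 halias D G hN hG hresp hpow
  obtain ⟨Λ, hΛ1, hΛ2, hΛ3⟩ := hm₀ m hm (m ^ 4) rfl Pt hPt0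
  have hm1' : (1 : ℝ) ≤ m := by exact_mod_cast hm1
  have hm0 : (0 : ℝ) < m := by linarith
  have hγ : 0 < √(Pt / P) := Real.sqrt_pos.2 (by positivity)
  -- With `γ² = Pt / P` the added noise has variance `vt P / Pt`, as in `K'`, and the vector to be
  -- reduced has variance at most `γ² P (1 - vt / Pt) + vt = Pt`.
  let C : MLLFC := ⟨D, m ^ 4, by positivity, Λ, fun _ => √(Pt / P), fun _ => hγ⟩
  have hC : C.lfc.N = m + 1 := hN
  have hγ2 : (√(Pt / P)) ^ 2 = Pt / P := Real.sq_sqrt (by positivity)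
  have hg : ∀ n, (C.γ n)⁻¹ ^ 2 = P / Pt := fun n => by
    change (√(Pt / P))⁻¹ ^ 2 = _
    rw [inv_pow, hγ2, inv_div]
  have hQ : 0 ≤ P * (1 - vt / Pt) := by
    have : vt / Pt ≤ 1 := (div_le_one hPt0).2 hPt.le
    exact mul_nonneg hP.le (by linarith)
  have hK'' : ∀ n : Fin C.lfc.N, n.val ≠ 0 → K' = K + (vt * (C.γ n)⁻¹ ^ 2) • !![1, 1; 1, 1] :=
    fun n _ => by rw [hg, hK']
  have hV : ∀ n, C.γ n ^ 2 * (P * (1 - vt / Pt)) + vt ≤ Pt := fun n => by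
    change (√(Pt / P)) ^ 2 * _ + _ ≤ _
    rw [hγ2]
    refine le_of_eq ?_
    field_simp
    ring
  have ha := aliasBound_nonneg m
  have hA : ((bcNoise C.len K).prod (macNoise C.len vt)) C.aliasing ≤
      ENNReal.ofReal (aliasBound m) := by
    refine (MLLFC.measure_aliasing_le hK hvt.le hK'' hQ hresp hV hΛ2).trans (le_of_eq ?_)
    rw [hC, aliasBound, show 6 * ((m : ℝ) + 1) * Real.exp (-(m / 128)) =
      2 * ((m + 1 : ℕ) : ℝ) * (3 * Real.exp (-(m / 128))) by push_cast; ring]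
    generalize 3 * Real.exp (-(m / 128 : ℝ)) = p
    rw [ENNReal.ofReal_mul (by positivity), ENNReal.ofReal_mul (by norm_num),
      ENNReal.ofReal_natCast, ENNReal.ofReal_ofNat]
  refine ⟨C, ⟨?_, fun i => ?_⟩, ?_, fun i => ?_, ?_⟩
  · refine (MLLFC.sum_meanPower_input_le hK (hK' ▸ posSemidef_add_smul_one hK (by positivity))
      hvt.le hg hK' hΛ3).trans ?_
    have hpow' : ∑ n, meanPower (W := fun i => Fin (C.lfc.M i)) (effLaw C.lfc.N K K')
        (fun w z => C.lfc.input w z n) ≤ _ := hpow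
    calc _ ≤ 2 * ((m ^ 4 : ℕ) * ((1 + 2 * ENNReal.ofReal (aliasBound m)) *
          ENNReal.ofReal (P / 4 + m * (P * (1 - vt / Pt))) +
          (m * ENNReal.ofReal (P / Pt * vt) + (m + 1 : ℕ) * (ENNReal.ofReal (aliasBound m) *
            ENNReal.ofReal (2 * (P / Pt) * (32 * Pt * m ^ 16)))))) := by
          have hC1 : C.lfc.N - 1 = m := by rw [hC, Nat.add_sub_cancel]
          have hC2 : (C.lfc.N : ℝ≥0∞) = (m + 1 : ℕ) := by rw [hC]
          rw [hC1, hC2]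
          gcongr
      _ = ENNReal.ofReal (2 * ((m ^ 4 : ℕ) * ((1 + 2 * aliasBound m) *
          (P / 4 + m * (P * (1 - vt / Pt))) + (m * (P / Pt * vt) +
          (m + 1 : ℕ) * (aliasBound m * (2 * (P / Pt) * (32 * Pt * m ^ 16))))))) := by
          have hp : 0 ≤ P / 4 + m * (P * (1 - vt / Pt)) := by positivity
          have hx : 0 ≤ P / Pt * vt := by positivity
          have hy : 0 ≤ 2 * (P / Pt) * (32 * Pt * (m : ℝ) ^ 16) := by positivity
          generalize aliasBound m = a at ha
          generalize P / 4 + m * (P * (1 - vt / Pt)) = p at hp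
          generalize P / Pt * vt = x at hx
          generalize 2 * (P / Pt) * (32 * Pt * (m : ℝ) ^ 16) = y at hy
          rw [ENNReal.ofReal_mul (by positivity), ENNReal.ofReal_mul (by positivity),
            ENNReal.ofReal_add (by positivity) (by positivity),
            ENNReal.ofReal_mul (p := 1 + 2 * a) (by positivity),
            ENNReal.ofReal_add (p := 1) (by positivity) (by positivity),
            ENNReal.ofReal_mul (p := 2) (q := a) (by positivity),
            ENNReal.ofReal_add (p := m * x) (by positivity) (by positivity),
            ENNReal.ofReal_mul (p := m) (by positivity),
            ENNReal.ofReal_mul (p := ((m + 1 : ℕ) : ℝ)) (by positivity),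
            ENNReal.ofReal_mul (p := a) (by positivity)]
          simp only [ENNReal.ofReal_natCast, ENNReal.ofReal_ofNat, ENNReal.ofReal_one]
      _ ≤ _ := by
          refine ENNReal.ofReal_le_ofReal ?_
          have hlen : (C.len : ℝ) = (m + 1) * 2 * (m : ℝ) ^ 4 := by
            change ((C.lfc.N * 2 * m ^ 4 : ℕ) : ℝ) = _
            rw [hC]; push_cast; ring
          rw [hlen]
          have e1 : 2 * (P / Pt) * (32 * Pt * (m : ℝ) ^ 16) = 64 * P * m ^ 16 := by
            field_simp; ring
          have e2 : P * (1 - vt / Pt) = P - P / Pt * vt := by ring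
          have hx : 0 ≤ P / Pt * vt := by positivity
          rw [e1, e2]
          have hp1 : (m : ℝ) ≤ m ^ 17 := le_self_pow₀ hm1' (by norm_num)
          have hb : aliasBound m ≤ 1 / 400 :=
            (le_mul_of_one_le_left ha (one_le_pow₀ hm1')).trans halias
          have hb1 : m * aliasBound m ≤ 1 / 400 :=
            (mul_le_mul_of_nonneg_right hp1 ha).trans halias
          have hb2 : (m : ℝ) ^ 16 * aliasBound m ≤ 1 / 400 :=
            (mul_le_mul_of_nonneg_right (pow_le_pow_right₀ hm1' (by norm_num)) ha).trans halias
          push_cast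
          generalize aliasBound m = a at ha halias hb hb1 hb2
          generalize P / Pt * vt = x at hx
          -- The feedback noise `x` restores `P - x` to `P` in each of the `m` active rounds. The
          -- idle round leaves `P`, of which `P / 4` is spent by `hpow`; the terms in `a` are at
          -- most `130.5 P / 400`. The exponent `17` is the `16` of the covering bound plus one for
          -- the number of rounds.
          have key : (1 + 2 * a) * (P / 4 + m * (P - x)) +
              (m * x + (m + 1) * (a * (64 * P * (m : ℝ) ^ 16))) ≤ (m + 1) * P := by
            have h1 : (1 + 2 * a) * (P / 4 + m * (P - x)) +
              (m * x + (m + 1) * (a * (64 * P * (m : ℝ) ^ 16))) =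
              P * (1 / 4 + m + a / 2 + 2 * (m * a) + 64 * (m ^ 17 * a) + 64 * (m ^ 16 * a)) -
                2 * a * m * x := by ring
            have h2 : 0 ≤ 2 * a * m * x := by positivity
            have h3 : P * (1 / 4 + m + a / 2 + 2 * (m * a) + 64 * (m ^ 17 * a) + 64 * (m ^ 16 * a))
              ≤ P * (m + 1) := mul_le_mul_of_nonneg_left (by linarith) hP.le
            linarith
          calc _ ≤ 2 * ((m : ℝ) ^ 4 * ((m + 1) * P)) := by
                refine mul_le_mul_of_nonneg_left (mul_le_mul_of_nonneg_left key ?_) ?_ <;> positivity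
            _ = _ := by ring
  · refine (MLLFC.sum_meanPower_fbInput_le i).trans ?_
    rw [hC, Nat.add_sub_cancel]
    -- Since `m (1 + 1/m) = m + 1`, the silent step exactly offsets the excess of the lattice.
    calc _ ≤ 2 * ((m : ℝ≥0∞) * ENNReal.ofReal ((m ^ 4 : ℕ) * (Pt * (1 + 1 / m)))) := by
          gcongr
      _ = ENNReal.ofReal (2 * (m * ((m ^ 4 : ℕ) * (Pt * (1 + 1 / m))))) := by
          generalize ((m ^ 4 : ℕ) : ℝ) * (Pt * (1 + 1 / m)) = e
          rw [ENNReal.ofReal_mul (by norm_num), ENNReal.ofReal_mul (by positivity),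
            ENNReal.ofReal_natCast, ENNReal.ofReal_ofNat]
      _ ≤ _ := by
          refine ENNReal.ofReal_le_ofReal (le_of_eq ?_)
          change _ = ((C.lfc.N * 2 * m ^ 4 : ℕ) : ℝ) * Pt
          rw [hC]
          push_cast
          field_simp
  · change m ≤ C.lfc.N * 2 * m ^ 4
    rw [hC]
    have : 1 ≤ m ^ 4 := Nat.one_le_pow _ _ hm1
    nlinarith
  · rw [MLLFC.rate_eq, hC]
    push_cast
    rfl
  · exact (MLLFC.errorProb_le hK hvt.le hK'' G hG).trans (add_le_add hA le_rfl)


/-- Rate loss of the concatenation. -/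
lemma abs_logb_div_sub_le {M D N j τ : ℕ} (hM : 0 < M) (hD : 0 < D) (hN : 0 < N) (hj : 0 < j)
    (h1 : D ≤ M ^ (j * τ)) (h2 : M ^ (j * τ) ≤ 2 ^ (j * τ) * M ^ (2 * τ) * D) :
    |Real.logb 2 D / ((j * τ * N : ℕ) + 1) - Real.logb 2 M / N| ≤
      Real.logb 2 M / N / ((j * τ * N : ℕ) + 1) + 1 / N + 2 * (Real.logb 2 M / N) / j := by
  have hM' : (1 : ℝ) ≤ M := by exact_mod_cast hM
  have hN' : (0 : ℝ) < N := by exact_mod_cast hN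
  have hj' : (0 : ℝ) < j := by exact_mod_cast hj
  have hD' : (0 : ℝ) < D := by exact_mod_cast hD
  set ρ := Real.logb 2 M / N with hρ
  have hρ0 : 0 ≤ ρ := div_nonneg (Real.logb_nonneg (by norm_num) hM') hN'.le
  have hlM : Real.logb 2 M = N * ρ := by rw [hρ]; field_simp
  have g1 : Real.logb 2 D ≤ j * τ * (N * ρ) := by
    have := Real.logb_le_logb_of_le (b := 2) (by norm_num) hD'
      (show (D : ℝ) ≤ (M : ℝ) ^ (j * τ) by exact_mod_cast h1)
    rw [Real.logb_pow, hlM] at this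
    push_cast at this
    exact this
  have g2 : j * τ * (N * ρ) ≤ j * τ + 2 * τ * (N * ρ) + Real.logb 2 D := by
    have := Real.logb_le_logb_of_le (b := 2) (by norm_num) (by positivity)
      (show (M : ℝ) ^ (j * τ) ≤ 2 ^ (j * τ) * (M : ℝ) ^ (2 * τ) * D by exact_mod_cast h2)
    rw [Real.logb_mul (by positivity) (by positivity), Real.logb_mul (by positivity) (by positivity),
      Real.logb_pow, Real.logb_pow, Real.logb_pow, hlM, Real.logb_self_eq_one (by norm_num)] at this
    push_cast at this
    linarith
  push_cast
  have hm : (0 : ℝ) < j * τ * N + 1 := by positivity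
  -- The three losses: the factor `2^T` of the Gilbert–Varshamov bound costs `1 / N`, the minimum
  -- distance `2 τ` out of `j τ` costs `2 ρ / j`, and the idle round costs `ρ / (j τ N + 1)`.
  have e1 : (j * τ : ℝ) / (j * τ * N + 1) ≤ 1 / N := by
    rw [div_le_div_iff₀ hm hN']; linarith
  have e2 : (2 * τ * (N * ρ) : ℝ) / (j * τ * N + 1) ≤ 2 * ρ / j := by
    rw [div_le_div_iff₀ hm hj']
    have : 2 * τ * (N * ρ) * j = 2 * ρ * (j * τ * N) := by ring
    rw [this]
    gcongr
    linarith
  have e3 : ρ = j * τ * (N * ρ) / (j * τ * N + 1) + ρ / (j * τ * N + 1) := by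
    field_simp
  have e4 : Real.logb 2 D / (j * τ * N + 1) ≤ j * τ * (N * ρ) / (j * τ * N + 1) := by gcongr
  have e5 : j * τ * (N * ρ) / (j * τ * N + 1) ≤ j * τ / (j * τ * N + 1) +
      2 * τ * (N * ρ) / (j * τ * N + 1) + Real.logb 2 D / (j * τ * N + 1) := by
    rw [← add_div, ← add_div]; gcongr
  have e6 : 0 ≤ ρ / (j * τ * N + 1) := by positivity
  have e7 : (0 : ℝ) ≤ 1 / N := by positivity
  have e8 : 0 ≤ 2 * ρ / j := by positivity
  rw [abs_le]
  constructor <;> linarith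

/-- With `m = T N` this is the union bound over `2 m⁴` instances, each failing with probability at
most `(1 + 4 m) / 2^T`. -/
lemma tendsto_natCast_pow_five_div_two_pow (N : ℕ) :
    Tendsto (fun T : ℕ => 2 * ((T * N : ℕ) : ℝ) ^ 4 * ((1 + 4 * (T * N : ℕ)) / 2 ^ T)) atTop
      (𝓝 0) := by
  have h5 := (tendsto_pow_const_div_const_pow_of_one_lt 5 (show (1 : ℝ) < 2 by norm_num)).const_mul
    (8 * (N : ℝ) ^ 5)
  have h4 := (tendsto_pow_const_div_const_pow_of_one_lt 4 (show (1 : ℝ) < 2 by norm_num)).const_mul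
    (2 * (N : ℝ) ^ 4)
  have h := h5.add h4
  simp only [mul_zero, add_zero] at h
  refine h.congr fun T => ?_
  push_cast
  ring

/-- Approximation of the performance of the linear feedback schemes by a single modulo-lattice
scheme. -/
lemma exists_mllfc_approx {P Pt vt : ℝ} {K K' : Matrix (Fin 2) (Fin 2) ℝ} (hP : 0 < P)
    (hvt : 0 < vt) (hPt : vt < Pt) (hK : K.PosSemidef)
    (hK' : K' = K + (vt * (P / Pt)) • !![1, 1; 1, 1]) {S : ℕ → LFC} {R : Fin 2 → ℝ}
    (hpow : ∀ k, (S k).HasConstantPower K' (P * (1 - vt / Pt)))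
    (hN : Tendsto (fun k => (S k).N) atTop atTop)
    (hR : ∀ i, Tendsto (fun k => (S k).rate i) atTop (𝓝 (R i)))
    (hPe : Tendsto (fun k => (S k).errorProb K') atTop (𝓝 0)) (n : ℕ) {η : ℝ} (hη : 0 < η) :
    ∃ C : MLLFC, C.toScheme.SatisfiesPower K vt P Pt ∧ n ≤ C.len ∧
      (∀ i, |C.toScheme.rate i - R i| ≤ η) ∧ C.toScheme.errorProb K vt ≤ ENNReal.ofReal η := by
  have hPt0 : 0 < Pt := hvt.trans hPt
  have hK'p : K'.PosSemidef := hK' ▸ posSemidef_add_smul_one hK (by positivity)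
  have hQ : 0 ≤ P * (1 - vt / Pt) := by
    have : vt / Pt ≤ 1 := (div_le_one hPt0).2 hPt.le
    exact mul_nonneg hP.le (by linarith)
  have hQP : P * (1 - vt / Pt) ≤ P := by
    have : 0 < vt / Pt := by positivity
    nlinarith
  obtain ⟨B, hB0, hB⟩ : ∃ B : ℝ, 0 < B ∧ ∀ i, R i + 1 ≤ B := by
    refine ⟨|R 0| + |R 1| + 1, by positivity, fun i => ?_⟩
    have h0 := abs_nonneg (R 0)
    have h1 := abs_nonneg (R 1)
    have h2 := le_abs_self (R i)
    fin_cases i <;> simp at h2 ⊢ <;> linarith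
  -- The outer code corrects about a fraction `1 / j` of erroneous repetitions; `j` is chosen so
  -- that its rate loss is at most `η / 4`.
  obtain ⟨j, hj⟩ := exists_nat_ge (8 * B / η)
  have hj0 : (0 : ℝ) < j := lt_of_lt_of_le (by positivity) hj
  have hjn : 0 < j := by exact_mod_cast hj0
  have hjB : 2 * B / j ≤ η / 4 := by
    rw [div_le_iff₀ hη] at hj
    rw [div_le_iff₀ hj0]
    linarith
  -- An inner error below `4^(-j)` is enough: with `T = j τ` repetitions, `2^T (4^(-j))^τ = 2^(-T)`.
  have hεpos : (0 : ℝ≥0∞) < ENNReal.ofReal ((1 / 4) ^ j) := by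
    rw [ENNReal.ofReal_pos]; positivity
  have hRk : ∀ᶠ k in atTop, ∀ i, |(S k).rate i - R i| ≤ min (η / 4) 1 := by
    refine eventually_all.2 fun i => ?_
    have := (hR i).eventually (Metric.closedBall_mem_nhds (R i)
      (show 0 < min (η / 4) 1 by positivity))
    filter_upwards [this] with k hk
    exact hk
  obtain ⟨n₁, hn₁⟩ := exists_nat_ge (4 / η)
  -- From here on the inner scheme `S k` is fixed and only the number of repetitions grows. Its
  -- length is taken large because of the loss `1 / N` in the rate.
  obtain ⟨k, hkR, hkN, hkN1, hkE⟩ := (hRk.and ((hN.eventually_ge_atTop n₁).and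
    ((hN.eventually_ge_atTop 1).and (hPe.eventually_lt_const hεpos)))).exists
  have hN0 : (0 : ℝ) < (S k).N := by exact_mod_cast hkN1
  have hNη : 1 / ((S k).N : ℝ) ≤ η / 4 := by
    have h1 : 4 / η ≤ (S k).N := hn₁.trans (by exact_mod_cast hkN)
    rw [div_le_iff₀ hη] at h1
    rw [div_le_iff₀ hN0]
    linarith
  obtain ⟨⟨g, hg⟩, hgE⟩ := iInf_lt_iff.1 hkE
  have hmt : Tendsto (fun τ => j * τ * (S k).N) atTop atTop :=
    tendsto_atTop_mono (fun τ => by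
      calc τ = 1 * τ * 1 := by ring
        _ ≤ j * τ * (S k).N := by gcongr; omega) tendsto_id
  have hTt : Tendsto (fun τ => j * τ) atTop atTop :=
    tendsto_atTop_mono (fun τ => Nat.le_mul_of_pos_left τ hjn) tendsto_id
  obtain ⟨n₂, hn₂⟩ := exists_nat_ge (B * 4 / η)
  obtain ⟨τ, hτC, hτA, hτE, hτn, hτB⟩ := ((hmt.eventually (exists_mllfc hP hvt hPt hK hK')).and
    ((hmt.eventually (eventually_pow_mul_aliasBound_le 0 (half_pos hη))).and
    (((tendsto_natCast_pow_five_div_two_pow (S k).N).comp hTt |>.eventually_le_const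
      (half_pos hη)).and
    ((hmt.eventually_ge_atTop n).and (hmt.eventually_ge_atTop n₂))))).exists
  simp only [Function.comp_apply] at hτE
  rw [pow_zero, one_mul] at hτA
  set m := j * τ * (S k).N with hm
  set T := j * τ with hT
  -- This weight makes the error term cost exactly `P / 4`, the part of the idle round's power
  -- reserved in `exists_mllfc`.
  set A : ℝ := 2 ^ T * (P / 4) with hA
  have hA0 : 0 < A := by positivity
  obtain ⟨D, G, hDN, hDM, hG, hresp, htrade⟩ := LFC.exists_concat hK'p (hpow k) hg
    (ε := ENNReal.ofReal ((1 / 4) ^ j)) hgE.le K T τ (ENNReal.ofReal A)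
  have htrade' := htrade.trans (show _ ≤ ENNReal.ofReal (P / 4 + m * (P * (1 - vt / Pt))) by
    have h1 : (2 : ℝ≥0∞) ^ T * ENNReal.ofReal ((1 / 4) ^ j) ^ τ =
        ENNReal.ofReal (2 ^ T * ((1 / 4) ^ j) ^ τ) := by
      rw [ENNReal.ofReal_mul (by positivity), ENNReal.ofReal_pow (p := 2) (by norm_num),
        ENNReal.ofReal_pow (p := (1 / 4) ^ j) (by positivity), ENNReal.ofReal_ofNat]
    have h2 : (T : ℝ≥0∞) * ((S k).N * ENNReal.ofReal (P * (1 - vt / Pt))) =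
        ENNReal.ofReal (m * (P * (1 - vt / Pt))) := by
      rw [ENNReal.ofReal_mul (p := m) (by positivity), ENNReal.ofReal_natCast, hm]
      push_cast
      ring
    have h3 : A * (2 ^ T * ((1 / 4) ^ j) ^ τ) = P / 4 := by
      rw [hA, ← pow_mul]
      have : (2 : ℝ) ^ T * 2 ^ T * (1 / 4) ^ T = 1 := by
        rw [← mul_pow, ← mul_pow]; norm_num
      linear_combination P / 4 * this
    rw [h1, h2, ← ENNReal.ofReal_mul hA0.le, h3, ENNReal.ofReal_add (by positivity) (by positivity)])
  obtain ⟨C, hCp, hCl, hCr, hCe⟩ := hτC D G hDN hG hresp (le_add_self.trans htrade')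
  refine ⟨C, hCp, hτn.trans hCl, fun i => ?_, hCe.trans ?_⟩
  · rw [hCr]
    have h1 := abs_logb_div_sub_le ((S k).M_pos i) (D.M_pos i) hkN1 hjn (hDM i).1 (hDM i).2
    have h2 := hkR i
    change |Real.logb 2 ((S k).M i) / (S k).N - R i| ≤ _ at h2
    set ρ := Real.logb 2 ((S k).M i) / (S k).N
    have h3 : ρ ≤ B := by
      have := (abs_le.1 (h2.trans (min_le_right _ _))).2
      linarith [hB i]
    have h4 : |ρ - R i| ≤ η / 4 := h2.trans (min_le_left _ _)
    have h5 : 2 * ρ / j ≤ η / 4 := le_trans (by gcongr) hjB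
    have h6 : ρ / ((m : ℕ) + 1) ≤ η / 4 := by
      have h7 : B * 4 / η ≤ m := hn₂.trans (by exact_mod_cast hτB)
      rw [div_le_iff₀ hη] at h7
      rw [div_le_iff₀ (by positivity)]
      nlinarith
    calc |Real.logb 2 (D.M i) / (m + 1) - R i|
        ≤ |Real.logb 2 (D.M i) / (m + 1) - ρ| + |ρ - R i| := abs_sub_le _ _ _
      _ ≤ _ := by linarith
  -- The weighted sum is at most `P / 4 + m P`; dividing by the exponentially large `A` bounds the
  -- error.
  · have herr : uniformAvg (fun w => effLaw D.N K K' (D.errorEvent G w)) ≤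
        ENNReal.ofReal ((1 + 4 * m) / 2 ^ T) := by
      have h1 : ENNReal.ofReal A * uniformAvg (fun w => effLaw D.N K K' (D.errorEvent G w)) ≤
          ENNReal.ofReal (P / 4 * (1 + 4 * m)) := by
        refine (le_self_add.trans htrade').trans (ENNReal.ofReal_le_ofReal ?_)
        have : m * (P * (1 - vt / Pt)) ≤ m * P := by gcongr
        linarith
      have h2 : (1 + 4 * (m : ℝ)) / 2 ^ T = P / 4 * (1 + 4 * m) / A := by
        rw [hA]; field_simp
      rw [h2, ENNReal.ofReal_div_of_pos hA0, ENNReal.le_div_iff_mul_le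
        (Or.inl (ENNReal.ofReal_pos.2 hA0).ne') (Or.inl ENNReal.ofReal_ne_top), mul_comm]
      exact h1
    calc _ ≤ ENNReal.ofReal (η / 2) +
          2 * ((m ^ 4 : ℕ) * ENNReal.ofReal ((1 + 4 * m) / 2 ^ T)) := by gcongr
      _ = ENNReal.ofReal (η / 2 + 2 * (m : ℝ) ^ 4 * ((1 + 4 * m) / 2 ^ T)) := by
          have : (0 : ℝ) ≤ (1 + 4 * m) / 2 ^ T := by positivity
          generalize (1 + 4 * (m : ℝ)) / 2 ^ T = e at this
          rw [ENNReal.ofReal_add (by positivity) (by positivity), mul_assoc,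
            ENNReal.ofReal_mul (by norm_num), ENNReal.ofReal_mul (by positivity),
            ENNReal.ofReal_ofNat, ← Nat.cast_pow, ENNReal.ofReal_natCast]
      _ ≤ ENNReal.ofReal η := by
          refine ENNReal.ofReal_le_ofReal ?_
          linarith


end

end BCFeedback


theorem theorem1 (P Pt σ₁ σ₂ r vt : ℝ) (hP : 0 < P) (hσ₁ : 0 < σ₁) (hσ₂ : 0 < σ₂)
    (hr : |r| ≤ 1) (hvt : 0 < vt) (hPt : vt < Pt)
    (KZ Keq : Matrix (Fin 2) (Fin 2) ℝ) (hKZ : KZ = noiseCov σ₁ σ₂ r)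
    (hKeq : Keq = KZ + (vt * (P / Pt)) • !![1, 1; 1, 1])
    (Peq : ℝ) (hPeq : Peq = P * (1 - vt / Pt))
    (S : ℕ → LFC) (R : Fin 2 → ℝ)
    (hpow : ∀ k, (S k).HasConstantPower Keq Peq)
    (hN : Tendsto (fun k => (S k).N) atTop atTop)
    (hR : ∀ i, Tendsto (fun k => (S k).rate i) atTop (𝓝 (R i)))
    (hPe : Tendsto (fun k => (S k).errorProb Keq) atTop (𝓝 0)) :
    ∃ C : ℕ → MLLFC,
      (∀ k, (C k).toScheme.SatisfiesPower KZ vt P Pt) ∧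
      Tendsto (fun k => (C k).len) atTop atTop ∧
      (∀ i, Tendsto (fun k => (C k).toScheme.rate i) atTop (𝓝 (R i))) ∧
      Tendsto (fun k => (C k).toScheme.errorProb KZ vt) atTop (𝓝 0) := by
  have hK : KZ.PosSemidef := hKZ ▸ posSemidef_noiseCov hr
  subst hPeq
  have hη : Tendsto (fun k : ℕ => 1 / ((k : ℝ) + 1)) atTop (𝓝 0) :=
    tendsto_one_div_add_atTop_nhds_zero_nat
  -- The `k`-th scheme has length at least `k` and tolerance `1 / (k + 1)`.
  choose C hCp hCl hCr hCe using fun k : ℕ => exists_mllfc_approx hP hvt hPt hK hKeq hpow hN hR hPe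
    k (show 0 < 1 / ((k : ℝ) + 1) by positivity)
  refine ⟨C, hCp, tendsto_atTop_mono hCl tendsto_id, fun i => ?_, ?_⟩
  · exact tendsto_iff_dist_tendsto_zero.2
      (squeeze_zero (fun _ => dist_nonneg) (fun k => (Real.dist_eq _ _).trans_le (hCr k i)) hη)
  · refine tendsto_of_tendsto_of_tendsto_of_le_of_le tendsto_const_nhds ?_ (fun _ => zero_le) hCe
    have h := (ENNReal.continuous_ofReal.tendsto 0).comp hη
    rwa [ENNReal.ofReal_zero] at h
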